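/- Let $M$ be a smooth, Hausdorff, second countable, connected manifold of dimension $n\ge 2$, let $h$ be a smooth Riemannian metric on $M$, and let $g$ be a locally Lipschitz continuous Lorentzian metric on $M$ of signature $(-,+,\dots,+)$. A vector field $X$ is $g$-timelike if $g(X,X)<0$ everywhere. *Regularisation.* Fix a countable locally finite cover of $M$ by relatively compact domains $U_\alpha$ of smooth charts $\psi_\alpha$, a smooth partition of unity $(\xi_\alpha)$ with $\operatorname{supp}\xi_\alpha\subseteq U_\alpha$, cut-off functions $\chi_\alpha\in C_c^\infty(U_\alpha)$ with $\chi_\alpha=1$ on a neighbourhood of $\operatorname{supp}\xi_\alpha$, and a nonnegative $\varrho\in C_c^\infty(B_1(0))$, $B_1(0)\subseteq\mathbb R^n$, with $\int\varrho=1$; put $\varrho_\varepsilon(x)=\varepsilon^{-n}\varrho(x/\varepsilon)$ and $$g_\varepsilon:=\sum_\alpha \chi_\alpha\,(\psi_\alpha)^*\big[\big((\psi_\alpha)_*(\xi_\alpha g)\big)*\varrho_\varepsilon\big]\qquad(0<\varepsilon\le 1),$$ with componentwise convolution on $\mathbb R^n$. Let $(\varepsilon_k)$ be a sequence in $(0,1]$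 with $\varepsilon_k\to0$, and let $(g_k)$ be smooth Lorentzian metrics on $M$ with strictly narrower light cones than $g$ (i.e. $v\ne0$ and $g_k(v,v)\le 0$ imply $g(v,v)<0$) such that $g_k-g_{\varepsilon_k}\to 0$ in $C^\infty_{\mathrm{loc}}(M)$ and, for each compact set $K$, $\sup_K\|g_k-g_{\varepsilon_k}\|_h\le C_K\,\varepsilon_k$ for all $k$. *Distributional bound.* $\mathrm{Ric}[g]$ is the distributional Ricci tensor, in local coordinates $\mathrm{Ric}_{ij}=\partial_m\Gamma^m_{ij}-\partial_j\Gamma^m_{im}+\Gamma^m_{ij}\Gamma^l_{ml}-\Gamma^m_{il}\Gamma^l_{jm}$ with $\Gamma^m_{ij}\in L^\infty_{\mathrm{loc}}$ and distributional outer derivatives. Suppose that for some $\rho\in\mathbb R$ and every smooth $g$-timelike vector field $X$ on $M$ the scalar distribution $\mathrm{Ric}[g](X,X)-\rho\, g(X,X)$ is nonnegative, i.e. nonnegative on nonnegative test densities. *Claim.* Let $(X_k)$ be a sequence of smooth vector fields on $M$ which is locally uniformly bounded (for each compact $K$, $\sup_k\sup_K\|X_k\|_h<\infty$) and locally uniformly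 $g$-timelike (for each compact $K$ there is $c<0$ with $g(X_k,X_k)<c$ on $K$ for all $k$). Then for every compact $K\subseteq M$ and every $p\in[1,\infty)$ $$\big(\mathrm{Ric}[g_k](X_k,X_k)-\rho\,g_k(X_k,X_k)\big)_-\to 0\quad\text{in }L^p(K)\text{ as }k\to\infty,$$ where $f_-=\max(-f,0)$ is the negative part. -/

import Mathlib

open Set Filter Topology MeasureTheory Manifold
open scoped ContDiff ENNReal

noncomputable section

namespace LipschitzSpacetime

/-- The model space `ℝⁿ` with its Euclidean norm. -/
abbrev Model (n : ℕ) : Type := EuclideanSpace ℝ (Fin n)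

/-! ## Coordinate expressions on `ℝⁿ`

A metric in coordinates is a matrix-valued function `G`, and a vector field in coordinates is a
function `X : ℝⁿ → ℝⁿ`. -/

/-- The partial derivative `∂ₖ f`. -/
def pderiv {n : ℕ} (k : Fin n) (f : Model n → ℝ) (y : Model n) : ℝ :=
  fderiv ℝ f y (EuclideanSpace.single k 1)

/-- The Christoffel symbol `Γᵏᵢⱼ = ½ gᵏˡ (∂ᵢ gⱼₗ + ∂ⱼ gᵢₗ - ∂ₗ gᵢⱼ)`. If the components of `G` are
locally Lipschitz, the derivatives exist almost everywhere and agree with the weak derivatives. -/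
def christoffel {n : ℕ} (G : Model n → Matrix (Fin n) (Fin n) ℝ) (k i j : Fin n)
    (y : Model n) : ℝ :=
  (1 / 2 : ℝ) * ∑ l, (G y)⁻¹ k l *
    (pderiv i (fun z => G z j l) y + pderiv j (fun z => G z i l) y - pderiv l (fun z => G z i j) y)

/-- The part `Γᵏᵢⱼ Γˡₖₗ - Γᵏᵢₗ Γˡⱼₖ` of the Ricci tensor. -/
def ricciQuadratic {n : ℕ} (G : Model n → Matrix (Fin n) (Fin n) ℝ) (i j : Fin n)
    (y : Model n) : ℝ :=
  ∑ k, ∑ l, (christoffel G k i j y * christoffel G l k l y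
    - christoffel G k i l y * christoffel G l j k y)

/-- The Ricci tensor of a smooth metric,
`Ricᵢⱼ = ∂ₖ Γᵏᵢⱼ - ∂ⱼ Γᵏᵢₖ + Γᵏᵢⱼ Γˡₖₗ - Γᵏᵢₗ Γˡⱼₖ`. -/
def ricci {n : ℕ} (G : Model n → Matrix (Fin n) (Fin n) ℝ) (i j : Fin n) (y : Model n) : ℝ :=
  (∑ k, (pderiv k (christoffel G k i j) y - pderiv j (christoffel G k i k) y))
    + ricciQuadratic G i j y

/-- `Ric(X, X)` for a smooth metric. -/
def ricciEval {n : ℕ} (G : Model n → Matrix (Fin n) (Fin n) ℝ) (X : Model n → Model n)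
    (y : Model n) : ℝ :=
  ∑ i, ∑ j, ricci G i j y * X y i * X y j

/-- `g(X, X)`. -/
def metricEval {n : ℕ} (G : Model n → Matrix (Fin n) (Fin n) ℝ) (X : Model n → Model n)
    (y : Model n) : ℝ :=
  ∑ i, ∑ j, G y i j * X y i * X y j

/-- The distribution `Ric(X, X) = Ricᵢⱼ Xⁱ Xʲ` on the open set `U`, applied to the test function
`φ`. The Christoffel symbols are locally bounded functions, and the outer derivatives in
`Ricᵢⱼ = ∂ₖ Γᵏᵢⱼ - ∂ⱼ Γᵏᵢₖ + Γᵏᵢⱼ Γˡₖₗ - Γᵏᵢₗ Γˡⱼₖ` are taken in the sense of distributions. -/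
def ricciDistribution {n : ℕ} (U : Set (Model n)) (G : Model n → Matrix (Fin n) (Fin n) ℝ)
    (X : Model n → Model n) (φ : Model n → ℝ) : ℝ :=
  ∑ i, ∑ j, ∫ y in U,
    ((∑ k, (-(christoffel G k i j y * pderiv k (fun z => X z i * X z j * φ z) y)
        + christoffel G k i k y * pderiv j (fun z => X z i * X z j * φ z) y))
      + ricciQuadratic G i j y * (X y i * X y j * φ y))

/-! ## Tensor fields on a manifold -/

variable {n : ℕ} {M : Type*} [TopologicalSpace M] [ChartedSpace (Model n) M]

/-- The atlas of all smooth charts of `M`. -/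
abbrev smoothCharts (n : ℕ) (M : Type*) [TopologicalSpace M] [ChartedSpace (Model n) M] :
    Set (OpenPartialHomeomorph M (Model n)) :=
  IsManifold.maximalAtlas (𝓡 n) ∞ M

/-- Fields of bilinear forms (covariant tensor fields of rank two), without regularity. -/
abbrev BilinField (n : ℕ) (M : Type*) [TopologicalSpace M] [ChartedSpace (Model n) M] : Type _ :=
  ∀ x : M, TangentSpace (𝓡 n) x →L[ℝ] TangentSpace (𝓡 n) x →L[ℝ] ℝ

/-- Vector fields, without regularity. -/
abbrev VectorField (n : ℕ) (M : Type*) [TopologicalSpace M] [ChartedSpace (Model n) M] : Type _ :=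
  ∀ x : M, TangentSpace (𝓡 n) x

/-- The push-forward `ψ_* T` of a field of bilinear forms under a chart `ψ`; meaningful on
`ψ.target`. -/
def pushBilin (ψ : OpenPartialHomeomorph M (Model n)) (T : BilinField n M) (y : Model n) :
    Model n →L[ℝ] Model n →L[ℝ] ℝ :=
  ContinuousLinearMap.bilinearComp (E := Model n) (F := Model n) (T (ψ.symm y))
    (mfderiv (𝓡 n) (𝓡 n) ψ.symm y) (mfderiv (𝓡 n) (𝓡 n) ψ.symm y)

/-- The components of a field of bilinear forms in a chart. -/
def gram (ψ : OpenPartialHomeomorph M (Model n)) (T : BilinField n M) (y : Model n) :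
    Matrix (Fin n) (Fin n) ℝ :=
  Matrix.of fun i j =>
    pushBilin ψ T y (EuclideanSpace.single i 1) (EuclideanSpace.single j 1)

/-- The push-forward of a vector field under a chart `ψ`; meaningful on `ψ.target`. -/
def pushVector (ψ : OpenPartialHomeomorph M (Model n)) (X : VectorField n M) (y : Model n) :
    Model n :=
  mfderiv (𝓡 n) (𝓡 n) ψ (ψ.symm y) (X (ψ.symm y))

/-- Smoothness of a vector field. -/
def SmoothVectorField [IsManifold (𝓡 n) ∞ M] (X : VectorField n M) : Prop :=
  ContMDiff (𝓡 n) (𝓡 n).tangent ∞ (fun x => (⟨x, X x⟩ : TangentBundle (𝓡 n) M))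

/-- Lorentzian metrics (without regularity): symmetric bilinear forms of signature
`(-, +, …, +)` at each point. -/
structure IsLorentzian (g : BilinField n M) : Prop where
  symm : ∀ x v w, g x v w = g x w v
  signature : ∀ x, ∃ v, g x v v < 0 ∧ ∀ w, g x v w = 0 → w ≠ 0 → 0 < g x w w

/-- `T` is smooth. -/
def SmoothBilin (T : BilinField n M) : Prop :=
  ∀ ψ ∈ smoothCharts n M, ContDiffOn ℝ ∞ (pushBilin ψ T) ψ.target

/-- `T` is locally Lipschitz continuous. -/
def LocLipschitzBilin (T : BilinField n M) : Prop :=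
  ∀ ψ ∈ smoothCharts n M, LocallyLipschitzOn ψ.target (pushBilin ψ T)

/-- `T k → 0` in `C^∞_loc`: in every chart all derivatives converge to `0` uniformly on compact
sets. -/
def TendstoZeroSmoothLoc (T : ℕ → BilinField n M) : Prop :=
  ∀ ψ ∈ smoothCharts n M, ∀ L ⊆ ψ.target, IsCompact L → ∀ m : ℕ,
    TendstoUniformlyOn (fun k y => iteratedFDeriv ℝ m (pushBilin ψ (T k)) y) 0 atTop L

/-- `T k = O(ε k)` uniformly on compact sets. -/
def LocUniformlyBigO (ε : ℕ → ℝ) (T : ℕ → BilinField n M) : Prop :=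
  ∀ ψ ∈ smoothCharts n M, ∀ L ⊆ ψ.target, IsCompact L →
    ∃ C : ℝ, ∀ k, ∀ y ∈ L, ‖pushBilin ψ (T k) y‖ ≤ C * ε k

/-- `g₁ ≺ g₂`: `g₁` has strictly narrower light cones than `g₂`. -/
def NarrowerCones (g₁ g₂ : BilinField n M) : Prop :=
  ∀ x, ∀ v : TangentSpace (𝓡 n) x, v ≠ 0 → g₁ x v v ≤ 0 → g₂ x v v < 0

/-- `X` is `g`-timelike. -/
def Timelike (g : BilinField n M) (X : VectorField n M) : Prop :=
  ∀ x, g x (X x) (X x) < 0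

/-- The sequence `X k` is locally uniformly `g`-timelike. -/
def LocUniformlyTimelike (g : BilinField n M) (X : ℕ → VectorField n M) : Prop :=
  ∀ K : Set M, IsCompact K → ∃ c < 0, ∀ k, ∀ x ∈ K, g x (X k x) (X k x) < c

/-- The sequence `X k` is locally uniformly bounded with respect to the norm
`‖v‖_h = (h(v, v))^(1/2)`. -/
def LocUniformlyBounded (h : BilinField n M) (X : ℕ → VectorField n M) : Prop :=
  ∀ K : Set M, IsCompact K → ∃ C : ℝ, ∀ k, ∀ x ∈ K, Real.sqrt (h x (X k x) (X k x)) ≤ C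

/-- `Ric[g](X, X) ≥ c g(X, X)` in the sense of distributions on `M`: in every chart, the
distribution `Ric[g](X, X) - c g(X, X)` is nonnegative on nonnegative test functions (densities). -/
def RicciLowerBound (g : BilinField n M) (c : ℝ) (X : VectorField n M) : Prop :=
  ∀ ψ ∈ smoothCharts n M, ∀ φ : Model n → ℝ, ContDiff ℝ ∞ φ → HasCompactSupport φ →
    tsupport φ ⊆ ψ.target → (∀ y, 0 ≤ φ y) →
    0 ≤ ricciDistribution ψ.target (gram ψ g) (pushVector ψ X) φ
      - c * ∫ y in ψ.target, metricEval (gram ψ g) (pushVector ψ X) y * φ y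

/-! ## Regularisation by convolution in charts -/

/-- The choices in the definition of the convolution `⋆_M`: a countable locally finite cover by
relatively compact chart domains, a subordinate partition of unity `ξ`, cut-off functions `χ` and a
nonnegative mollifier `ρ` supported in the open unit ball. -/
structure RegularisationData (n : ℕ) (M : Type*) [TopologicalSpace M]
    [ChartedSpace (Model n) M] where
  ψ : ℕ → OpenPartialHomeomorph M (Model n)
  ψ_mem : ∀ α, ψ α ∈ smoothCharts n M
  relatively_compact : ∀ α, IsCompact (closure (ψ α).source)
  locally_finite : LocallyFinite fun α => (ψ α).source
  cover : ⋃ α, (ψ α).source = univ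
  ξ : SmoothPartitionOfUnity ℕ (𝓡 n) M
  ξ_subordinate : ξ.IsSubordinate fun α => (ψ α).source
  χ : ℕ → M → ℝ
  χ_smooth : ∀ α, ContMDiff (𝓡 n) 𝓘(ℝ, ℝ) ∞ (χ α)
  χ_compact : ∀ α, HasCompactSupport (χ α)
  χ_support : ∀ α, tsupport (χ α) ⊆ (ψ α).source
  χ_eq_one : ∀ α, ∀ᶠ x in 𝓝ˢ (tsupport (ξ α)), χ α x = 1
  ρ : Model n → ℝ
  ρ_smooth : ContDiff ℝ ∞ ρ
  ρ_compact : HasCompactSupport ρ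
  ρ_support : tsupport ρ ⊆ Metric.ball 0 1
  ρ_nonneg : ∀ x, 0 ≤ ρ x
  ρ_integral : ∫ x, ρ x = 1

/-- `ρ_ε(x) = ε⁻ⁿ ρ(x / ε)`. -/
def RegularisationData.mollifier (d : RegularisationData n M) (ε : ℝ) (x : Model n) : ℝ :=
  (ε ^ n)⁻¹ * d.ρ (ε⁻¹ • x)

/-- The componentwise convolution `((ψ_α)_* (ξ_α T)) * ρ_ε` on `ℝⁿ`, where `(ψ_α)_* (ξ_α T)` is
extended by zero outside the image of the chart. -/
def RegularisationData.chartConvolution (d : RegularisationData n M) (T : BilinField n M) (ε : ℝ)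
    (α : ℕ) (z : Model n) : Model n →L[ℝ] Model n →L[ℝ] ℝ :=
  ∫ y in (d.ψ α).target,
    (d.mollifier ε (z - y) * d.ξ α ((d.ψ α).symm y)) • pushBilin (d.ψ α) T y

/-- The regularisation `T ⋆_M ρ_ε = ∑_α χ_α (ψ_α)^* [((ψ_α)_* (ξ_α T)) * ρ_ε]`. -/
def RegularisationData.regularise (d : RegularisationData n M) (T : BilinField n M) (ε : ℝ) :
    BilinField n M := fun x =>
  (∑ᶠ α, d.χ α x • ContinuousLinearMap.bilinearComp (d.chartConvolution T ε α (d.ψ α x))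
    (E' := Model n) (F' := Model n)
    (mfderiv (𝓡 n) (𝓡 n) (d.ψ α) x) (mfderiv (𝓡 n) (𝓡 n) (d.ψ α) x) :
      Model n →L[ℝ] Model n →L[ℝ] ℝ)

/-- `g k` is a sequence of smooth Lorentzian metrics approximating `g` from the inside, i.e. with
strictly narrower light cones than `g` and such that, for some sequence `ε k → 0` in `(0, 1]`,
`g k - g ⋆_M ρ_{ε k}` tends to `0` in `C^∞_loc` and is `O(ε k)` locally uniformly (which is the rate
at which `g ⋆_M ρ_{ε k}` tends to the Lipschitz metric `g`). -/
structure IsInnerApproximation (d : RegularisationData n M) (g : BilinField n M)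
    (gk : ℕ → BilinField n M) : Prop where
  lorentzian : ∀ k, IsLorentzian (gk k)
  smooth : ∀ k, SmoothBilin (gk k)
  narrower : ∀ k, NarrowerCones (gk k) g
  close : ∃ ε : ℕ → ℝ, (∀ k, 0 < ε k ∧ ε k ≤ 1) ∧ Tendsto ε atTop (𝓝 0) ∧
    TendstoZeroSmoothLoc (fun k x => gk k x - d.regularise g (ε k) x) ∧
    LocUniformlyBigO ε (fun k x => gk k x - d.regularise g (ε k) x)

/-! ## The conclusion -/

/-- The negative part `(Ric[g](X, X) - c g(X, X))_-` of a smooth metric `g`, as a function on `M`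
written in the chart `ψ`; meaningful on `ψ.target`. -/
def ricciDeficit (ψ : OpenPartialHomeomorph M (Model n)) (g : BilinField n M) (c : ℝ)
    (X : VectorField n M) (y : Model n) : ℝ :=
  max (-(ricciEval (gram ψ g) (pushVector ψ X) y - c * metricEval (gram ψ g) (pushVector ψ X) y)) 0

/-- Convergence to `0` in `L^p(K)` of a sequence of functions on `M` given by their expressions
`f k ψ` in the charts `ψ` of `M`: the `L^p` norms tend to `0` on every compact part of `K` that
lies in a chart domain. As a compact `K` is a finite union of such parts, and any smooth positive
density is comparable to Lebesgue measure on each of them, this is convergence in `L^p(K)` with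
respect to any such density. -/
def TendstoZeroLp (K : Set M) (p : ℝ≥0∞)
    (f : ℕ → OpenPartialHomeomorph M (Model n) → Model n → ℝ) : Prop :=
  ∀ ψ ∈ smoothCharts n M, ∀ L : Set M, IsCompact L → L ⊆ K ∩ ψ.source →
    Tendsto (fun k => eLpNorm (f k ψ) p (volume.restrict (ψ '' L))) atTop (𝓝 0)

end LipschitzSpacetime

end

noncomputable section

namespace LipschitzSpacetime

/-! ## Parametric integrals -/

/-! Everything is local, so fix a chart and a compact subset `L` of its image. There the components
of the regularised metric are finite sums of operators u ↦ ∫ Φ(ε, x, w) u(x + εw) dw (`kernelOp`),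
applied to the Lipschitz components u of g, with kernels Φ that are smooth across ε = 0. Transition
maps, cut-offs and the partition of unity enter only through Φ, and at ε = 0 they recombine into a
single nonnegative scalar kernel H(0, x, ·) of mass one that acts on each component separately
(`RegularisationData.exists_kernel`). To leading order the regularisation is therefore an average in
one chart, with a mollifier depending on x.

An error is a sequence that is eventually bounded on `L` and tends to zero almost everywhere
(`BddTendsto`); for finite p dominated convergence makes it a null sequence in L^p. The derivatives
of the Christoffel symbols of g_k may grow like 1/ε, so they have to be compared with averages of
distributions. The core is a Friedrichs commutator estimate: ∂(g_k⁻¹ ∂g_k) is, up to an error, the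
distribution ∂(g⁻¹ ∂g) averaged with H (`RicciApproximation.bddTendsto_pderiv_inv_mul`). The bound
g_k⁻¹ - g⁻¹ = O(ε) pays for one factor 1/ε; in the commutator, difference quotients of g converge by
Rademacher's theorem and ∂g is averaged at its Lebesgue points. Consequently Ric[g_k] at x is, up to
an error, the distribution Ric[g] tested against y ↦ ε⁻ⁿ H(0, x, (y - x)/ε)
(`RicciApproximation.bddTendsto_ricci`).

For the sign, nothing is known about derivatives of X_k, so X_k itself is not inserted into the
distribution. Instead, for every x the vector v = X_k(x) is frozen to constant components in the
chart. By the Lipschitz bound it stays timelike on a ball whose radius depends neither on x nor on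
k, and it extends from a smaller ball to a global smooth timelike field
(`exists_timelike_extension`). The hypothesis for this field, with the test function above, says
that the averaged tensor Ric[g] - ρ g is nonnegative on v (`eventually_ricciAverage_nonneg`). Hence
the negative part at x is at most a constant times the errors (`bddTendsto_ricciDeficit`). -/

theorem contDiff_integral_Ioc {P F : Type*} [NormedAddCommGroup P] [NormedSpace ℝ P]
    [NormedAddCommGroup F] [NormedSpace ℝ F] {f : P × ℝ → F} (hf : ContDiff ℝ ∞ f) :
    ContDiff ℝ ∞ fun p => ∫ t in Ioc (0 : ℝ) 1, f (p, t) := by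
  -- The integral is the value at 0 of the convolution of the indicator of (0, 1] with s ↦ c(s) f(p,
  -- -s). The bump equals one on [-1, 1] and only serves to make the second factor compactly
  -- supported.
  let c : ContDiffBump (0 : ℝ) := ⟨1, 2, by norm_num, by norm_num⟩
  have key := contDiffOn_convolution_right_with_param_comp (𝕜 := ℝ) (n := ⊤) (μ := volume)
    (ContinuousLinearMap.lsmul ℝ ℝ) (s := (univ : Set P)) (v := fun _ => (0 : ℝ))
    contDiffOn_const (f := (Ioc (0 : ℝ) 1).indicator fun _ => (1 : ℝ))
    (g := fun p s => c s • f (p, -s)) (k := Metric.closedBall 0 2)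
    isOpen_univ (isCompact_closedBall 0 2) ?_ ?_ ?_
  · rw [contDiffOn_univ] at key
    convert! key using 2 with p
    rw [convolution, ← integral_indicator measurableSet_Ioc]
    refine integral_congr_ae (Eventually.of_forall fun t => ?_)
    by_cases ht : t ∈ Ioc (0 : ℝ) 1
    · have : c (0 - t) = 1 := c.one_of_mem_closedBall (by
        rw [zero_sub, mem_closedBall_zero_iff, norm_neg, Real.norm_eq_abs, abs_of_pos ht.1]
        exact ht.2)
      simp only [ContinuousLinearMap.lsmul_apply, indicator_of_mem ht, this, one_smul]
      simp
    · simp [indicator_of_notMem ht]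
  · intro p x _ hx
    rw [c.zero_of_le_dist, zero_smul]
    simp only [Metric.mem_closedBall, not_le] at hx
    exact hx.le
  · exact ((integrable_indicator_iff measurableSet_Ioc).2 (by simp)).locallyIntegrable
  · refine ContDiff.contDiffOn ?_
    have h1 : ContDiff ℝ ∞ fun q : P × ℝ => c q.2 := c.contDiff.comp contDiff_snd
    exact h1.smul (hf.comp (contDiff_fst.prodMk contDiff_snd.neg))

/-! ## Smooth kernels of convolution type -/

variable {n : ℕ}

/-- Smooth functions `Φ(ε, x, w)` with bounded support in `w`. -/
structure IsKernel (Φ : ℝ × Model n × Model n → ℝ) : Prop where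
  contDiff : ContDiff ℝ ∞ Φ
  support : ∃ R : ℝ, ∀ p, R ≤ ‖p.2.2‖ → Φ p = 0

/-- The operator `u ↦ ∫ Φ(ε, x, w) u(x + ε w) dw`. -/
def kernelOp (Φ : ℝ × Model n × Model n → ℝ) (ε : ℝ) (u : Model n → ℝ) (x : Model n) : ℝ :=
  ∫ w, Φ (ε, x, w) * u (x + ε • w)

/-- The derivative of a kernel in the variable `xᵢ`. -/
def dx (i : Fin n) (Φ : ℝ × Model n × Model n → ℝ) (p : ℝ × Model n × Model n) : ℝ :=
  fderiv ℝ Φ p (0, EuclideanSpace.single i 1, 0)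

/-- The derivative of a kernel in the variable `wᵢ`. -/
def dw (i : Fin n) (Φ : ℝ × Model n × Model n → ℝ) (p : ℝ × Model n × Model n) : ℝ :=
  fderiv ℝ Φ p (0, 0, EuclideanSpace.single i 1)

/-- The difference quotient `(Φ(ε, x, w) - Φ(0, x, w)) / ε`. -/
def epsQuotient (Φ : ℝ × Model n × Model n → ℝ) (p : ℝ × Model n × Model n) : ℝ :=
  ∫ t in Ioc (0 : ℝ) 1, fderiv ℝ Φ (t * p.1, p.2) (1, 0)

variable {Φ Ψ : ℝ × Model n × Model n → ℝ}

theorem IsKernel.fderiv_apply (h : IsKernel Φ) (v : ℝ × Model n × Model n) :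
    IsKernel fun p => fderiv ℝ Φ p v := by
  refine ⟨(h.contDiff.fderiv_right (m := ∞) (by simp)).clm_apply contDiff_const, ?_⟩
  obtain ⟨R, hR⟩ := h.support
  -- The derivative vanishes where Φ vanishes on a whole neighbourhood; enlarging the radius
  -- provides one.
  refine ⟨R + 1, fun p hp => ?_⟩
  have : Φ =ᶠ[𝓝 p] fun _ => 0 := by
    have ho : IsOpen {q : ℝ × Model n × Model n | R < ‖q.2.2‖} :=
      isOpen_lt continuous_const (by fun_prop)
    filter_upwards [ho.mem_nhds (show R < ‖p.2.2‖ by linarith)] with q hq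
    exact hR q (le_of_lt hq)
  rw [this.fderiv_eq]
  simp

theorem IsKernel.dx (h : IsKernel Φ) (i : Fin n) : IsKernel (dx i Φ) := h.fderiv_apply _

theorem IsKernel.dw (h : IsKernel Φ) (i : Fin n) : IsKernel (dw i Φ) := h.fderiv_apply _

theorem IsKernel.sum {ι : Type*} {s : Finset ι} {Φ : ι → ℝ × Model n × Model n → ℝ}
    (h : ∀ i ∈ s, IsKernel (Φ i)) : IsKernel fun p => ∑ i ∈ s, Φ i p := by
  refine ⟨ContDiff.sum fun i hi => (h i hi).contDiff, ?_⟩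
  choose! R hR using fun i hi => (h i hi).support
  -- Absolute values make the sum dominate each radius, whatever the signs.
  refine ⟨∑ i ∈ s, |R i|, fun p hp => Finset.sum_eq_zero fun i hi => hR i hi p ?_⟩
  exact (le_abs_self _).trans
    ((Finset.single_le_sum (f := fun i => |R i|) (fun i _ => abs_nonneg _) hi).trans hp)

/-- Regards the kernel frozen at ε = 0 as a kernel in its own right, so that the results on
operators at scale ε also apply to averages with H(0, x, ·). -/
theorem IsKernel.comp_zero (h : IsKernel Φ) : IsKernel fun p => Φ (0, p.2) := by
  refine ⟨h.contDiff.comp (contDiff_const.prodMk contDiff_snd), ?_⟩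
  obtain ⟨R, hR⟩ := h.support
  exact ⟨R, fun p hp => hR (0, p.2) hp⟩

theorem IsKernel.epsQuotient (h : IsKernel Φ) :
    IsKernel (LipschitzSpacetime.epsQuotient Φ) := by
  refine ⟨?_, ?_⟩
  · have h1 := (h.fderiv_apply (1, 0)).contDiff
    have h2 : ContDiff ℝ ∞ fun q : (ℝ × Model n × Model n) × ℝ => (q.2 * q.1.1, q.1.2) := by
      fun_prop
    exact contDiff_integral_Ioc (h1.comp h2)
  · obtain ⟨R, hR⟩ := (h.fderiv_apply (1, 0)).support
    refine ⟨R, fun p hp => ?_⟩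
    unfold LipschitzSpacetime.epsQuotient
    rw [setIntegral_congr_fun (g := fun _ => 0) measurableSet_Ioc]
    · simp
    · exact fun t _ => hR (t * p.1, p.2) hp

/-- Hadamard's lemma: the fundamental theorem of calculus along t ↦ Φ(tε, q). The quotient is again
a kernel, smooth across ε = 0, so replacing Φ(ε, ·) by Φ(0, ·) gains a factor ε. -/
theorem IsKernel.sub_eq_mul_epsQuotient (h : IsKernel Φ) (ε : ℝ) (q : Model n × Model n) :
    Φ (ε, q) - Φ (0, q) = ε * LipschitzSpacetime.epsQuotient Φ (ε, q) := by
  have hd : ∀ t : ℝ, HasDerivAt (fun s : ℝ => Φ (s * ε, q))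
      (ε * fderiv ℝ Φ (t * ε, q) (1, 0)) t := fun t => by
    have h0 : HasDerivAt (fun s : ℝ => s * ε) ε t := by
      simpa using (hasDerivAt_id t).mul_const ε
    have h1 : HasDerivAt (fun s : ℝ => (s * ε, q)) ((ε, 0) : ℝ × Model n × Model n) t :=
      h0.prodMk (hasDerivAt_const t q)
    have h2 := ((h.contDiff.differentiable (by simp)) (t * ε, q)).hasFDerivAt.comp_hasDerivAt t h1
    have h4 : ((ε, 0) : ℝ × Model n × Model n) = ε • ((1, 0) : ℝ × Model n × Model n) := by
      ext <;> simp
    rw [h4, map_smul, smul_eq_mul] at h2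
    exact h2
  have h3 := intervalIntegral.integral_eq_sub_of_hasDerivAt (a := 0) (b := 1)
    (fun t _ => hd t) (by
      refine Continuous.intervalIntegrable ?_ _ _
      have := (h.fderiv_apply (1, 0)).contDiff.continuous
      exact continuous_const.mul (this.comp (f := fun t : ℝ => (t * ε, q)) (by fun_prop)))
  simp only [one_mul, zero_mul] at h3
  rw [← h3, intervalIntegral.integral_const_mul, LipschitzSpacetime.epsQuotient,
    intervalIntegral.integral_of_le zero_le_one]

theorem IsKernel.exists_bound (h : IsKernel Φ) {L : Set (Model n)} (hL : IsCompact L) :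
    ∃ C : ℝ, 0 ≤ C ∧ ∀ ε ∈ Icc (0 : ℝ) 1, ∀ x ∈ L, ∀ w, |Φ (ε, x, w)| ≤ C := by
  obtain ⟨R, hR⟩ := h.support
  have hc : IsCompact (Icc (0 : ℝ) 1 ×ˢ L ×ˢ Metric.closedBall (0 : Model n) R) :=
    isCompact_Icc.prod (hL.prod (isCompact_closedBall _ _))
  obtain ⟨C, hC⟩ := hc.exists_bound_of_continuousOn h.contDiff.continuous.continuousOn
  refine ⟨max C 0, le_max_right _ _, fun ε hε x hx w => ?_⟩
  by_cases hw : R ≤ ‖w‖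
  · rw [hR (ε, x, w) hw]
    simp
  · have hm : (ε, x, w) ∈ Icc (0 : ℝ) 1 ×ˢ L ×ˢ Metric.closedBall (0 : Model n) R :=
      mk_mem_prod hε (mk_mem_prod hx (mem_closedBall_zero_iff.2 (not_le.1 hw).le))
    have := hC (ε, x, w) hm
    rw [Real.norm_eq_abs] at this
    exact this.trans (le_max_left _ _)

theorem IsKernel.hasCompactSupport (h : IsKernel Φ) (ε : ℝ) (x : Model n) :
    HasCompactSupport fun w => Φ (ε, x, w) := by
  obtain ⟨R, hR⟩ := h.support
  refine HasCompactSupport.intro (isCompact_closedBall (0 : Model n) R) fun w hw => hR (ε, x, w) ?_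
  simp only [Metric.mem_closedBall, dist_zero_right, not_le] at hw
  exact hw.le

theorem IsKernel.contDiff_slice (h : IsKernel Φ) (ε : ℝ) (x : Model n) :
    ContDiff ℝ ∞ fun w => Φ (ε, x, w) :=
  h.contDiff.comp (contDiff_const.prodMk (contDiff_const.prodMk contDiff_id))

theorem IsKernel.continuous_slice (h : IsKernel Φ) (ε : ℝ) (x : Model n) :
    Continuous fun w => Φ (ε, x, w) := (h.contDiff_slice ε x).continuous

theorem IsKernel.integrable_mul (h : IsKernel Φ) (ε : ℝ) (x : Model n) {u : Model n → ℝ}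
    (hu : Continuous u) : Integrable fun w => Φ (ε, x, w) * u w :=
  ((h.continuous_slice ε x).mul hu).integrable_of_hasCompactSupport
    (h.hasCompactSupport ε x).mul_right

theorem dw_eq_pderiv (h : IsKernel Φ) (i : Fin n) (ε : ℝ) (x w : Model n) :
    dw i Φ (ε, x, w) = pderiv i (fun v => Φ (ε, x, v)) w := by
  have h1 : HasFDerivAt (fun v : Model n => (ε, x, v))
      ((0 : Model n →L[ℝ] ℝ).prod ((0 : Model n →L[ℝ] Model n).prod (.id ℝ _))) w :=
    (hasFDerivAt_const ε w).prodMk ((hasFDerivAt_const x w).prodMk (hasFDerivAt_id w))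
  have h2 := ((h.contDiff.differentiable (by simp)) (ε, x, w)).hasFDerivAt.comp w h1
  rw [pderiv]
  have : (fun v => Φ (ε, x, v)) = Φ ∘ fun v => (ε, x, v) := rfl
  rw [this, h2.fderiv]
  simp [dw]

theorem dx_eq_pderiv (h : IsKernel Φ) (i : Fin n) (ε : ℝ) (x w : Model n) :
    dx i Φ (ε, x, w) = pderiv i (fun v => Φ (ε, v, w)) x := by
  have h1 : HasFDerivAt (fun v : Model n => (ε, v, w))
      ((0 : Model n →L[ℝ] ℝ).prod ((ContinuousLinearMap.id ℝ _).prod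
        (0 : Model n →L[ℝ] Model n))) x :=
    (hasFDerivAt_const ε x).prodMk ((hasFDerivAt_id x).prodMk (hasFDerivAt_const w x))
  have h2 := ((h.contDiff.differentiable (by simp)) (ε, x, w)).hasFDerivAt.comp x h1
  rw [pderiv]
  have : (fun v => Φ (ε, v, w)) = Φ ∘ fun v => (ε, v, w) := rfl
  rw [this, h2.fderiv]
  simp [dx]

end LipschitzSpacetime

end
noncomputable section

namespace LipschitzSpacetime

variable {n : ℕ} {Φ Ψ : ℝ × Model n × Model n → ℝ} {u : Model n → ℝ} {ε : ℝ} {L : Set (Model n)}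

/-! ## Differentiation of kernel operators -/

theorem integral_comp_add_smul (x : Model n) (hε : 0 < ε) (F : Model n → ℝ) :
    ∫ w, F (x + ε • w) = (ε ^ n)⁻¹ * ∫ y, F y := by
  rw [Measure.integral_comp_smul volume (fun w => F (x + w)) ε, integral_add_left_eq_self,
    finrank_euclideanSpace_fin, abs_of_pos (by positivity), smul_eq_mul]

/-- The substitution y = x + εw removes x from the argument of u, so that derivatives in x fall on
the smooth kernel alone. -/
theorem kernelOp_eq (Φ : ℝ × Model n × Model n → ℝ) (hε : 0 < ε) (u : Model n → ℝ) (x : Model n) :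
    kernelOp Φ ε u x = (ε ^ n)⁻¹ * ∫ y, Φ (ε, x, ε⁻¹ • (y - x)) * u y := by
  rw [← integral_comp_add_smul x hε fun y => Φ (ε, x, ε⁻¹ • (y - x)) * u y, kernelOp]
  simp only [add_sub_cancel_left, inv_smul_smul₀ hε.ne']

theorem IsKernel.contDiff_kernelOp (h : IsKernel Φ) (hε : 0 < ε) (hu : Continuous u) :
    ContDiff ℝ ∞ (kernelOp Φ ε u) := by
  have key : ContDiff ℝ ∞ fun x => ∫ y, Φ (ε, x, ε⁻¹ • (y - x)) * u y := by
    obtain ⟨R, hR⟩ := h.support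
    -- A convolution whose second factor depends on a parameter p, evaluated along the diagonal p =
    -- x.
    have key := contDiffOn_convolution_right_with_param_comp (𝕜 := ℝ) (n := ⊤) (μ := volume)
      (ContinuousLinearMap.mul ℝ ℝ) (s := (univ : Set (Model n))) (v := fun x => x)
      contDiffOn_id (f := u) (g := fun p s => Φ (ε, p, -(ε⁻¹ • s)))
      (k := Metric.closedBall 0 (ε * R)) isOpen_univ (isCompact_closedBall _ _) ?_
      hu.locallyIntegrable ?_
    · rw [contDiffOn_univ] at key
      convert! key using 2 with x
      rw [convolution]
      refine integral_congr_ae (Eventually.of_forall fun t => ?_)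
      simp only [ContinuousLinearMap.mul_apply', ← smul_neg, neg_sub]
      exact mul_comm _ _
    · intro p x _ hx
      refine hR (ε, p, -(ε⁻¹ • x)) ?_
      simp only [mem_closedBall_zero_iff, not_le] at hx
      rw [norm_neg, norm_smul, norm_inv, Real.norm_eq_abs, abs_of_pos hε, le_inv_mul_iff₀ hε]
      exact hx.le
    · refine ContDiff.contDiffOn (h.contDiff.comp (g := Φ)
        (f := fun q : Model n × Model n => (ε, q.1, -(ε⁻¹ • q.2))) ?_)
      fun_prop
  rw [show kernelOp Φ ε u = _ from funext fun x => kernelOp_eq Φ hε u x]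
  exact contDiff_const.mul key

/-- After the substitution y = x + εw, the variable x occurs as the second argument of Φ and inside
(y - x)/ε; the latter contributes the factor -1/ε. No derivative of u is needed. -/
theorem IsKernel.pderiv_kernelOp (h : IsKernel Φ) (hε : 0 < ε) (hu : Continuous u) (i : Fin n)
    (x₀ : Model n) : pderiv i (kernelOp Φ ε u) x₀ =
      kernelOp (LipschitzSpacetime.dx i Φ) ε u x₀
        - ε⁻¹ * kernelOp (LipschitzSpacetime.dw i Φ) ε u x₀ := by
  let D : Model n →L[ℝ] ℝ × Model n × Model n :=
    (0 : Model n →L[ℝ] ℝ).prod ((ContinuousLinearMap.id ℝ _).prod (-(ε⁻¹ • .id ℝ _)))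
  let F' : Model n → Model n → Model n →L[ℝ] ℝ := fun x y =>
    u y • (fderiv ℝ Φ (ε, x, ε⁻¹ • (y - x))).comp D
  obtain ⟨R, hR⟩ := h.support
  have hR' : ∀ p, R + 1 ≤ ‖p.2.2‖ → fderiv ℝ Φ p = 0 := fun p hp => by
    have : Φ =ᶠ[𝓝 p] fun _ => 0 := by
      have ho : IsOpen {q : ℝ × Model n × Model n | R < ‖q.2.2‖} :=
        isOpen_lt continuous_const (by fun_prop)
      filter_upwards [ho.mem_nhds (show R < ‖p.2.2‖ by linarith)] with q hq
      exact hR q (le_of_lt hq)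
    rw [this.fderiv_eq]
    simp
  have hfc : Continuous (fderiv ℝ Φ) := h.contDiff.continuous_fderiv (by simp)
  have hF'c : Continuous fun q : Model n × Model n => F' q.1 q.2 := by
    refine (hu.comp continuous_snd).smul ?_
    exact (hfc.comp (f := fun q : Model n × Model n => (ε, q.1, ε⁻¹ • (q.2 - q.1)))
      (by fun_prop)).clm_comp continuous_const
  -- Outside a ball that serves all x in the unit ball about `x₀`, the rescaled difference lies
  -- beyond the support. This yields an integrable majorant that is uniform in x.
  have hlarge : ∀ {r : ℝ} {x y : Model n}, 1 ≤ r → x ∈ Metric.closedBall x₀ 1 →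
      y ∉ Metric.closedBall x₀ (1 + ε * (R + r)) → R + r ≤ ‖ε⁻¹ • (y - x)‖ := by
    intro r x y _ hx hy
    rw [norm_smul, norm_inv, Real.norm_eq_abs, abs_of_pos hε, le_inv_mul_iff₀ hε]
    simp only [Metric.mem_closedBall, not_le, dist_eq_norm] at hx hy
    have := norm_sub_le_norm_sub_add_norm_sub y x x₀
    linarith
  have hF'0 : ∀ x ∈ Metric.closedBall x₀ 1, ∀ y,
      y ∉ Metric.closedBall x₀ (1 + ε * (R + 1)) → F' x y = 0 := fun x hx y hy => by
    simp only [F', hR' (ε, x, ε⁻¹ • (y - x)) (hlarge le_rfl hx hy)]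
    simp
  have hx₀ : x₀ ∈ Metric.closedBall x₀ 1 := Metric.mem_closedBall_self zero_le_one
  obtain ⟨C, hC⟩ := ((isCompact_closedBall x₀ 1).prod
    (isCompact_closedBall x₀ (1 + ε * (R + 1)))).exists_bound_of_continuousOn hF'c.continuousOn
  have hslice : ∀ x, Continuous fun y => Φ (ε, x, ε⁻¹ • (y - x)) * u y := fun x =>
    (h.contDiff.continuous.comp (f := fun y => (ε, x, ε⁻¹ • (y - x))) (by fun_prop)).mul hu
  have hd : ∀ y x, HasFDerivAt (fun x => Φ (ε, x, ε⁻¹ • (y - x)) * u y) (F' x y) x := by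
    intro y x
    have h1 : HasFDerivAt (fun x => ε⁻¹ • (y - x)) (-(ε⁻¹ • .id ℝ (Model n))) x := by
      have := ((hasFDerivAt_id (𝕜 := ℝ) x).const_sub y).const_smul ε⁻¹
      rw [smul_neg] at this
      exact this
    have h3 : HasFDerivAt (fun x => (ε, x, ε⁻¹ • (y - x))) D x :=
      (hasFDerivAt_const ε x).prodMk ((hasFDerivAt_id x).prodMk h1)
    have h2 := ((h.contDiff.differentiable (by simp)) (ε, x, ε⁻¹ • (y - x))).hasFDerivAt.comp x h3
    exact h2.mul_const (u y)
  have hF'int : Integrable (F' x₀) :=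
    (hF'c.comp (f := fun y => (x₀, y)) (by fun_prop)).integrable_of_hasCompactSupport
      (HasCompactSupport.intro (isCompact_closedBall _ _) (hF'0 x₀ hx₀))
  have key := hasFDerivAt_integral_of_dominated_of_fderiv_le (𝕜 := ℝ) (μ := volume)
    (F := fun x y => Φ (ε, x, ε⁻¹ • (y - x)) * u y) (F' := F') (x₀ := x₀)
    (s := Metric.ball x₀ 1)
    (bound := (Metric.closedBall x₀ (1 + ε * (R + 1))).indicator fun _ => C)
    (Metric.ball_mem_nhds _ one_pos)
    (Eventually.of_forall fun x => (hslice x).aestronglyMeasurable)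
    ((hslice x₀).integrable_of_hasCompactSupport
      (HasCompactSupport.intro (isCompact_closedBall x₀ (1 + ε * (R + 1))) fun y hy => by
        rw [hR (ε, x₀, ε⁻¹ • (y - x₀)) ((by linarith : R ≤ R + 1).trans (hlarge le_rfl hx₀ hy)),
          zero_mul]))
    hF'int.aestronglyMeasurable
    (Eventually.of_forall fun y x hx => by
      by_cases hy : y ∈ Metric.closedBall x₀ (1 + ε * (R + 1))
      · rw [indicator_of_mem hy]
        exact hC (x, y) (mk_mem_prod (Metric.ball_subset_closedBall hx) hy)
      · rw [indicator_of_notMem hy, hF'0 x (Metric.ball_subset_closedBall hx) y hy, norm_zero])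
    ((integrable_indicator_iff measurableSet_closedBall).2
      (integrableOn_const (isCompact_closedBall _ _).measure_ne_top))
    (Eventually.of_forall fun y x _ => hd y x)
  have hk : HasFDerivAt (kernelOp Φ ε u) ((ε ^ n)⁻¹ • ∫ y, F' x₀ y) x₀ := by
    have := key.const_mul (ε ^ n)⁻¹
    convert! this using 1
    funext x
    exact kernelOp_eq Φ hε u x
  rw [pderiv, hk.fderiv, smul_apply, ContinuousLinearMap.integral_apply hF'int,
    kernelOp_eq _ hε, kernelOp_eq _ hε, smul_eq_mul, mul_left_comm ε⁻¹, ← mul_sub]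
  congr 1
  have hint : ∀ v : ℝ × Model n × Model n,
      Integrable fun y => fderiv ℝ Φ (ε, x₀, ε⁻¹ • (y - x₀)) v * u y := fun v => by
    refine Continuous.integrable_of_hasCompactSupport ?_ (HasCompactSupport.intro
      (isCompact_closedBall x₀ (1 + ε * (R + 1))) fun y hy => ?_)
    · exact ((hfc.comp (f := fun y => (ε, x₀, ε⁻¹ • (y - x₀))) (by fun_prop)).clm_apply
        continuous_const).mul hu
    · rw [hR' (ε, x₀, ε⁻¹ • (y - x₀)) (hlarge le_rfl hx₀ hy)]
      simp
  rw [← integral_const_mul]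
  refine Eq.trans ?_ (integral_sub (hint (0, EuclideanSpace.single i 1, 0))
    ((hint (0, 0, EuclideanSpace.single i 1)).const_mul _))
  refine integral_congr_ae (Eventually.of_forall fun y => ?_)
  have hD : D (EuclideanSpace.single i 1) =
      (0, EuclideanSpace.single i 1, 0) - ε⁻¹ • (0, 0, EuclideanSpace.single i 1) := by
    simp [D]
  simp only [F', smul_apply, ContinuousLinearMap.comp_apply, hD, map_sub,
    map_smul, smul_eq_mul, LipschitzSpacetime.dx, LipschitzSpacetime.dw]
  ring

/-! ## Integration by parts -/

theorem integral_mul_pderiv {f g : Model n → ℝ} (hf : ContDiff ℝ ∞ f) (hfs : HasCompactSupport f)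
    (hg : ContDiff ℝ ∞ g) (i : Fin n) :
    ∫ w, pderiv i f w * g w = -∫ w, f w * pderiv i g w := by
  have hf' : Continuous (pderiv i f) := (hf.continuous_fderiv (by simp)).clm_apply continuous_const
  have hg' : Continuous (pderiv i g) := (hg.continuous_fderiv (by simp)).clm_apply continuous_const
  have hs : HasCompactSupport (pderiv i f) := hfs.fderiv_apply ℝ _
  have := integral_mul_fderiv_eq_neg_fderiv_mul_of_integrable (𝕜 := ℝ) (μ := volume)
    (f := f) (g := g) (v := EuclideanSpace.single i 1)
    ((hf'.mul hg.continuous).integrable_of_hasCompactSupport hs.mul_right)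
    ((hf.continuous.mul hg').integrable_of_hasCompactSupport hfs.mul_right)
    ((hf.continuous.mul hg.continuous).integrable_of_hasCompactSupport hfs.mul_right)
    (fun x _ => hf.differentiable (by simp) x) (fun x _ => hg.differentiable (by simp) x)
  simp only [pderiv] at this ⊢
  rw [this, neg_neg]

/-- Integration by parts against a linear form, whose derivative is constant. With the differential
of u as linear form, this first moment turns limits of difference quotients into partial
derivatives. -/
theorem IsKernel.integral_dw_mul_clm (h : IsKernel Φ) (i : Fin n) (ε : ℝ) (x : Model n)
    (l : Model n →L[ℝ] ℝ) : ∫ w, LipschitzSpacetime.dw i Φ (ε, x, w) * l w =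
      -(l (EuclideanSpace.single i 1) * ∫ w, Φ (ε, x, w)) := by
  simp only [dw_eq_pderiv h]
  rw [integral_mul_pderiv (h.contDiff_slice ε x) (h.hasCompactSupport ε x) l.contDiff,
    ← integral_const_mul]
  congr 1
  refine integral_congr_ae (Eventually.of_forall fun w => ?_)
  simp only [pderiv, ContinuousLinearMap.fderiv]
  ring

theorem IsKernel.integral_dw (h : IsKernel Φ) (i : Fin n) (ε : ℝ) (x : Model n) :
    ∫ w, LipschitzSpacetime.dw i Φ (ε, x, w) = 0 := by
  have := integral_mul_pderiv (h.contDiff_slice ε x) (h.hasCompactSupport ε x)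
    (contDiff_const (c := (1 : ℝ))) i
  simp only [dw_eq_pderiv h]
  simpa [pderiv] using this

theorem IsKernel.dx_dw (h : IsKernel Φ) (i j : Fin n) :
    LipschitzSpacetime.dx i (LipschitzSpacetime.dw j Φ) =
      LipschitzSpacetime.dw j (LipschitzSpacetime.dx i Φ) := by
  funext p
  have hd : DifferentiableAt ℝ (fderiv ℝ Φ) p :=
    ((h.contDiff.fderiv_right (m := ∞) (by simp)).differentiable (by simp)) p
  have hs : IsSymmSndFDerivAt ℝ Φ p :=
    h.contDiff.contDiffAt.isSymmSndFDerivAt (by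
      simp only [minSmoothness_of_isRCLikeNormedField]
      exact WithTop.coe_le_coe.2 le_top)
  have key : ∀ v w, fderiv ℝ (fun q => fderiv ℝ Φ q v) p w = fderiv ℝ (fderiv ℝ Φ) p w v := by
    intro v w
    rw [fderiv_clm_apply hd (differentiableAt_const _)]
    simp
  change fderiv ℝ (fun q => fderiv ℝ Φ q _) p _ = fderiv ℝ (fun q => fderiv ℝ Φ q _) p _
  rw [key, key, hs]

theorem IsKernel.pderiv_integral (h : IsKernel Φ) (i : Fin n) (x : Model n) :
    pderiv i (fun x => ∫ w, Φ (0, x, w)) x = ∫ w, LipschitzSpacetime.dx i Φ (0, x, w) := by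
  -- Differentiation under the integral is the case ε = 1, u = 1 of the formula for kernel
  -- operators; the term with the derivative in w integrates to zero.
  have h1 := h.comp_zero.pderiv_kernelOp one_pos (u := fun _ => 1) continuous_const i x
  have h2 := h.comp_zero.integral_dw i 1 x
  simp only [kernelOp, mul_one, h2, mul_zero, sub_zero] at h1
  have h0 : (kernelOp (fun p => Φ (0, p.2)) 1 fun _ => 1) = fun x => ∫ w, Φ (0, x, w) := by
    funext x
    simp [kernelOp]
  rw [← h0]
  refine h1.trans (integral_congr_ae (Eventually.of_forall fun w => ?_))
  simp only [dx_eq_pderiv h, dx_eq_pderiv h.comp_zero]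

end LipschitzSpacetime

end
noncomputable section

namespace LipschitzSpacetime

variable {n : ℕ} {L : Set (Model n)}

/-! ## Bounded almost everywhere convergence -/

/-- Uniform boundedness on `L` and pointwise convergence almost everywhere on `L`. -/
structure BddTendsto (L : Set (Model n)) (f : ℕ → Model n → ℝ) (f₀ : Model n → ℝ) : Prop where
  bdd : ∃ C : ℝ, ∀ᶠ k in atTop, ∀ x ∈ L, |f k x| ≤ C
  tendsto : ∀ᵐ x : Model n, x ∈ L → Tendsto (fun k => f k x) atTop (𝓝 (f₀ x))

namespace BddTendsto

variable {f g : ℕ → Model n → ℝ} {f₀ g₀ : Model n → ℝ}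

theorem add (hf : BddTendsto L f f₀) (hg : BddTendsto L g g₀) :
    BddTendsto L (fun k x => f k x + g k x) fun x => f₀ x + g₀ x := by
  refine ⟨?_, ?_⟩
  · obtain ⟨C, hC⟩ := hf.bdd
    obtain ⟨D, hD⟩ := hg.bdd
    refine ⟨C + D, ?_⟩
    filter_upwards [hC, hD] with k h1 h2 x hx
    exact (abs_add_le _ _).trans (add_le_add (h1 x hx) (h2 x hx))
  · filter_upwards [hf.tendsto, hg.tendsto] with x h1 h2 hx using (h1 hx).add (h2 hx)

theorem mul (hf : BddTendsto L f f₀) (hg : BddTendsto L g g₀) :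
    BddTendsto L (fun k x => f k x * g k x) fun x => f₀ x * g₀ x := by
  refine ⟨?_, ?_⟩
  · obtain ⟨C, hC⟩ := hf.bdd
    obtain ⟨D, hD⟩ := hg.bdd
    refine ⟨|C| * |D|, ?_⟩
    filter_upwards [hC, hD] with k h1 h2 x hx
    rw [abs_mul]
    exact mul_le_mul ((h1 x hx).trans (le_abs_self _)) ((h2 x hx).trans (le_abs_self _))
      (abs_nonneg _) (abs_nonneg _)
  · filter_upwards [hf.tendsto, hg.tendsto] with x h1 h2 hx using (h1 hx).mul (h2 hx)

theorem of_bound (h : ∃ C : ℝ, ∀ x ∈ L, |f₀ x| ≤ C) : BddTendsto L (fun _ => f₀) f₀ :=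
  ⟨h.imp fun _ hC => Eventually.of_forall fun _ => hC,
    Eventually.of_forall fun _ _ => tendsto_const_nhds⟩

theorem const (c : ℝ) : BddTendsto L (fun _ _ => c) fun _ => c := of_bound ⟨|c|, fun _ _ => le_rfl⟩

theorem const_mul (c : ℝ) (hf : BddTendsto L f f₀) :
    BddTendsto L (fun k x => c * f k x) fun x => c * f₀ x := (const c).mul hf

theorem neg (hf : BddTendsto L f f₀) : BddTendsto L (fun k x => -f k x) fun x => -f₀ x := by
  simpa using hf.const_mul (-1)

theorem sub (hf : BddTendsto L f f₀) (hg : BddTendsto L g g₀) :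
    BddTendsto L (fun k x => f k x - g k x) fun x => f₀ x - g₀ x := by
  simpa [sub_eq_add_neg] using hf.add hg.neg

theorem sum {ι : Type*} (s : Finset ι) {f : ι → ℕ → Model n → ℝ} {f₀ : ι → Model n → ℝ}
    (h : ∀ i ∈ s, BddTendsto L (f i) (f₀ i)) :
    BddTendsto L (fun k x => ∑ i ∈ s, f i k x) fun x => ∑ i ∈ s, f₀ i x := by
  classical
  induction s using Finset.induction_on with
  | empty => simpa using const 0
  | insert a s ha ih =>
    simp only [Finset.sum_insert ha]
    exact (h a (Finset.mem_insert_self _ _)).add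
      (ih fun i hi => h i (Finset.mem_insert_of_mem hi))

theorem congr (hf : BddTendsto L f f₀) (h : ∀ᶠ k in atTop, ∀ x ∈ L, g k x = f k x)
    (h₀ : ∀ᵐ x : Model n, x ∈ L → g₀ x = f₀ x) : BddTendsto L g g₀ := by
  refine ⟨?_, ?_⟩
  · obtain ⟨C, hC⟩ := hf.bdd
    refine ⟨C, ?_⟩
    filter_upwards [hC, h] with k h1 h2 x hx
    rw [h2 x hx]
    exact h1 x hx
  · filter_upwards [hf.tendsto, h₀] with x h1 h2 hx
    rw [h2 hx]
    refine (h1 hx).congr' ?_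
    filter_upwards [h] with k hk using (hk x hx).symm

/-- A bounded sequence times a null sequence is a null sequence. -/
theorem bdd_mul_zero (hf : ∃ C : ℝ, ∀ᶠ k in atTop, ∀ x ∈ L, |f k x| ≤ C)
    (hg : BddTendsto L g fun _ => 0) : BddTendsto L (fun k x => f k x * g k x) fun _ => 0 := by
  obtain ⟨C, hC⟩ := hf
  refine ⟨?_, ?_⟩
  · obtain ⟨D, hD⟩ := hg.bdd
    refine ⟨|C| * |D|, ?_⟩
    filter_upwards [hC, hD] with k h1 h2 x hx
    rw [abs_mul]
    exact mul_le_mul ((h1 x hx).trans (le_abs_self _)) ((h2 x hx).trans (le_abs_self _))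
      (abs_nonneg _) (abs_nonneg _)
  · filter_upwards [hg.tendsto] with x h1 hx
    refine squeeze_zero_norm' (a := fun k => |C| * |g k x|) ?_ ?_
    · filter_upwards [hC] with k h2
      rw [Real.norm_eq_abs, abs_mul]
      exact mul_le_mul_of_nonneg_right ((h2 x hx).trans (le_abs_self _)) (abs_nonneg _)
    · simpa using (h1 hx).abs.const_mul |C|

/-- Squeezing a nonnegative sequence below a null sequence. -/
theorem of_nonneg_of_le (hg : BddTendsto L g fun _ => 0) (h0 : ∀ k, ∀ x ∈ L, 0 ≤ f k x)
    (h : ∀ᶠ k in atTop, ∀ x ∈ L, f k x ≤ g k x) : BddTendsto L f fun _ => 0 := by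
  refine ⟨?_, ?_⟩
  · obtain ⟨D, hD⟩ := hg.bdd
    refine ⟨D, ?_⟩
    filter_upwards [hD, h] with k h1 h2 x hx
    rw [abs_of_nonneg (h0 k x hx)]
    exact (h2 x hx).trans ((le_abs_self _).trans (h1 x hx))
  · filter_upwards [hg.tendsto] with x h1 hx
    refine tendsto_of_tendsto_of_tendsto_of_le_of_le' tendsto_const_nhds (h1 hx)
      (Eventually.of_forall fun k => h0 k x hx) ?_
    filter_upwards [h] with k hk using hk x hx

theorem of_uniform_zero (h : ∀ δ > 0, ∀ᶠ k in atTop, ∀ x ∈ L, |f k x| ≤ δ) :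
    BddTendsto L f fun _ => 0 := by
  refine ⟨⟨1, h 1 one_pos⟩, Eventually.of_forall fun x hx => ?_⟩
  rw [Metric.tendsto_nhds]
  intro δ hδ
  filter_upwards [h (δ / 2) (half_pos hδ)] with k hk
  rw [Real.dist_0_eq_abs]
  exact (hk x hx).trans_lt (half_lt_self hδ)

theorem of_tendsto (ht : ∀ x ∈ L, Tendsto (fun k => f k x) atTop (𝓝 (f₀ x)))
    (hb : ∃ C : ℝ, ∀ᶠ k in atTop, ∀ x ∈ L, |f k x| ≤ C) : BddTendsto L f f₀ :=
  ⟨hb, Eventually.of_forall ht⟩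

/-- Bounded almost everywhere convergence to zero implies convergence in `L^p`. -/
theorem tendsto_eLpNorm (hf : BddTendsto L f fun _ => 0) (hL : IsCompact L)
    (hm : ∀ k, AEStronglyMeasurable (f k) (volume.restrict L)) {p : ℝ≥0∞} (hp : 1 ≤ p)
    (hp' : p ≠ ⊤) :
    Tendsto (fun k => eLpNorm (f k) p (volume.restrict L)) atTop (𝓝 0) := by
  obtain ⟨C, hC⟩ := hf.bdd
  have hp0 : p ≠ 0 := (zero_lt_one.trans_le hp).ne'
  have hpr : 0 < p.toReal := ENNReal.toReal_pos hp0 hp'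
  have hmL := hL.measurableSet
  simp only [eLpNorm_eq_lintegral_rpow_enorm_toReal hp0 hp']
  have key : Tendsto (fun k => ∫⁻ x in L, ‖f k x‖ₑ ^ p.toReal) atTop (𝓝 (∫⁻ _ in L, 0)) := by
    -- The uniform bound holds only eventually, so the sequence is shifted before dominated
    -- convergence is applied.
    obtain ⟨k₀, hk₀⟩ := eventually_atTop.1 hC
    rw [← tendsto_add_atTop_iff_nat k₀]
    refine tendsto_lintegral_of_dominated_convergence' (fun _ => (ENNReal.ofReal C) ^ p.toReal)
      (fun k => (hm (k + k₀)).enorm.pow_const _) (fun k => ?_) ?_ ?_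
    · refine (ae_restrict_iff' hmL).2 (Eventually.of_forall fun x hx => ?_)
      refine ENNReal.rpow_le_rpow ?_ hpr.le
      rw [← ofReal_norm]
      exact ENNReal.ofReal_le_ofReal (hk₀ (k + k₀) (Nat.le_add_left _ _) x hx)
    · rw [lintegral_const]
      exact ENNReal.mul_ne_top (ENNReal.rpow_ne_top_of_nonneg hpr.le ENNReal.ofReal_ne_top)
        (by simpa using hL.measure_ne_top)
    · rw [ae_restrict_iff' hmL]
      filter_upwards [hf.tendsto] with x hx hxL
      have h1 := (ENNReal.continuous_rpow_const (y := p.toReal)).tendsto _ |>.comp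
        ((continuous_enorm.tendsto _).comp ((hx hxL).comp (tendsto_add_atTop_nat k₀)))
      simpa [ENNReal.zero_rpow_of_pos hpr, Function.comp_def] using h1
  have h2 := (ENNReal.continuous_rpow_const (y := 1 / p.toReal)).tendsto _ |>.comp key
  simpa [ENNReal.zero_rpow_of_pos (inv_pos.2 hpr), Function.comp_def] using h2

end BddTendsto

/-! ## Integrals against bounded kernels -/

/-- Measurable functions `κ k x` of uniformly bounded size and support, converging pointwise for
almost every `x ∈ L`. -/
structure KernelTendsto (L : Set (Model n)) (κ : ℕ → Model n → Model n → ℝ)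
    (κ₀ : Model n → Model n → ℝ) : Prop where
  aestronglyMeasurable : ∀ k, ∀ x ∈ L, AEStronglyMeasurable (κ k x)
  bdd : ∃ R C : ℝ, ∀ᶠ k in atTop, ∀ x ∈ L, ∀ w,
    |κ k x w| ≤ (Metric.closedBall (0 : Model n) R).indicator (fun _ => C) w
  tendsto : ∀ᵐ x : Model n, x ∈ L → ∀ w, Tendsto (fun k => κ k x w) atTop (𝓝 (κ₀ x w))

variable {κ : ℕ → Model n → Model n → ℝ} {κ₀ : Model n → Model n → ℝ}

theorem integrable_indicator_closedBall (R C : ℝ) :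
    Integrable ((Metric.closedBall (0 : Model n) R).indicator fun _ => C) :=
  (integrable_indicator_iff measurableSet_closedBall).2
    (integrableOn_const (isCompact_closedBall _ _).measure_ne_top)

theorem KernelTendsto.integral (h : KernelTendsto L κ κ₀) :
    BddTendsto L (fun k x => ∫ w, κ k x w) fun x => ∫ w, κ₀ x w := by
  obtain ⟨R, C, hC⟩ := h.bdd
  refine ⟨⟨∫ w, (Metric.closedBall (0 : Model n) R).indicator (fun _ => C) w, ?_⟩, ?_⟩
  · filter_upwards [hC] with k hk x hx
    rw [← Real.norm_eq_abs]
    exact norm_integral_le_of_norm_le (integrable_indicator_closedBall R C)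
      (Eventually.of_forall (hk x hx))
  · filter_upwards [h.tendsto] with x hx hxL
    refine tendsto_integral_filter_of_dominated_convergence _
      (Eventually.of_forall fun k => h.aestronglyMeasurable k x hxL) ?_
      (integrable_indicator_closedBall R C) (Eventually.of_forall (hx hxL))
    filter_upwards [hC] with k hk
    exact Eventually.of_forall (hk x hxL)

/-- Lebesgue's differentiation theorem on the balls of radius εR about x, pulled back to a fixed
ball; the volume of the ball and the Jacobian contribute powers of ε that cancel. -/
theorem ae_tendsto_integral_norm_sub {H : Model n → ℝ} (hH : LocallyIntegrable H)
    {ε : ℕ → ℝ} (hε : ∀ k, 0 < ε k) (hε0 : Tendsto ε atTop (𝓝 0)) {R : ℝ} (hR : 0 < R) :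
    ∀ᵐ x, Tendsto (fun k => ∫ w in Metric.closedBall (0 : Model n) R, |H (x + ε k • w) - H x|)
      atTop (𝓝 0) := by
  filter_upwards [IsUnifLocDoublingMeasure.ae_tendsto_average_norm_sub (μ := volume) hH 1] with x hx
  have h1 := hx (l := atTop) (fun _ : ℕ => x) (fun k => ε k * R)
    (tendsto_nhdsWithin_iff.2 ⟨by simpa using hε0.mul_const R,
      Eventually.of_forall fun k => mul_pos (hε k) hR⟩)
    (Eventually.of_forall fun k => by
      simpa using (mul_pos (hε k) hR).le)
  have h2 := h1.const_mul (volume.real (Metric.closedBall (0 : Model n) R))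
  rw [mul_zero] at h2
  refine h2.congr fun k => ?_
  have hmem : ∀ w, (x + ε k • w ∈ Metric.closedBall x (ε k * R)) ↔
      w ∈ Metric.closedBall (0 : Model n) R := fun w => by
    simp only [Metric.mem_closedBall, dist_self_add_left, dist_zero_right, norm_smul,
      Real.norm_eq_abs, abs_of_pos (hε k)]
    exact mul_le_mul_iff_right₀ (hε k)
  have h3 := integral_comp_add_smul x (hε k)
    ((Metric.closedBall x (ε k * R)).indicator fun y => |H y - H x|)
  rw [integral_indicator measurableSet_closedBall] at h3
  rw [← integral_indicator measurableSet_closedBall]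
  have h4 : (Metric.closedBall (0 : Model n) R).indicator (fun w => |H (x + ε k • w) - H x|) =
      fun w => (Metric.closedBall x (ε k * R)).indicator (fun y => |H y - H x|) (x + ε k • w) := by
    funext w
    by_cases hw : w ∈ Metric.closedBall (0 : Model n) R
    · rw [indicator_of_mem hw, indicator_of_mem ((hmem w).2 hw)]
    · rw [indicator_of_notMem hw, indicator_of_notMem (mt (hmem w).1 hw)]
  rw [h4, h3, setAverage_eq, smul_eq_mul, ← mul_assoc]
  congr 1
  have hv : volume.real (Metric.closedBall x (ε k * R)) =
      ε k ^ n * volume.real (Metric.closedBall (0 : Model n) R) := by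
    rw [measureReal_def, Measure.addHaar_closedBall_mul _ _ (hε k).le hR.le, measureReal_def,
      ENNReal.toReal_mul, ENNReal.toReal_ofReal (pow_nonneg (hε k).le _),
      finrank_euclideanSpace_fin]
  have hv0 : volume.real (Metric.closedBall (0 : Model n) R) ≠ 0 := by
    have := Metric.measure_closedBall_pos (volume : Measure (Model n)) 0 hR
    exact (ENNReal.toReal_pos this.ne' (isCompact_closedBall _ _).measure_ne_top).ne'
  rw [hv]
  have := (pow_pos (hε k) n).ne'
  field_simp

/-- Split H(x + εw) into H(x) and the difference. The first part converges by dominated convergence;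
the second is at most the bound of the kernel times the mean oscillation of H, which vanishes at
Lebesgue points. Continuity of H is not required, as the result is meant for derivatives of
Lipschitz functions. -/
theorem KernelTendsto.integral_mul (h : KernelTendsto L κ κ₀) {H : Model n → ℝ}
    (hH : Measurable H) (hHb : ∃ C, ∀ x, |H x| ≤ C) {ε : ℕ → ℝ} (hε : ∀ k, 0 < ε k)
    (hε0 : Tendsto ε atTop (𝓝 0)) :
    BddTendsto L (fun k x => ∫ w, κ k x w * H (x + ε k • w)) fun x => H x * ∫ w, κ₀ x w := by
  obtain ⟨R, C, hC⟩ := h.bdd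
  obtain ⟨D, hD⟩ := hHb
  have hmeas : ∀ k x, Measurable fun w => H (x + ε k • w) := fun k x => by fun_prop
  -- The given radius need not be positive; the Lebesgue point argument needs one that is.
  have hCR : ∀ᶠ k in atTop, ∀ x ∈ L, ∀ w,
      |κ k x w| ≤ (Metric.closedBall (0 : Model n) (max R 1)).indicator (fun _ => |C|) w := by
    filter_upwards [hC] with k hk x hx w
    refine (hk x hx w).trans ?_
    refine (indicator_le_indicator_of_subset (Metric.closedBall_subset_closedBall
      (le_max_left R 1)) (fun _ => abs_nonneg C) w).trans' ?_
    exact indicator_le_indicator (le_abs_self C)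
  have hDn : ∀ x, |H x| ≤ |D| := fun x => (hD x).trans (le_abs_self D)
  have hint : ∀ᶠ k in atTop, ∀ x ∈ L, Integrable (κ k x) := by
    filter_upwards [hCR] with k hk x hx
    exact (integrable_indicator_closedBall _ _).mono' (h.aestronglyMeasurable k x hx)
      (Eventually.of_forall (hk x hx))
  have hlocal : LocallyIntegrable H := by
    refine (locallyIntegrable_const (μ := (volume : Measure (Model n))) |D|).mono hH.aestronglyMeasurable
      (Eventually.of_forall fun x => ?_)
    simpa using hDn x
  refine ⟨⟨∫ w, (Metric.closedBall (0 : Model n) (max R 1)).indicator (fun _ => |C| * |D|) w, ?_⟩,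
    ?_⟩
  · filter_upwards [hCR] with k hk x hx
    rw [← Real.norm_eq_abs]
    refine norm_integral_le_of_norm_le (integrable_indicator_closedBall _ _)
      (Eventually.of_forall fun w => ?_)
    rw [norm_mul]
    have := mul_le_mul (hk x hx w) (hDn (x + ε k • w)) (abs_nonneg _)
      (indicator_nonneg (fun _ _ => abs_nonneg C) w)
    rwa [← indicator_mul_const] at this
  · filter_upwards [h.integral.tendsto,
      ae_tendsto_integral_norm_sub hlocal hε hε0 (lt_max_of_lt_right one_pos : 0 < max R 1)]
      with x h1 h2 hx
    have h3 : Tendsto (fun k => ∫ w, κ k x w * (H (x + ε k • w) - H x)) atTop (𝓝 0) := by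
      refine squeeze_zero_norm' ?_ (by simpa using h2.const_mul |C|)
      filter_upwards [hCR] with k hk
      rw [← integral_const_mul, ← integral_indicator measurableSet_closedBall]
      refine norm_integral_le_of_norm_le ?_ (Eventually.of_forall fun w => ?_)
      · refine (integrable_indicator_closedBall (max R 1) (|C| * (|D| + |D|))).mono' ?_
          (Eventually.of_forall fun w => ?_)
        · exact ((((hmeas k x).sub_const _).abs.const_mul |C|).indicator
            measurableSet_closedBall).aestronglyMeasurable
        · by_cases hw : w ∈ Metric.closedBall (0 : Model n) (max R 1)
          · rw [indicator_of_mem hw, indicator_of_mem hw, Real.norm_eq_abs, abs_mul, abs_abs,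
              abs_abs]
            refine mul_le_mul_of_nonneg_left ?_ (abs_nonneg C)
            exact (abs_sub _ _).trans (add_le_add (hDn _) (hDn _))
          · rw [indicator_of_notMem hw, indicator_of_notMem hw, norm_zero]
      · rw [norm_mul]
        have := mul_le_mul_of_nonneg_right (hk x hx w) (abs_nonneg (H (x + ε k • w) - H x))
        refine this.trans (le_of_eq ?_)
        by_cases hw : w ∈ Metric.closedBall (0 : Model n) (max R 1)
        · rw [indicator_of_mem hw, indicator_of_mem hw]
        · rw [indicator_of_notMem hw, indicator_of_notMem hw, zero_mul]
    have h4 := h3.add ((h1 hx).const_mul (H x))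
    rw [zero_add] at h4
    refine h4.congr' ?_
    filter_upwards [hint] with k hk
    rw [← integral_const_mul, ← integral_add]
    · refine integral_congr_ae (Eventually.of_forall fun w => ?_)
      simp only
      ring
    · refine ((hk x hx).mul_bdd (c := |D| + |D|) ?_ (Eventually.of_forall fun w => ?_))
      · exact ((hmeas k x).sub_const _).aestronglyMeasurable
      · exact (abs_sub _ _).trans (add_le_add (hDn _) (hDn _))
    · exact (hk x hx).const_mul _

/-- The second factor need only be bounded for bounded w, since the first confines w to a fixed
ball. This admits difference quotients, which grow linearly in w. -/
theorem KernelTendsto.mul {κ' : ℕ → Model n → Model n → ℝ} {κ₀' : Model n → Model n → ℝ}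
    (h : KernelTendsto L κ κ₀)
    (hm : ∀ k, ∀ x ∈ L, AEStronglyMeasurable (κ' k x))
    (hb : ∀ R, ∃ C : ℝ, ∀ᶠ k in atTop, ∀ x ∈ L, ∀ w, ‖w‖ ≤ R → |κ' k x w| ≤ C)
    (ht : ∀ᵐ x : Model n, x ∈ L → ∀ w, Tendsto (fun k => κ' k x w) atTop (𝓝 (κ₀' x w))) :
    KernelTendsto L (fun k x w => κ k x w * κ' k x w) fun x w => κ₀ x w * κ₀' x w := by
  refine ⟨fun k x hx => (h.aestronglyMeasurable k x hx).mul (hm k x hx), ?_, ?_⟩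
  · obtain ⟨R, C, hC⟩ := h.bdd
    obtain ⟨D, hD⟩ := hb R
    refine ⟨R, |C| * |D|, ?_⟩
    filter_upwards [hC, hD] with k h1 h2 x hx w
    have h3 := h1 x hx w
    by_cases hw : w ∈ Metric.closedBall (0 : Model n) R
    · rw [indicator_of_mem hw] at h3 ⊢
      rw [abs_mul]
      exact mul_le_mul (h3.trans (le_abs_self _))
        ((h2 x hx w (mem_closedBall_zero_iff.1 hw)).trans (le_abs_self _)) (abs_nonneg _)
        (abs_nonneg _)
    · rw [indicator_of_notMem hw] at h3 ⊢
      rw [abs_nonpos_iff.1 h3]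
      simp
  · filter_upwards [h.tendsto, ht] with x h1 h2 hx w using (h1 hx w).mul (h2 hx w)

theorem IsKernel.kernelTendsto {Ψ : ℝ × Model n × Model n → ℝ} (h : IsKernel Ψ) (hL : IsCompact L)
    {ε : ℕ → ℝ} (hε : ∀ k, 0 < ε k ∧ ε k ≤ 1) (hε0 : Tendsto ε atTop (𝓝 0)) :
    KernelTendsto L (fun k x w => Ψ (ε k, x, w)) fun x w => Ψ (0, x, w) := by
  refine ⟨fun k x _ => (h.continuous_slice _ _).aestronglyMeasurable, ?_,
    Eventually.of_forall fun x _ w => ?_⟩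
  · obtain ⟨C, hC0, hC⟩ := h.exists_bound hL
    obtain ⟨R, hR⟩ := h.support
    refine ⟨R, C, Eventually.of_forall fun k x hx w => ?_⟩
    by_cases hw : w ∈ Metric.closedBall (0 : Model n) R
    · rw [indicator_of_mem hw]
      exact hC _ ⟨(hε k).1.le, (hε k).2⟩ x hx w
    · rw [indicator_of_notMem hw]
      simp only [Metric.mem_closedBall, dist_zero_right, not_le] at hw
      rw [hR (ε k, x, w) hw.le, abs_zero]
  · exact (h.contDiff.continuous.tendsto (0, x, w)).comp
      (hε0.prodMk_nhds tendsto_const_nhds)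

end LipschitzSpacetime

end
-- Asymptotics of kernel operators on Lipschitz functions.
noncomputable section

namespace LipschitzSpacetime

variable {n : ℕ} {L N : Set (Model n)} {κ : ℕ → Model n → Model n → ℝ}
  {κ₀ : Model n → Model n → ℝ} {u : Model n → ℝ} {C : NNReal} {ε : ℕ → ℝ}
  {Φ Ψ H : ℝ × Model n × Model n → ℝ} {c : ℝ}

theorem pderiv_congr {f g : Model n → ℝ} {x : Model n} (h : f =ᶠ[𝓝 x] g) (i : Fin n) :
    pderiv i f x = pderiv i g x := by
  rw [pderiv, pderiv, h.fderiv_eq]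

theorem pderiv_const_mul (c : ℝ) (f : Model n → ℝ) (i : Fin n) (x : Model n) :
    pderiv i (fun y => c * f y) x = c * pderiv i f x := by
  have : fderiv ℝ (c • f) x = c • fderiv ℝ f x := by rw [fderiv_const_smul_field]; rfl
  exact congrArg (fun l : Model n →L[ℝ] ℝ => l (EuclideanSpace.single i 1)) this

theorem tendsto_add_smul (hε0 : Tendsto ε atTop (𝓝 0)) (x w : Model n) :
    Tendsto (fun k => x + ε k • w) atTop (𝓝 x) := by
  simpa using tendsto_const_nhds.add (hε0.smul_const w)

theorem KernelTendsto.mul_shift (h : KernelTendsto L κ κ₀) (hL : IsCompact L) (hu : Continuous u)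
    (hε : ∀ k, 0 < ε k ∧ ε k ≤ 1) (hε0 : Tendsto ε atTop (𝓝 0)) :
    KernelTendsto L (fun k x w => κ k x w * u (x + ε k • w)) fun x w => κ₀ x w * u x := by
  refine h.mul (fun k x _ => (by fun_prop : Continuous fun w => u (x + ε k • w)).aestronglyMeasurable)
    (fun R => ?_) (Eventually.of_forall fun x _ w =>
      (hu.tendsto x).comp (tendsto_add_smul hε0 x w))
  obtain ⟨C, hC⟩ := (hL.add (isCompact_closedBall (0 : Model n) R)).exists_bound_of_continuousOn
    hu.continuousOn
  refine ⟨C, Eventually.of_forall fun k x hx w hw => hC _ (add_mem_add hx ?_)⟩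
  rw [mem_closedBall_zero_iff, norm_smul, Real.norm_eq_abs, abs_of_pos (hε k).1]
  exact (mul_le_of_le_one_left (norm_nonneg w) (hε k).2).trans hw

theorem abs_quotient_le (hu : LipschitzWith C u) {ε : ℝ} (hε : 0 < ε) (x w : Model n) :
    |ε⁻¹ * (u (x + ε • w) - u x)| ≤ C * ‖w‖ := by
  rw [abs_mul, abs_inv, abs_of_pos hε, inv_mul_le_iff₀ hε]
  have := hu.dist_le_mul (x + ε • w) x
  rw [Real.dist_eq, dist_self_add_left, norm_smul, Real.norm_eq_abs, abs_of_pos hε] at this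
  linarith

theorem tendsto_quotient (hε : ∀ k, 0 < ε k) (hε0 : Tendsto ε atTop (𝓝 0)) {x : Model n}
    (hx : DifferentiableAt ℝ u x) (w : Model n) :
    Tendsto (fun k => (ε k)⁻¹ * (u (x + ε k • w) - u x)) atTop (𝓝 (fderiv ℝ u x w)) :=
  (hx.hasFDerivAt.hasLineDerivAt w).tendsto_slope_zero_right.comp
    (tendsto_nhdsWithin_iff.2 ⟨hε0, Eventually.of_forall hε⟩)

/-- By Rademacher's theorem the difference quotients converge at almost every x, for all w at once;
the Lipschitz constant bounds them. -/
theorem KernelTendsto.mul_quotient (h : KernelTendsto L κ κ₀) (hu : LipschitzWith C u)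
    (hε : ∀ k, 0 < ε k) (hε0 : Tendsto ε atTop (𝓝 0)) :
    KernelTendsto L (fun k x w => κ k x w * ((ε k)⁻¹ * (u (x + ε k • w) - u x)))
      fun x w => κ₀ x w * fderiv ℝ u x w := by
  have hc := hu.continuous
  refine h.mul (fun k x _ => (by fun_prop : Continuous fun w =>
    (ε k)⁻¹ * (u (x + ε k • w) - u x)).aestronglyMeasurable)
    (fun R => ⟨C * R, Eventually.of_forall fun k x _ w hw => (abs_quotient_le hu (hε k) x w).trans
      (mul_le_mul_of_nonneg_left hw C.2)⟩) ?_
  filter_upwards [hu.ae_differentiableAt] with x hx _ w using tendsto_quotient hε hε0 hx w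

theorem IsKernel.bddTendsto_kernelOp (h : IsKernel Ψ) (hL : IsCompact L) (hu : Continuous u)
    (hε : ∀ k, 0 < ε k ∧ ε k ≤ 1) (hε0 : Tendsto ε atTop (𝓝 0)) :
    BddTendsto L (fun k => kernelOp Ψ (ε k) u) fun x => u x * ∫ w, Ψ (0, x, w) := by
  have := ((h.kernelTendsto hL hε hε0).mul_shift hL hu hε hε0).integral
  refine this.congr (Eventually.of_forall fun k x _ => rfl) (Eventually.of_forall fun x _ => ?_)
  rw [integral_mul_const, mul_comm]

theorem kernelOp_eq_quotient (h : IsKernel Ψ) (hu : Continuous u) (ε : ℝ)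
    (x : Model n) : ε⁻¹ * kernelOp Ψ ε u x =
      (∫ w, Ψ (ε, x, w) * (ε⁻¹ * (u (x + ε • w) - u x))) + ε⁻¹ * u x * ∫ w, Ψ (ε, x, w) := by
  rw [kernelOp, ← integral_const_mul, ← integral_const_mul, ← integral_add]
  · refine integral_congr_ae (Eventually.of_forall fun w => ?_)
    simp only
    ring
  · exact h.integrable_mul ε x (by fun_prop)
  · refine Integrable.const_mul ?_ _
    simpa using h.integrable_mul ε x (u := fun _ => 1) continuous_const

/-- Since the kernel has mean zero, u(x) can be subtracted under the integral; the factor 1/ε then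
forms a difference quotient. -/
theorem IsKernel.bddTendsto_inv_mul_kernelOp (h : IsKernel Ψ) (hL : IsCompact L)
    (hu : LipschitzWith C u) (hε : ∀ k, 0 < ε k ∧ ε k ≤ 1) (hε0 : Tendsto ε atTop (𝓝 0))
    (h0 : ∀ ε, ∀ x ∈ L, ∫ w, Ψ (ε, x, w) = 0) :
    BddTendsto L (fun k x => (ε k)⁻¹ * kernelOp Ψ (ε k) u x)
      fun x => ∫ w, Ψ (0, x, w) * fderiv ℝ u x w := by
  refine ((h.kernelTendsto hL hε hε0).mul_quotient hu (fun k => (hε k).1) hε0).integral.congr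
    (Eventually.of_forall fun k x hx => ?_) (Eventually.of_forall fun x _ => rfl)
  rw [kernelOp_eq_quotient h hu.continuous, h0 _ x hx, mul_zero, add_zero]

theorem IsKernel.bddTendsto_inv_mul_kernelOp_dw (h : IsKernel Ψ) (hL : IsCompact L)
    (hu : LipschitzWith C u) (hε : ∀ k, 0 < ε k ∧ ε k ≤ 1) (hε0 : Tendsto ε atTop (𝓝 0))
    (i : Fin n) :
    BddTendsto L (fun k x => (ε k)⁻¹ * kernelOp (LipschitzSpacetime.dw i Ψ) (ε k) u x)
      fun x => -(pderiv i u x * ∫ w, Ψ (0, x, w)) := by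
  refine ((h.dw i).bddTendsto_inv_mul_kernelOp hL hu hε hε0
    fun ε x _ => h.integral_dw i ε x).congr (Eventually.of_forall fun k x hx => rfl)
    (Eventually.of_forall fun x _ => ?_)
  rw [h.integral_dw_mul_clm, pderiv]

/-- The kernel `Φ` is, at `ε = 0`, the multiple `c H` of a kernel `H` of mass one. -/
structure KernelAtZero (N : Set (Model n)) (Φ H : ℝ × Model n × Model n → ℝ) (c : ℝ) : Prop where
  kernel : IsKernel Φ
  kernel_one : IsKernel H
  eq_mul : ∀ x ∈ N, ∀ w, Φ (0, x, w) = c * H (0, x, w)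
  integral_eq_one : ∀ x ∈ N, ∫ w, H (0, x, w) = 1

namespace KernelAtZero

theorem integral_eq (h : KernelAtZero N Φ H c) {x : Model n} (hx : x ∈ N) :
    ∫ w, Φ (0, x, w) = c := by
  simp only [h.eq_mul x hx, integral_const_mul, h.integral_eq_one x hx, mul_one]

/-- The mass of Φ(0, x, ·) is constant on the open set `N`, so its derivatives in x vanish. -/
theorem integral_dx (h : KernelAtZero N Φ H c) (hN : IsOpen N) (i : Fin n) {x : Model n}
    (hx : x ∈ N) : ∫ w, dx i Φ (0, x, w) = 0 := by
  rw [← h.kernel.pderiv_integral, pderiv_congr (g := fun _ => c)]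
  · simp [pderiv]
  · filter_upwards [hN.mem_nhds hx] with y hy using h.integral_eq hy

theorem integral_dx_dx (h : KernelAtZero N Φ H c) (hN : IsOpen N) (i j : Fin n) {x : Model n}
    (hx : x ∈ N) : ∫ w, dx i (dx j Φ) (0, x, w) = 0 := by
  rw [← (h.kernel.dx j).pderiv_integral, pderiv_congr (g := fun _ => 0)]
  · simp [pderiv]
  · filter_upwards [hN.mem_nhds hx] with y hy using h.integral_dx hN j hy

/-- The source of the O(ε) rate. The rescaled error consists of a difference quotient of u and of
u(x) times the deviation of the mass of Φ(ε, x, ·) from c, which Hadamard's lemma shows to be O(ε).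
-/
theorem bddTendsto_inv_mul_sub (h : KernelAtZero N Φ H c) (hL : IsCompact L) (hLN : L ⊆ N)
    (hu : LipschitzWith C u) (hε : ∀ k, 0 < ε k ∧ ε k ≤ 1) (hε0 : Tendsto ε atTop (𝓝 0)) :
    BddTendsto L (fun k x => (ε k)⁻¹ * (kernelOp Φ (ε k) u x - c * u x))
      fun x => (∫ w, Φ (0, x, w) * fderiv ℝ u x w) + u x * ∫ w, epsQuotient Φ (0, x, w) := by
  have hq := h.kernel.epsQuotient
  have h1 := (hq.kernelTendsto hL hε hε0).integral
  have h2 : BddTendsto L (fun _ => u) u :=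
    BddTendsto.of_bound (hL.exists_bound_of_continuousOn hu.continuous.continuousOn)
  refine ((((h.kernel.kernelTendsto hL hε hε0).mul_quotient hu (fun k => (hε k).1) hε0).integral).add
    (h2.mul h1)).congr (Eventually.of_forall fun k x hx => ?_) (Eventually.of_forall fun x _ => rfl)
  have hk := (hε k).1.ne'
  have h3 : ∫ w, Φ (ε k, x, w) = c + ε k * ∫ w, epsQuotient Φ (ε k, x, w) := by
    rw [← h.integral_eq (hLN hx), ← integral_const_mul, ← integral_add]
    · refine integral_congr_ae (Eventually.of_forall fun w => ?_)
      simp only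
      rw [← h.kernel.sub_eq_mul_epsQuotient]
      ring
    · simpa using h.kernel.integrable_mul 0 x (u := fun _ => 1) continuous_const
    · refine Integrable.const_mul ?_ _
      simpa using hq.integrable_mul (ε k) x (u := fun _ => 1) continuous_const
  rw [mul_sub, kernelOp_eq_quotient h.kernel hu.continuous, h3]
  field_simp
  ring

/-- The term with the derivative of the kernel in x has limit zero because the mass is constant;
integration by parts in the other term produces the derivative of u. -/
theorem bddTendsto_pderiv (h : KernelAtZero N Φ H c) (hL : IsCompact L) (hN : IsOpen N)
    (hLN : L ⊆ N) (hu : LipschitzWith C u) (hε : ∀ k, 0 < ε k ∧ ε k ≤ 1)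
    (hε0 : Tendsto ε atTop (𝓝 0)) (i : Fin n) :
    BddTendsto L (fun k => pderiv i (kernelOp Φ (ε k) u)) fun x => c * pderiv i u x := by
  refine (((h.kernel.dx i).bddTendsto_kernelOp hL hu.continuous hε hε0).sub
    (h.kernel.bddTendsto_inv_mul_kernelOp_dw hL hu hε hε0 i)).congr
    (Eventually.of_forall fun k x _ => ?_) (Eventually.of_forall fun x hx => ?_)
  · rw [h.kernel.pderiv_kernelOp (hε k).1 hu.continuous]
  · rw [h.integral_dx hN i (hLN hx), h.integral_eq (hLN hx)]
    ring

/-- The second derivatives of the approximation, up to a null sequence. -/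
theorem bddTendsto_pderiv_pderiv (h : KernelAtZero N Φ H c) (hL : IsCompact L) (hN : IsOpen N)
    (hLN : L ⊆ N) (hu : LipschitzWith C u) (hε : ∀ k, 0 < ε k ∧ ε k ≤ 1)
    (hε0 : Tendsto ε atTop (𝓝 0)) (i j : Fin n) :
    BddTendsto L (fun k x => pderiv i (pderiv j (kernelOp Φ (ε k) u)) x
      - c * ((ε k)⁻¹ * ((ε k)⁻¹ * ∫ w, dw i (dw j H) (0, x, w) * u (x + ε k • w))))
      fun _ => 0 := by
  have hΦ := h.kernel
  have hq := hΦ.epsQuotient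
  have hc := hu.continuous
  -- Two derivatives give four terms. In the one of order ε⁻² the kernel Φ is replaced by cH(0, ·)
  -- plus ε times its quotient: the first part is the one subtracted in the statement, the second
  -- joins the terms of order ε⁻¹. Every remaining limit contains the integral of an x-derivative of
  -- Φ(0, ·) or of a w-derivative, hence is zero.
  have h1 := ((hΦ.dx j).dx i).bddTendsto_kernelOp hL hc hε hε0
  have h2 := (hΦ.dx j).bddTendsto_inv_mul_kernelOp_dw hL hu hε hε0 i
  have h3 := (hΦ.dx i).bddTendsto_inv_mul_kernelOp_dw hL hu hε hε0 j
  have h4 := (hq.dw j).bddTendsto_inv_mul_kernelOp_dw hL hu hε hε0 i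
  refine (((h1.sub h2).sub h3).add h4).congr (Eventually.of_forall fun k x hx => ?_)
    (Eventually.of_forall fun x hx => ?_)
  · have hk := (hε k).1
    have e1 : pderiv j (kernelOp Φ (ε k) u) =
        fun x => kernelOp (dx j Φ) (ε k) u x - (ε k)⁻¹ * kernelOp (dw j Φ) (ε k) u x :=
      funext fun x => hΦ.pderiv_kernelOp hk hc j x
    have e2 : pderiv i (pderiv j (kernelOp Φ (ε k) u)) x =
        pderiv i (kernelOp (dx j Φ) (ε k) u) x - (ε k)⁻¹ * pderiv i (kernelOp (dw j Φ) (ε k) u) x := by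
      rw [e1, ← pderiv_const_mul]
      have d1 := ((hΦ.dx j).contDiff_kernelOp hk hc).differentiable (by simp) x
      have d2 := ((hΦ.dw j).contDiff_kernelOp hk hc).differentiable (by simp) x
      simp only [pderiv]
      rw [fderiv_fun_sub d1 (d2.const_mul _)]
      rfl
    have e3 : kernelOp (dw i (dw j Φ)) (ε k) u x =
        c * (∫ w, dw i (dw j H) (0, x, w) * u (x + ε k • w)) +
          ε k * kernelOp (dw i (dw j (epsQuotient Φ))) (ε k) u x := by
      have hH := h.kernel_one
      have p1 : ∀ v, dw j Φ (ε k, x, v) =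
          c * dw j H (0, x, v) + ε k * dw j (epsQuotient Φ) (ε k, x, v) := fun v => by
        rw [dw_eq_pderiv hΦ, dw_eq_pderiv hH, dw_eq_pderiv hq, ← pderiv_const_mul,
          ← pderiv_const_mul]
        have d1 := ((hH.contDiff_slice 0 x).differentiable (by simp) v).const_mul c
        have d2 := ((hq.contDiff_slice (ε k) x).differentiable (by simp) v).const_mul (ε k)
        simp only [pderiv, ← add_apply]
        rw [← fderiv_fun_add d1 d2]
        congr 2
        funext w
        rw [← h.eq_mul x (hLN hx), ← hΦ.sub_eq_mul_epsQuotient]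
        ring
      have p2 : ∀ w, dw i (dw j Φ) (ε k, x, w) =
          c * dw i (dw j H) (0, x, w) + ε k * dw i (dw j (epsQuotient Φ)) (ε k, x, w) := fun w => by
        rw [dw_eq_pderiv (hΦ.dw j), dw_eq_pderiv (hH.dw j), dw_eq_pderiv (hq.dw j),
          ← pderiv_const_mul, ← pderiv_const_mul]
        have d1 := (((hH.dw j).contDiff_slice 0 x).differentiable (by simp) w).const_mul c
        have d2 := (((hq.dw j).contDiff_slice (ε k) x).differentiable (by simp) w).const_mul (ε k)
        simp only [pderiv, ← add_apply]
        rw [← fderiv_fun_add d1 d2]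
        congr 2
        funext v
        exact p1 v
      have hshift : Continuous fun w => u (x + ε k • w) := by fun_prop
      rw [kernelOp, kernelOp, ← integral_const_mul, ← integral_const_mul, ← integral_add]
      · refine integral_congr_ae (Eventually.of_forall fun w => ?_)
        simp only [p2]
        ring
      · exact (((hH.dw j).dw i).integrable_mul 0 x hshift).const_mul _
      · exact (((hq.dw j).dw i).integrable_mul (ε k) x hshift).const_mul _
    rw [e2, (hΦ.dx j).pderiv_kernelOp hk hc, (hΦ.dw j).pderiv_kernelOp hk hc, e3, hΦ.dx_dw]
    field_simp
    ring
  · rw [h.integral_dx_dx hN i j (hLN hx), h.integral_dx hN j (hLN hx), h.integral_dx hN i (hLN hx),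
      hq.integral_dw]
    ring

end KernelAtZero

/-- Integration by parts for the rescaled Lipschitz function `w ↦ u(x + ε w)`. -/
theorem integral_pderiv_mul_shift (hu : LipschitzWith C u) {f : Model n → ℝ}
    (hf : ContDiff ℝ ∞ f) (hfs : HasCompactSupport f) {ε : ℝ} (hε : 0 < ε) (i : Fin n)
    (x : Model n) :
    ∫ w, pderiv i f w * u (x + ε • w) = -(ε * ∫ w, f w * pderiv i u (x + ε • w)) := by
  obtain ⟨D, hD⟩ := hf.lipschitzWith_of_hasCompactSupport hfs (by simp)
  have hshift : LipschitzWith (C * ⟨ε, hε.le⟩) fun w => u (x + ε • w) := by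
    refine hu.comp (LipschitzWith.of_dist_le_mul fun v w => ?_)
    rw [dist_add_left, dist_smul₀, Real.norm_eq_abs, abs_of_pos hε]
    rfl
  have key := hshift.integral_lineDeriv_mul_eq (μ := volume) hD hfs (EuclideanSpace.single i 1)
  have h1 : ∀ w, lineDeriv ℝ f w (-EuclideanSpace.single i 1) = -pderiv i f w := fun w => by
    rw [((hf.differentiable (by simp)) w).lineDeriv_eq_fderiv, map_neg, pderiv]
  -- The affine map w ↦ x + εw pulls null sets back to null sets, so Rademacher's theorem for u
  -- applies at x + εw for almost every w.
  have hqmp : Measure.QuasiMeasurePreserving (fun w : Model n => x + ε • w) volume volume := by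
    refine (measurePreserving_add_left volume x).quasiMeasurePreserving.comp ⟨by fun_prop, ?_⟩
    rw [Measure.map_addHaar_smul volume hε.ne']
    exact Measure.smul_absolutelyContinuous
  have h2 : ∀ᵐ w : Model n, lineDeriv ℝ (fun w => u (x + ε • w)) w (EuclideanSpace.single i 1) * f w =
      ε * (f w * pderiv i u (x + ε • w)) := by
    filter_upwards [hqmp.ae hu.ae_differentiableAt] with w hw
    have h3 : HasFDerivAt (fun w : Model n => x + ε • w) (ε • .id ℝ (Model n)) w :=
      ((hasFDerivAt_id (𝕜 := ℝ) w).const_smul ε).const_add x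
    have h4 : HasFDerivAt (fun w => u (x + ε • w))
        ((fderiv ℝ u (x + ε • w)).comp (ε • .id ℝ (Model n))) w :=
      hw.hasFDerivAt.comp w h3
    rw [h4.differentiableAt.lineDeriv_eq_fderiv, h4.fderiv, pderiv]
    simp
    ring
  rw [integral_congr_ae h2, integral_const_mul] at key
  simp only [h1, neg_mul, integral_neg] at key
  rw [key, neg_neg]

end LipschitzSpacetime

end
noncomputable section

namespace LipschitzSpacetime

variable {n : ℕ} {L N : Set (Model n)} {ε : ℕ → ℝ}

/-! ## Convergence at a rate -/

/-- `f k = f₀ + O(ε k)` uniformly on `L`, with bounded `f₀`. -/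
structure RateTendsto (L : Set (Model n)) (ε : ℕ → ℝ) (f : ℕ → Model n → ℝ) (f₀ : Model n → ℝ) :
    Prop where
  rate : ∃ C : ℝ, ∀ᶠ k in atTop, ∀ x ∈ L, |f k x - f₀ x| ≤ C * ε k
  bdd : ∃ C : ℝ, ∀ x ∈ L, |f₀ x| ≤ C

namespace RateTendsto

variable {f g : ℕ → Model n → ℝ} {f₀ g₀ : Model n → ℝ}

theorem const (c : ℝ) : RateTendsto L ε (fun _ _ => c) fun _ => c :=
  ⟨⟨0, by simp⟩, ⟨|c|, fun _ _ => le_rfl⟩⟩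

theorem add (hf : RateTendsto L ε f f₀) (hg : RateTendsto L ε g g₀) :
    RateTendsto L ε (fun k x => f k x + g k x) fun x => f₀ x + g₀ x := by
  obtain ⟨⟨C, hC⟩, C', hC'⟩ := hf
  obtain ⟨⟨D, hD⟩, D', hD'⟩ := hg
  refine ⟨⟨C + D, ?_⟩, C' + D', fun x hx => (abs_add_le _ _).trans (add_le_add (hC' x hx) (hD' x hx))⟩
  filter_upwards [hC, hD] with k h1 h2 x hx
  rw [add_sub_add_comm, add_mul]
  exact (abs_add_le _ _).trans (add_le_add (h1 x hx) (h2 x hx))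

theorem mul (hε : ∀ k, 0 < ε k ∧ ε k ≤ 1) (hf : RateTendsto L ε f f₀) (hg : RateTendsto L ε g g₀) :
    RateTendsto L ε (fun k x => f k x * g k x) fun x => f₀ x * g₀ x := by
  obtain ⟨⟨C, hC⟩, C', hC'⟩ := hf
  obtain ⟨⟨D, hD⟩, D', hD'⟩ := hg
  refine ⟨⟨|C| * |D| + |C| * |D'| + |C'| * |D|, ?_⟩, |C'| * |D'|, fun x hx => ?_⟩
  · filter_upwards [hC, hD] with k h1 h2 x hx
    have e : f k x * g k x - f₀ x * g₀ x = (f k x - f₀ x) * (g k x - g₀ x) +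
      (f k x - f₀ x) * g₀ x + f₀ x * (g k x - g₀ x) := by ring
    obtain ⟨p, p'⟩ := hε k
    have a1 : |f k x - f₀ x| ≤ |C| * ε k :=
      (h1 x hx).trans (mul_le_mul_of_nonneg_right (le_abs_self C) p.le)
    have a2 : |g k x - g₀ x| ≤ |D| * ε k :=
      (h2 x hx).trans (mul_le_mul_of_nonneg_right (le_abs_self D) p.le)
    have a3 := (hC' x hx).trans (le_abs_self C')
    have a4 := (hD' x hx).trans (le_abs_self D')
    rw [e]
    refine (abs_add_three _ _ _).trans ?_
    rw [abs_mul, abs_mul, abs_mul, add_mul, add_mul]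
    have b2 : |g k x - g₀ x| ≤ |D| := a2.trans (mul_le_of_le_one_right (abs_nonneg _) p')
    have c1 := mul_le_mul a1 b2 (abs_nonneg _) (mul_nonneg (abs_nonneg C) p.le)
    have c2 := mul_le_mul a1 a4 (abs_nonneg _) (mul_nonneg (abs_nonneg C) p.le)
    have c3 := mul_le_mul a3 a2 (abs_nonneg _) (abs_nonneg C')
    linarith
  · rw [abs_mul]
    exact mul_le_mul ((hC' x hx).trans (le_abs_self _)) ((hD' x hx).trans (le_abs_self _))
      (abs_nonneg _) (abs_nonneg _)

theorem sum {ι : Type*} (s : Finset ι) {f : ι → ℕ → Model n → ℝ}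
    {f₀ : ι → Model n → ℝ} (h : ∀ i ∈ s, RateTendsto L ε (f i) (f₀ i)) :
    RateTendsto L ε (fun k x => ∑ i ∈ s, f i k x) fun x => ∑ i ∈ s, f₀ i x := by
  classical
  induction s using Finset.induction_on with
  | empty => simpa using const 0
  | insert a s ha ih =>
    simp only [Finset.sum_insert ha]
    exact (h a (Finset.mem_insert_self _ _)).add
      (ih fun i hi => h i (Finset.mem_insert_of_mem hi))

theorem prod (hε : ∀ k, 0 < ε k ∧ ε k ≤ 1) {ι : Type*} (s : Finset ι) {f : ι → ℕ → Model n → ℝ}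
    {f₀ : ι → Model n → ℝ} (h : ∀ i ∈ s, RateTendsto L ε (f i) (f₀ i)) :
    RateTendsto L ε (fun k x => ∏ i ∈ s, f i k x) fun x => ∏ i ∈ s, f₀ i x := by
  classical
  induction s using Finset.induction_on with
  | empty => simpa using const 1
  | insert a s ha ih =>
    simp only [Finset.prod_insert ha]
    exact mul hε (h a (Finset.mem_insert_self _ _))
      (ih fun i hi => h i (Finset.mem_insert_of_mem hi))

theorem eventually_abs_ge (hε0 : Tendsto ε atTop (𝓝 0)) (hf : RateTendsto L ε f f₀) {c : ℝ}
    (hc : 0 < c) (h0 : ∀ x ∈ L, c ≤ |f₀ x|) : ∀ᶠ k in atTop, ∀ x ∈ L, c / 2 ≤ |f k x| := by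
  obtain ⟨C, hC⟩ := hf.rate
  have h1 : Tendsto (fun k => C * ε k) atTop (𝓝 0) := by simpa using hε0.const_mul C
  filter_upwards [hC, h1.eventually_lt_const (half_pos hc)] with k hk h2 x hx
  have h3 := abs_sub_abs_le_abs_sub (f₀ x) (f k x)
  rw [abs_sub_comm] at h3
  linarith [hk x hx, h0 x hx]

theorem inv (hε0 : Tendsto ε atTop (𝓝 0))
    (hf : RateTendsto L ε f f₀) {c : ℝ} (hc : 0 < c) (h0 : ∀ x ∈ L, c ≤ |f₀ x|) :
    RateTendsto L ε (fun k x => (f k x)⁻¹) fun x => (f₀ x)⁻¹ := by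
  obtain ⟨C, hC⟩ := hf.rate
  refine ⟨⟨2 / c * (1 / c) * C, ?_⟩, c⁻¹, fun x hx => ?_⟩
  · filter_upwards [hC, hf.eventually_abs_ge hε0 hc h0] with k hk h2 x hx
    have p1 : 0 < |f k x| := (half_pos hc).trans_le (h2 x hx)
    have p2 : 0 < |f₀ x| := hc.trans_le (h0 x hx)
    have e : (f k x)⁻¹ - (f₀ x)⁻¹ = (f k x)⁻¹ * (f₀ x)⁻¹ * (f₀ x - f k x) := by
      have := abs_pos.1 p1
      have := abs_pos.1 p2
      field_simp
    rw [e, abs_mul, abs_mul, abs_inv, abs_inv, abs_sub_comm, mul_assoc (2 / c * (1 / c))]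
    refine mul_le_mul (mul_le_mul ?_ ?_ (by positivity) (by positivity)) (hk x hx) (abs_nonneg _)
      (by positivity)
    · rw [show 2 / c = (c / 2)⁻¹ by rw [inv_div]]
      exact inv_anti₀ (half_pos hc) (h2 x hx)
    · rw [one_div]
      exact inv_anti₀ hc (h0 x hx)
  · rw [abs_inv]
    exact inv_anti₀ hc (h0 x hx)

theorem bddTendsto (hε : ∀ k, 0 < ε k ∧ ε k ≤ 1) (hε0 : Tendsto ε atTop (𝓝 0))
    (hf : RateTendsto L ε f f₀) : BddTendsto L f f₀ := by
  obtain ⟨⟨C, hC⟩, D, hD⟩ := hf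
  refine BddTendsto.of_tendsto (fun x hx => ?_) ⟨|C| + D, ?_⟩
  · rw [tendsto_iff_norm_sub_tendsto_zero]
    refine squeeze_zero' (Eventually.of_forall fun _ => norm_nonneg _) ?_
      (by simpa using hε0.const_mul C : Tendsto (fun k => C * ε k) atTop (𝓝 0))
    filter_upwards [hC] with k hk using hk x hx
  · filter_upwards [hC] with k hk x hx
    have h1 := hk x hx
    have h2 : C * ε k ≤ |C| := (mul_le_mul_of_nonneg_right (le_abs_self C) (hε k).1.le).trans
      (mul_le_of_le_one_right (abs_nonneg _) (hε k).2)
    have h3 := abs_sub_abs_le_abs_sub (f k x) (f₀ x)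
    linarith [hD x hx]

theorem bdd_inv_mul_sub (hε : ∀ k, 0 < ε k) (hf : RateTendsto L ε f f₀) :
    ∃ C : ℝ, ∀ᶠ k in atTop, ∀ x ∈ L, |(ε k)⁻¹ * (f k x - f₀ x)| ≤ C := by
  obtain ⟨C, hC⟩ := hf.rate
  refine ⟨C, ?_⟩
  filter_upwards [hC] with k hk x hx
  rw [abs_mul, abs_inv, abs_of_pos (hε k), inv_mul_le_iff₀ (hε k), mul_comm]
  exact hk x hx

end RateTendsto

/-! ## Inverse matrices -/

/-- Cramer's rule: entries of the inverse are quotients of determinants, so continuity,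
measurability, smoothness and rates pass from the entries of a matrix to those of its inverse. -/
theorem inv_apply_eq (A : Matrix (Fin n) (Fin n) ℝ) (p q : Fin n) :
    A⁻¹ p q = A.det⁻¹ * A.adjugate p q := by
  rw [Matrix.inv_def, Ring.inverse_eq_inv', Matrix.smul_apply, smul_eq_mul]

section

variable {G : Model n → Matrix (Fin n) (Fin n) ℝ}

theorem continuousOn_det {s : Set (Model n)} (h : ∀ a b, ContinuousOn (fun z => G z a b) s) :
    ContinuousOn (fun z => (G z).det) s := by
  simp only [Matrix.det_apply]
  exact continuousOn_finsetSum _ fun σ _ => (continuousOn_finsetProd _ fun i _ => h _ _).const_smul _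

/-- An adjugate entry is the determinant of the matrix with one row replaced by a unit vector, so
its entries are old entries or constants. -/
theorem updateRow_entry (P : (Model n → ℝ) → Prop) (hP : ∀ c : ℝ, P fun _ => c)
    (h : ∀ a b, P fun z => G z a b) (p q a b : Fin n) :
    P fun z => (G z).updateRow q (Pi.single p 1) a b := by
  simp only [Matrix.updateRow_apply]
  by_cases hi : a = q
  · simpa only [if_pos hi] using hP _
  · simpa only [if_neg hi] using h a b

theorem continuousOn_inv_apply {s : Set (Model n)} (h : ∀ a b, ContinuousOn (fun z => G z a b) s)
    (hd : ∀ z ∈ s, (G z).det ≠ 0) (p q : Fin n) : ContinuousOn (fun z => (G z)⁻¹ p q) s := by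
  simp only [inv_apply_eq, Matrix.adjugate_apply]
  exact ((continuousOn_det h).inv₀ hd).mul
    (continuousOn_det fun a b => updateRow_entry (fun f => ContinuousOn f s)
      (fun _ => continuousOn_const) h p q a b)

theorem measurable_det (h : ∀ a b, Measurable fun z => G z a b) :
    Measurable fun z => (G z).det := by
  simp only [Matrix.det_apply]
  exact Finset.measurable_sum _ fun σ _ => (Finset.measurable_prod _ fun i _ => h _ _).const_smul _

theorem measurable_inv_apply (h : ∀ a b, Measurable fun z => G z a b) (p q : Fin n) :
    Measurable fun z => (G z)⁻¹ p q := by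
  simp only [inv_apply_eq, Matrix.adjugate_apply]
  exact (measurable_det h).inv.mul
    (measurable_det fun a b => updateRow_entry Measurable (fun _ => measurable_const) h p q a b)

theorem contDiffAt_det {x : Model n} (h : ∀ a b, ContDiffAt ℝ ∞ (fun z => G z a b) x) :
    ContDiffAt ℝ ∞ (fun z => (G z).det) x := by
  simp only [Matrix.det_apply]
  exact ContDiffAt.sum fun σ _ => (contDiffAt_prod fun i _ => h _ _).const_smul _

theorem contDiffAt_inv_apply {x : Model n} (h : ∀ a b, ContDiffAt ℝ ∞ (fun z => G z a b) x)
    (hd : (G x).det ≠ 0) (p q : Fin n) : ContDiffAt ℝ ∞ (fun z => (G z)⁻¹ p q) x := by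
  simp only [inv_apply_eq, Matrix.adjugate_apply]
  exact ((contDiffAt_det h).inv hd).mul
    (contDiffAt_det fun a b => updateRow_entry (fun f => ContDiffAt ℝ ∞ f x)
      (fun _ => contDiffAt_const) h p q a b)

theorem RateTendsto.det (hε : ∀ k, 0 < ε k ∧ ε k ≤ 1)
    {Gk : ℕ → Model n → Matrix (Fin n) (Fin n) ℝ}
    (h : ∀ a b, RateTendsto L ε (fun k z => Gk k z a b) fun z => G z a b) :
    RateTendsto L ε (fun k z => (Gk k z).det) fun z => (G z).det := by
  simp only [Matrix.det_apply']
  exact RateTendsto.sum _ fun σ _ =>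
    (RateTendsto.const _).mul hε (RateTendsto.prod hε _ fun i _ => h _ _)

theorem RateTendsto.inv_apply (hε : ∀ k, 0 < ε k ∧ ε k ≤ 1) (hε0 : Tendsto ε atTop (𝓝 0))
    {Gk : ℕ → Model n → Matrix (Fin n) (Fin n) ℝ}
    (h : ∀ a b, RateTendsto L ε (fun k z => Gk k z a b) fun z => G z a b) {c : ℝ} (hc : 0 < c)
    (h0 : ∀ x ∈ L, c ≤ |(G x).det|) (p q : Fin n) :
    RateTendsto L ε (fun k z => (Gk k z)⁻¹ p q) fun z => (G z)⁻¹ p q := by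
  simp only [inv_apply_eq, Matrix.adjugate_apply]
  refine ((RateTendsto.det hε h).inv hε0 hc h0).mul hε (RateTendsto.det hε fun a b => ?_)
  simp only [Matrix.updateRow_apply]
  by_cases hi : a = q
  · simpa only [if_pos hi] using RateTendsto.const _
  · simpa only [if_neg hi] using h a b

/-- The resolvent identity A⁻¹ - B⁻¹ = -A⁻¹(A - B)B⁻¹ in components. It yields the derivative of the
inverse and also expresses difference quotients of G⁻¹ through those of G. -/
theorem inv_apply_sub (A B : Matrix (Fin n) (Fin n) ℝ) (hA : A.det ≠ 0) (hB : B.det ≠ 0)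
    (p q : Fin n) : A⁻¹ p q - B⁻¹ p q = -∑ r, ∑ s, A⁻¹ p r * (A r s - B r s) * B⁻¹ s q := by
  have h1 : A⁻¹ - B⁻¹ = -(A⁻¹ * (A - B) * B⁻¹) := by
    rw [mul_sub, sub_mul, Matrix.nonsing_inv_mul _ (isUnit_iff_ne_zero.2 hA), mul_assoc,
      Matrix.mul_nonsing_inv _ (isUnit_iff_ne_zero.2 hB), one_mul, mul_one, neg_sub]
  have h2 := congrFun (congrFun h1 p) q
  rw [Matrix.sub_apply] at h2
  rw [h2, Matrix.neg_apply, Matrix.mul_apply]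
  simp only [Matrix.mul_apply, Finset.sum_mul, Matrix.sub_apply]
  rw [Finset.sum_comm]

theorem pderiv_inv_apply {x : Model n} (h : ∀ a b, ContDiffAt ℝ ∞ (fun z => G z a b) x)
    (hd : (G x).det ≠ 0) (d p q : Fin n) : pderiv d (fun z => (G z)⁻¹ p q) x =
      -∑ r, ∑ s, (G x)⁻¹ p r * pderiv d (fun z => G z r s) x * (G x)⁻¹ s q := by
  have hdiff : ∀ a b, DifferentiableAt ℝ (fun z => G z a b) x := fun a b =>
    (h a b).differentiableAt (by simp)
  have hinv : ∀ a b, DifferentiableAt ℝ (fun z => (G z)⁻¹ a b) x := fun a b =>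
    (contDiffAt_inv_apply h hd a b).differentiableAt (by simp)
  have hnear : ∀ᶠ z in 𝓝 x, (G z).det ≠ 0 :=
    (contDiffAt_det h).continuousAt.eventually_ne hd
  -- The difference G(z) - G(x) vanishes at z = x, so the product rule leaves only its derivative;
  -- in particular no derivative of the inverse remains on the right.
  have e : (fun z => (G z)⁻¹ p q) =ᶠ[𝓝 x] fun z => (G x)⁻¹ p q -
      ∑ r, ∑ s, (G z)⁻¹ p r * (G z r s - G x r s) * (G x)⁻¹ s q := by
    filter_upwards [hnear] with z hz
    have := inv_apply_sub (G z) (G x) hz hd p q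
    linarith
  have hterm : ∀ r s, HasFDerivAt (fun z => (G z)⁻¹ p r * (G z r s - G x r s) * (G x)⁻¹ s q)
      ((G x)⁻¹ s q • ((G x)⁻¹ p r • fderiv ℝ (fun z => G z r s) x)) x := fun r s => by
    have h1 := ((hinv p r).hasFDerivAt.mul ((hdiff r s).hasFDerivAt.sub_const (G x r s))).mul_const
      ((G x)⁻¹ s q)
    simpa using h1
  have hsum := (HasFDerivAt.fun_sum fun r (_ : r ∈ Finset.univ) =>
    HasFDerivAt.fun_sum fun s (_ : s ∈ Finset.univ) => hterm r s).const_sub ((G x)⁻¹ p q)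
  rw [pderiv_congr e, pderiv, hsum.fderiv]
  simp only [neg_apply, sum_apply, smul_apply, smul_eq_mul, pderiv]
  congr 1
  exact Finset.sum_congr rfl fun r _ => Finset.sum_congr rfl fun s _ => by ring

end

end LipschitzSpacetime

end
noncomputable section

namespace LipschitzSpacetime

variable {n : ℕ} {L N : Set (Model n)} {ε : ℕ → ℝ} {κ : ℕ → Model n → Model n → ℝ}
  {κ₀ : Model n → Model n → ℝ} {r : ℝ} {F : Model n → ℝ}

/-! ## Kernels against functions that are controlled near a set -/

theorem eventually_add_smul_mem (hr : 0 < r) (hε : ∀ k, 0 < ε k) (hε0 : Tendsto ε atTop (𝓝 0))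
    (R : ℝ) : ∀ᶠ k in atTop, ∀ x ∈ L, ∀ w : Model n, ‖w‖ ≤ R →
      x + ε k • w ∈ Metric.cthickening r L := by
  have h1 : Tendsto (fun k => ε k * R) atTop (𝓝 0) := by simpa using hε0.mul_const R
  filter_upwards [h1.eventually_lt_const hr] with k hk x hx w hw
  refine Metric.mem_cthickening_of_dist_le _ x _ _ hx ?_
  rw [dist_self_add_left, norm_smul, Real.norm_eq_abs, abs_of_pos (hε k)]
  exact (mul_le_mul_of_nonneg_left hw (hε k).le).trans hk.le

/-- Eventually the shifted support stays in the neighbourhood, so F may be cut off outside it. This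
matters because the globally extended matrix G is known to be invertible only near `L`. -/
theorem KernelTendsto.integral_mul_of_bdd (h : KernelTendsto L κ κ₀) (hr : 0 < r)
    (hF : Measurable F) (hb : ∃ C, ∀ y ∈ Metric.cthickening r L, |F y| ≤ C)
    (hε : ∀ k, 0 < ε k) (hε0 : Tendsto ε atTop (𝓝 0)) :
    BddTendsto L (fun k x => ∫ w, κ k x w * F (x + ε k • w)) fun x => F x * ∫ w, κ₀ x w := by
  have hT : MeasurableSet (Metric.cthickening r L) := Metric.isClosed_cthickening.measurableSet
  obtain ⟨C, hC⟩ := hb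
  refine (h.integral_mul (hF.indicator hT) ⟨|C|, fun x => ?_⟩ hε hε0).congr ?_
    (Eventually.of_forall fun x hx => ?_)
  · by_cases hx : x ∈ Metric.cthickening r L
    · rw [indicator_of_mem hx]
      exact (hC x hx).trans (le_abs_self C)
    · rw [indicator_of_notMem hx, abs_zero]
      exact abs_nonneg C
  · obtain ⟨R, D, hD⟩ := h.bdd
    filter_upwards [hD, eventually_add_smul_mem hr hε hε0 R] with k h1 h2 x hx
    refine integral_congr_ae (Eventually.of_forall fun w => ?_)
    by_cases hw : w ∈ Metric.closedBall (0 : Model n) R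
    · simp only
      rw [indicator_of_mem (h2 x hx w (mem_closedBall_zero_iff.1 hw))]
    · have := h1 x hx w
      rw [indicator_of_notMem hw] at this
      simp [abs_nonpos_iff.1 this]
  · rw [indicator_of_mem (Metric.self_subset_cthickening L hx)]

theorem KernelTendsto.eventually_integrable_mul (h : KernelTendsto L κ κ₀) (hr : 0 < r)
    (hF : Measurable F) (hb : ∃ C, ∀ y ∈ Metric.cthickening r L, |F y| ≤ C)
    (hε : ∀ k, 0 < ε k) (hε0 : Tendsto ε atTop (𝓝 0)) :
    ∀ᶠ k in atTop, ∀ x ∈ L, Integrable fun w => κ k x w * F (x + ε k • w) := by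
  obtain ⟨R, D, hD⟩ := h.bdd
  obtain ⟨C, hC⟩ := hb
  filter_upwards [hD, eventually_add_smul_mem hr hε hε0 R] with k h1 h2 x hx
  refine (integrable_indicator_closedBall R (|D| * |C|)).mono'
    ((h.aestronglyMeasurable k x hx).mul ?_) (Eventually.of_forall fun w => ?_)
  · exact (by fun_prop : Measurable fun w => F (x + ε k • w)).aestronglyMeasurable
  · have h3 := h1 x hx w
    by_cases hw : w ∈ Metric.closedBall (0 : Model n) R
    · rw [indicator_of_mem hw] at h3 ⊢
      rw [Real.norm_eq_abs, abs_mul]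
      exact mul_le_mul (h3.trans (le_abs_self _))
        ((hC _ (h2 x hx w (mem_closedBall_zero_iff.1 hw))).trans (le_abs_self _)) (abs_nonneg _)
        (abs_nonneg _)
    · rw [indicator_of_notMem hw] at h3 ⊢
      rw [abs_nonpos_iff.1 h3]
      simp

theorem KernelTendsto.mul_shift_of_continuousOn (h : KernelTendsto L κ κ₀) (hL : IsCompact L)
    (hr : 0 < r) (hF : Measurable F) (hc : ContinuousOn F (Metric.cthickening r L))
    (hε : ∀ k, 0 < ε k) (hε0 : Tendsto ε atTop (𝓝 0)) :
    KernelTendsto L (fun k x w => κ k x w * F (x + ε k • w)) fun x w => κ₀ x w * F x := by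
  refine h.mul (fun k x _ =>
    (by fun_prop : Measurable fun w => F (x + ε k • w)).aestronglyMeasurable)
    (fun R => ?_) (Eventually.of_forall fun x hx w => ?_)
  · obtain ⟨C, hC⟩ := hL.cthickening.exists_bound_of_continuousOn hc
    refine ⟨C, ?_⟩
    filter_upwards [eventually_add_smul_mem hr hε hε0 R] with k hk x hx w hw
    exact hC _ (hk x hx w hw)
  · have hm : Metric.cthickening r L ∈ 𝓝 x :=
      mem_of_superset (Metric.ball_mem_nhds x hr) fun y hy =>
        Metric.mem_cthickening_of_dist_le _ x _ _ hx (Metric.mem_ball.1 hy).le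
    exact ((hc.continuousAt hm).tendsto).comp (tendsto_add_smul hε0 x w)

theorem IsKernel.dw_dw {Φ : ℝ × Model n × Model n → ℝ} (h : IsKernel Φ) (i j : Fin n) :
    LipschitzSpacetime.dw i (LipschitzSpacetime.dw j Φ) =
      LipschitzSpacetime.dw j (LipschitzSpacetime.dw i Φ) := by
  funext p
  have hd : DifferentiableAt ℝ (fderiv ℝ Φ) p :=
    ((h.contDiff.fderiv_right (m := ∞) (by simp)).differentiable (by simp)) p
  have hs : IsSymmSndFDerivAt ℝ Φ p :=
    h.contDiff.contDiffAt.isSymmSndFDerivAt (by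
      simp only [minSmoothness_of_isRCLikeNormedField]
      exact WithTop.coe_le_coe.2 le_top)
  have key : ∀ v w, fderiv ℝ (fun q => fderiv ℝ Φ q v) p w = fderiv ℝ (fderiv ℝ Φ) p w v := by
    intro v w
    rw [fderiv_clm_apply hd (differentiableAt_const _)]
    simp
  change fderiv ℝ (fun q => fderiv ℝ Φ q _) p _ = fderiv ℝ (fun q => fderiv ℝ Φ q _) p _
  rw [key, key, hs]

theorem IsKernel.dw_comp_zero {Φ : ℝ × Model n × Model n → ℝ} (h : IsKernel Φ) (i : Fin n) :
    LipschitzSpacetime.dw i (fun p => Φ (0, p.2)) =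
      fun p => LipschitzSpacetime.dw i Φ (0, p.2) := by
  funext ⟨ε, x, w⟩
  rw [dw_eq_pderiv h.comp_zero, dw_eq_pderiv h]

theorem measurable_pderiv (i : Fin n) (f : Model n → ℝ) : Measurable (pderiv i f) :=
  measurable_fderiv_apply_const ℝ f _

theorem abs_pderiv_le {C : NNReal} (hF : LipschitzWith C F) (i : Fin n) (x : Model n) :
    |pderiv i F x| ≤ C := by
  have h1 := (fderiv ℝ F x).le_opNorm (EuclideanSpace.single i 1)
  have h2 := norm_fderiv_le_of_lipschitz ℝ hF (x₀ := x)
  simp only [PiLp.norm_single, norm_one, mul_one] at h1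
  exact h1.trans h2

/-! ## Approximation of the Ricci tensor in coordinates -/

/-- Smooth metrics `Gk k` that approximate the Lipschitz metric `G` near `L` as convolutions with
the kernel `H` at the scales `ε k` do. -/
structure RicciApproximation (L N : Set (Model n)) (G : Model n → Matrix (Fin n) (Fin n) ℝ)
    (Gk : ℕ → Model n → Matrix (Fin n) (Fin n) ℝ) (H : ℝ × Model n × Model n → ℝ) (ε : ℕ → ℝ) :
    Prop where
  isCompact : IsCompact L
  isOpen : IsOpen N
  subset : L ⊆ N
  pos : ∀ k, 0 < ε k ∧ ε k ≤ 1
  tendsto_zero : Tendsto ε atTop (𝓝 0)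
  lipschitz : ∃ C : NNReal, ∀ a b, LipschitzWith C fun z => G z a b
  det_ne_zero : ∀ z ∈ N, (G z).det ≠ 0
  kernel : IsKernel H
  integral_eq_one : ∀ x ∈ N, ∫ w, H (0, x, w) = 1
  contDiffAt : ∀ k, ∀ x ∈ L, ∀ a b, ContDiffAt ℝ ∞ (fun z => Gk k z a b) x
  rate : ∀ a b, ∃ C : ℝ, ∀ᶠ k in atTop, ∀ x ∈ L, |Gk k x a b - G x a b| ≤ C * ε k
  deriv : ∀ a b i, BddTendsto L (fun k => pderiv i fun z => Gk k z a b) (pderiv i fun z => G z a b)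
  deriv_deriv : ∀ a b i j, BddTendsto L (fun k x => pderiv i (pderiv j fun z => Gk k z a b) x
    - (ε k)⁻¹ * ((ε k)⁻¹ * ∫ w, dw i (dw j H) (0, x, w) * G (x + ε k • w) a b)) fun _ => 0

namespace RicciApproximation

variable {G : Model n → Matrix (Fin n) (Fin n) ℝ} {Gk : ℕ → Model n → Matrix (Fin n) (Fin n) ℝ}
  {H : ℝ × Model n × Model n → ℝ}

theorem continuous (h : RicciApproximation L N G Gk H ε) (a b : Fin n) :
    Continuous fun z => G z a b := by
  obtain ⟨C, hC⟩ := h.lipschitz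
  exact (hC a b).continuous

theorem exists_radius (h : RicciApproximation L N G Gk H ε) :
    ∃ r > 0, Metric.cthickening r L ⊆ N :=
  h.isCompact.exists_cthickening_subset_open h.isOpen h.subset

theorem pos' (h : RicciApproximation L N G Gk H ε) (k : ℕ) : 0 < ε k := (h.pos k).1

theorem continuousOn_inv (h : RicciApproximation L N G Gk H ε) (p q : Fin n) :
    ContinuousOn (fun z => (G z)⁻¹ p q) N :=
  continuousOn_inv_apply (fun a b => (h.continuous a b).continuousOn) h.det_ne_zero p q

theorem measurable_inv (h : RicciApproximation L N G Gk H ε) (p q : Fin n) :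
    Measurable fun z => (G z)⁻¹ p q :=
  measurable_inv_apply (fun a b => (h.continuous a b).measurable) p q

theorem rateTendsto (h : RicciApproximation L N G Gk H ε) (a b : Fin n) :
    RateTendsto L ε (fun k z => Gk k z a b) fun z => G z a b :=
  ⟨h.rate a b, h.isCompact.exists_bound_of_continuousOn (h.continuous a b).continuousOn⟩

theorem exists_det_bound (h : RicciApproximation L N G Gk H ε) :
    ∃ c > 0, ∀ x ∈ L, c ≤ |(G x).det| := by
  rcases L.eq_empty_or_nonempty with rfl | hne
  · exact ⟨1, one_pos, by simp⟩
  · obtain ⟨x, hx, hmin⟩ := h.isCompact.exists_isMinOn hne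
      (continuousOn_det fun a b => (h.continuous a b).continuousOn).abs
    exact ⟨_, abs_pos.2 (h.det_ne_zero x (h.subset hx)), fun y hy => hmin hy⟩

theorem rateTendsto_inv (h : RicciApproximation L N G Gk H ε) (p q : Fin n) :
    RateTendsto L ε (fun k z => (Gk k z)⁻¹ p q) fun z => (G z)⁻¹ p q := by
  obtain ⟨c, hc, hc'⟩ := h.exists_det_bound
  exact RateTendsto.inv_apply h.pos h.tendsto_zero h.rateTendsto hc hc' p q

theorem eventually_det_ne_zero (h : RicciApproximation L N G Gk H ε) :
    ∀ᶠ k in atTop, ∀ x ∈ L, (Gk k x).det ≠ 0 := by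
  obtain ⟨c, hc, hc'⟩ := h.exists_det_bound
  filter_upwards [(RateTendsto.det h.pos h.rateTendsto).eventually_abs_ge h.tendsto_zero hc hc']
    with k hk x hx
  exact abs_pos.1 ((half_pos hc).trans_le (hk x hx))

theorem bddTendsto_inv (h : RicciApproximation L N G Gk H ε) (p q : Fin n) :
    BddTendsto L (fun k z => (Gk k z)⁻¹ p q) fun z => (G z)⁻¹ p q :=
  (h.rateTendsto_inv p q).bddTendsto h.pos h.tendsto_zero

theorem bddTendsto_pderiv_inv (h : RicciApproximation L N G Gk H ε) (d p q : Fin n) :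
    BddTendsto L (fun k => pderiv d fun z => (Gk k z)⁻¹ p q) fun x =>
      -∑ r, ∑ s, (G x)⁻¹ p r * pderiv d (fun z => G z r s) x * (G x)⁻¹ s q := by
  refine (BddTendsto.sum Finset.univ fun r _ => BddTendsto.sum Finset.univ fun s _ =>
    ((h.bddTendsto_inv p r).mul (h.deriv r s d)).mul (h.bddTendsto_inv s q)).neg.congr ?_
    (Eventually.of_forall fun x _ => rfl)
  filter_upwards [h.eventually_det_ne_zero] with k hk x hx
  exact pderiv_inv_apply (h.contDiffAt k x hx) (hk x hx) d p q

theorem kernelTendsto (h : RicciApproximation L N G Gk H ε) {Ψ : ℝ × Model n × Model n → ℝ}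
    (hΨ : IsKernel Ψ) : KernelTendsto L (fun _ x w => Ψ (0, x, w)) fun x w => Ψ (0, x, w) :=
  hΨ.comp_zero.kernelTendsto h.isCompact h.pos h.tendsto_zero

/-- After multiplication by ε the leading term is 1/ε times an operator whose kernel is a second
w-derivative. One integration by parts reduces its limit to the integral of a first w-derivative of
H, which is zero. -/
theorem bddTendsto_eps_mul (h : RicciApproximation L N G Gk H ε) (a b i j : Fin n) :
    BddTendsto L (fun k x => ε k * pderiv i (pderiv j fun z => Gk k z a b) x) fun _ => 0 := by
  obtain ⟨C, hC⟩ := h.lipschitz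
  have h1 := (h.kernel.comp_zero.dw j).bddTendsto_inv_mul_kernelOp_dw h.isCompact (hC a b) h.pos
    h.tendsto_zero i
  have h2 : BddTendsto L (fun k _ => ε k) fun _ => 0 :=
    BddTendsto.of_tendsto (fun _ _ => h.tendsto_zero) ⟨1, Eventually.of_forall fun k _ _ => by
      rw [abs_of_pos (h.pos' k)]; exact (h.pos k).2⟩
  refine ((h2.mul (h.deriv_deriv a b i j)).add h1).congr (Eventually.of_forall fun k x _ => ?_)
    (Eventually.of_forall fun x _ => ?_)
  · have := (h.pos' k).ne'
    rw [h.kernel.dw_comp_zero, (h.kernel.dw j).dw_comp_zero, kernelOp]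
    field_simp
    ring
  · rw [h.kernel.comp_zero.integral_dw]
    ring

/-- One of the two w-derivatives on H is moved onto the Lipschitz function G, where it is an
ordinary derivative almost everywhere and costs a factor ε. -/
theorem bddTendsto_deriv_deriv (h : RicciApproximation L N G Gk H ε) (a b i j : Fin n) :
    BddTendsto L (fun k x => pderiv i (pderiv j fun z => Gk k z a b) x
      + (ε k)⁻¹ * ∫ w, dw i H (0, x, w) * pderiv j (fun z => G z a b) (x + ε k • w))
      fun _ => 0 := by
  obtain ⟨C, hC⟩ := h.lipschitz
  refine (h.deriv_deriv a b i j).congr (Eventually.of_forall fun k x _ => ?_)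
    (Eventually.of_forall fun x _ => rfl)
  have hi := h.kernel.dw i
  have := integral_pderiv_mul_shift (hC a b) (hi.contDiff_slice 0 x) (hi.hasCompactSupport 0 x)
    (h.pos' k) j x
  rw [h.kernel.dw_dw]
  simp only [dw_eq_pderiv hi]
  rw [this]
  have := (h.pos' k).ne'
  field_simp
  ring

/-- The commutator of multiplication by `G⁻¹` and convolution. -/
theorem bddTendsto_commutator (h : RicciApproximation L N G Gk H ε) (d p q i a b : Fin n) :
    BddTendsto L (fun k x => (ε k)⁻¹ * ∫ w, dw d H (0, x, w) *
      (((G (x + ε k • w))⁻¹ p q - (G x)⁻¹ p q) * pderiv i (fun z => G z a b) (x + ε k • w)))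
      fun x => (∑ r, ∑ s, (G x)⁻¹ p r * pderiv d (fun z => G z r s) x * (G x)⁻¹ s q)
        * pderiv i (fun z => G z a b) x := by
  obtain ⟨C, hC⟩ := h.lipschitz
  obtain ⟨ρ, hρ, hρN⟩ := h.exists_radius
  have hd := h.kernel.dw d
  have hDb : ∃ D, ∀ y ∈ Metric.cthickening ρ L, |pderiv i (fun z => G z a b) y| ≤ D :=
    ⟨C, fun y _ => abs_pderiv_le (hC a b) i y⟩
  have hDm := measurable_pderiv i fun z => G z a b
  -- By the resolvent identity the difference of inverses is -G⁻¹(x + εw)(G(x + εw) - G(x))G⁻¹(x).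
  -- Its middle factor over ε converges by Rademacher's theorem and G⁻¹(x + εw) by continuity; the
  -- remaining factor ∂G(x + εw) is then handled at its Lebesgue points.
  have hker : ∀ r s, KernelTendsto L (fun k x w => dw d H (0, x, w) *
      ((ε k)⁻¹ * (G (x + ε k • w) r s - G x r s)) * (G (x + ε k • w))⁻¹ p r)
      (fun x w => dw d H (0, x, w) * fderiv ℝ (fun z => G z r s) x w * (G x)⁻¹ p r) :=
    fun r s => ((h.kernelTendsto hd).mul_quotient (hC r s) h.pos' h.tendsto_zero)
      |>.mul_shift_of_continuousOn h.isCompact hρ (h.measurable_inv p r)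
        ((h.continuousOn_inv p r).mono hρN) h.pos' h.tendsto_zero
  have hinv : ∀ s, BddTendsto L (fun _ z => (G z)⁻¹ s q) fun z => (G z)⁻¹ s q := fun s =>
    BddTendsto.of_bound (h.isCompact.exists_bound_of_continuousOn
      ((h.continuousOn_inv s q).mono h.subset))
  have hsum := (BddTendsto.sum Finset.univ fun r _ => BddTendsto.sum Finset.univ fun s _ =>
    ((hker r s).integral_mul_of_bdd hρ hDm hDb h.pos' h.tendsto_zero).mul (hinv s)).neg
  have hint : ∀ᶠ k in atTop, ∀ r s, ∀ x ∈ L, Integrable fun w => dw d H (0, x, w) *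
      ((ε k)⁻¹ * (G (x + ε k • w) r s - G x r s)) * (G (x + ε k • w))⁻¹ p r *
      pderiv i (fun z => G z a b) (x + ε k • w) :=
    eventually_all.2 fun r => eventually_all.2 fun s =>
      (hker r s).eventually_integrable_mul hρ hDm hDb h.pos' h.tendsto_zero
  refine hsum.congr ?_ (Eventually.of_forall fun x hx => ?_)
  · obtain ⟨R, hR⟩ := hd.support
    filter_upwards [hint, eventually_add_smul_mem hρ h.pos' h.tendsto_zero R] with k hk hmem x hx
    simp only [← integral_mul_const]
    simp_rw [← integral_finsetSum Finset.univ fun s _ => (hk _ s x hx).mul_const ((G x)⁻¹ s q)]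
    rw [← integral_finsetSum Finset.univ fun r _ => integrable_finsetSum Finset.univ fun s _ =>
      (hk r s x hx).mul_const ((G x)⁻¹ s q), ← integral_neg, ← integral_const_mul]
    refine integral_congr_ae (Eventually.of_forall fun w => ?_)
    simp only
    by_cases hw : R ≤ ‖w‖
    · simp [hR (0, x, w) hw]
    · rw [inv_apply_sub _ _ (h.det_ne_zero _ (hρN (hmem x hx w (not_le.1 hw).le)))
        (h.det_ne_zero x (h.subset hx)), neg_mul, mul_neg, mul_neg, neg_inj, Finset.sum_mul,
        Finset.mul_sum, Finset.mul_sum]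
      refine Finset.sum_congr rfl fun r _ => ?_
      rw [Finset.sum_mul, Finset.mul_sum, Finset.mul_sum]
      refine Finset.sum_congr rfl fun s _ => ?_
      ring
  · simp only [integral_mul_const, h.kernel.integral_dw_mul_clm, h.integral_eq_one x (h.subset hx)]
    rw [← Finset.sum_neg_distrib, Finset.sum_mul]
    refine Finset.sum_congr rfl fun r _ => ?_
    rw [← Finset.sum_neg_distrib, Finset.sum_mul]
    refine Finset.sum_congr rfl fun s _ => ?_
    simp only [pderiv]
    ring

/-- The Friedrichs estimate. The expression is a sum of four pieces: ∂(G_k⁻¹)∂G_k; (G_k⁻¹ -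
G⁻¹)∂∂G_k; G⁻¹ times the comparison of ∂∂G_k with its averaged form; and the commutator. The middle
two are null sequences. The first tends to -G⁻¹(∂G)G⁻¹∂G, and the commutator to the same with the
opposite sign. -/
theorem bddTendsto_pderiv_inv_mul (h : RicciApproximation L N G Gk H ε) (d p q i a b : Fin n) :
    BddTendsto L (fun k x =>
      pderiv d (fun z => (Gk k z)⁻¹ p q * pderiv i (fun z => Gk k z a b) z) x
        + (ε k)⁻¹ * ∫ w, dw d H (0, x, w) *
          ((G (x + ε k • w))⁻¹ p q * pderiv i (fun z => G z a b) (x + ε k • w)))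
      fun _ => 0 := by
  obtain ⟨C, hC⟩ := h.lipschitz
  obtain ⟨ρ, hρ, hρN⟩ := h.exists_radius
  have hd := h.kernel.dw d
  have hDm := measurable_pderiv i fun z => G z a b
  have hDb : ∃ D, ∀ y ∈ Metric.cthickening ρ L, |pderiv i (fun z => G z a b) y| ≤ D :=
    ⟨C, fun y _ => abs_pderiv_le (hC a b) i y⟩
  have h1 := (h.bddTendsto_pderiv_inv d p q).mul (h.deriv a b i)
  -- Here the O(ε) rate is indispensable: (G_k⁻¹ - G⁻¹)/ε is bounded and ε∂∂G_k is a null sequence,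
  -- while ∂∂G_k itself need not be bounded.
  have h2 := BddTendsto.bdd_mul_zero ((h.rateTendsto_inv p q).bdd_inv_mul_sub h.pos')
    (h.bddTendsto_eps_mul a b d i)
  have h3 := BddTendsto.bdd_mul_zero (f := fun _ z => (G z)⁻¹ p q)
    ((h.rateTendsto_inv p q).bdd.imp fun _ hC => Eventually.of_forall fun _ => hC)
    (h.bddTendsto_deriv_deriv a b d i)
  have h4 := h.bddTendsto_commutator d p q i a b
  have hi1 := (h.kernelTendsto hd).eventually_integrable_mul hρ hDm hDb h.pos' h.tendsto_zero
  have hi2 := ((h.kernelTendsto hd).mul_shift_of_continuousOn h.isCompact hρ (h.measurable_inv p q)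
    ((h.continuousOn_inv p q).mono hρN) h.pos' h.tendsto_zero).eventually_integrable_mul hρ hDm hDb
    h.pos' h.tendsto_zero
  refine (((h1.add h2).add h3).add h4).congr ?_ (Eventually.of_forall fun x hx => ?_)
  · filter_upwards [h.eventually_det_ne_zero, hi1, hi2] with k hk hi1 hi2 x hx
    have hsm := h.contDiffAt k x hx
    have e1 : pderiv d (fun z => (Gk k z)⁻¹ p q * pderiv i (fun z => Gk k z a b) z) x =
        pderiv d (fun z => (Gk k z)⁻¹ p q) x * pderiv i (fun z => Gk k z a b) x
        + (Gk k x)⁻¹ p q * pderiv d (pderiv i fun z => Gk k z a b) x := by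
      have d1 := (contDiffAt_inv_apply hsm (hk x hx) p q).differentiableAt (by simp)
      have d2 : DifferentiableAt ℝ (pderiv i fun z => Gk k z a b) x :=
        (((hsm a b).fderiv_right (m := ∞) (by simp)).differentiableAt (by simp)).clm_apply
          (differentiableAt_const _)
      have := fderiv_fun_mul d1 d2
      simp only [pderiv] at this ⊢
      rw [this]
      simp only [add_apply, smul_apply, smul_eq_mul]
      ring
    have e2 : ∫ w, dw d H (0, x, w) *
        (((G (x + ε k • w))⁻¹ p q - (G x)⁻¹ p q) * pderiv i (fun z => G z a b) (x + ε k • w)) =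
        (∫ w, dw d H (0, x, w) *
          ((G (x + ε k • w))⁻¹ p q * pderiv i (fun z => G z a b) (x + ε k • w))) -
        (G x)⁻¹ p q * ∫ w, dw d H (0, x, w) * pderiv i (fun z => G z a b) (x + ε k • w) := by
      rw [← integral_const_mul, ← integral_sub]
      · refine integral_congr_ae (Eventually.of_forall fun w => ?_)
        simp only
        ring
      · simpa only [mul_assoc] using hi2 x hx
      · exact (hi1 x hx).const_mul _
    rw [e1, e2]
    have := (h.pos' k).ne'
    field_simp
    ring
  · ring

end RicciApproximation

end LipschitzSpacetime

end
-- Christoffel symbols and the averaged Ricci tensor.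
noncomputable section

namespace LipschitzSpacetime

variable {n : ℕ} {L N : Set (Model n)} {ε : ℕ → ℝ}
  {G : Model n → Matrix (Fin n) (Fin n) ℝ} {Gk : ℕ → Model n → Matrix (Fin n) (Fin n) ℝ}
  {H : ℝ × Model n × Model n → ℝ}

/-- The products `gᵖq ∂ᵢ g_{ab}` of which the Christoffel symbols are composed. -/
def invMulDeriv (G : Model n → Matrix (Fin n) (Fin n) ℝ) (p q i a b : Fin n) (y : Model n) : ℝ :=
  (G y)⁻¹ p q * pderiv i (fun z => G z a b) y

theorem christoffel_eq_sum (G : Model n → Matrix (Fin n) (Fin n) ℝ) (c i j : Fin n) (y : Model n) :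
    christoffel G c i j y = ∑ l, (1 / 2 : ℝ) * (invMulDeriv G c l i j l y
      + invMulDeriv G c l j i l y - invMulDeriv G c l l i j y) := by
  rw [christoffel, Finset.mul_sum]
  exact Finset.sum_congr rfl fun l _ => by simp only [invMulDeriv]; ring

theorem measurable_christoffel (hm : ∀ a b, Measurable fun z => G z a b) (c i j : Fin n) :
    Measurable (christoffel G c i j) := by
  have h : ∀ p q i a b, Measurable (invMulDeriv G p q i a b) := fun p q i a b =>
    (measurable_inv_apply hm p q).mul (measurable_pderiv i _)
  simp only [funext fun y => christoffel_eq_sum G c i j y]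
  exact Finset.measurable_fun_sum _ fun l _ =>
    (((h _ _ _ _ _).add (h _ _ _ _ _)).sub (h _ _ _ _ _)).const_mul _

theorem measurable_ricciQuadratic (hm : ∀ a b, Measurable fun z => G z a b) (i j : Fin n) :
    Measurable (ricciQuadratic G i j) := by
  have h := measurable_christoffel hm
  exact Finset.measurable_fun_sum _ fun k _ => Finset.measurable_fun_sum _ fun l _ =>
    ((h _ _ _).mul (h _ _ _)).sub ((h _ _ _).mul (h _ _ _))

namespace RicciApproximation

theorem bddTendsto_invMulDeriv (h : RicciApproximation L N G Gk H ε) (p q i a b : Fin n) :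
    BddTendsto L (fun k => invMulDeriv (Gk k) p q i a b) (invMulDeriv G p q i a b) :=
  (h.bddTendsto_inv p q).mul (h.deriv a b i)

theorem bddTendsto_christoffel (h : RicciApproximation L N G Gk H ε) (c i j : Fin n) :
    BddTendsto L (fun k => christoffel (Gk k) c i j) (christoffel G c i j) := by
  refine (BddTendsto.sum Finset.univ fun l _ => (((h.bddTendsto_invMulDeriv c l i j l).add
    (h.bddTendsto_invMulDeriv c l j i l)).sub (h.bddTendsto_invMulDeriv c l l i j)).const_mul
      (1 / 2)).congr (Eventually.of_forall fun k x _ => ?_) (Eventually.of_forall fun x _ => ?_)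
  all_goals exact christoffel_eq_sum _ c i j x

theorem bddTendsto_ricciQuadratic (h : RicciApproximation L N G Gk H ε) (i j : Fin n) :
    BddTendsto L (fun k => ricciQuadratic (Gk k) i j) (ricciQuadratic G i j) := by
  have hc := h.bddTendsto_christoffel
  exact BddTendsto.sum Finset.univ fun k _ => BddTendsto.sum Finset.univ fun l _ =>
    ((hc k i j).mul (hc l k l)).sub ((hc k i l).mul (hc l j k))

theorem exists_bound_invMulDeriv (h : RicciApproximation L N G Gk H ε) {s : Set (Model n)}
    (hs : IsCompact s) (hsN : s ⊆ N) (p q i a b : Fin n) :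
    ∃ D, ∀ y ∈ s, |invMulDeriv G p q i a b y| ≤ D := by
  obtain ⟨C, hC⟩ := h.lipschitz
  obtain ⟨D, hD⟩ := hs.exists_bound_of_continuousOn ((h.continuousOn_inv p q).mono hsN)
  refine ⟨|D| * C, fun y hy => ?_⟩
  rw [invMulDeriv, abs_mul]
  exact mul_le_mul ((hD y hy).trans (le_abs_self D)) (abs_pderiv_le (hC a b) i y) (abs_nonneg _)
    (abs_nonneg _)

theorem exists_bound_christoffel (h : RicciApproximation L N G Gk H ε) {s : Set (Model n)}
    (hs : IsCompact s) (hsN : s ⊆ N) : ∃ D, 0 ≤ D ∧ ∀ c i j, ∀ y ∈ s, |christoffel G c i j y| ≤ D := by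
  choose D hD using fun p q i a b => h.exists_bound_invMulDeriv hs hsN p q i a b
  let B : Fin n → Fin n → Fin n → ℝ := fun c i j =>
    ∑ l, (1 / 2 : ℝ) * (|D c l i j l| + |D c l j i l| + |D c l l i j|)
  have hB : ∀ c i j, 0 ≤ B c i j := fun c i j => Finset.sum_nonneg fun l _ => by positivity
  refine ⟨∑ c, ∑ i, ∑ j, B c i j, Finset.sum_nonneg fun c _ => Finset.sum_nonneg fun i _ =>
    Finset.sum_nonneg fun j _ => hB c i j, fun c i j y hy => ?_⟩
  have h1 : |christoffel G c i j y| ≤ B c i j := by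
    rw [christoffel_eq_sum]
    refine (Finset.abs_sum_le_sum_abs _ _).trans (Finset.sum_le_sum fun l _ => ?_)
    rw [abs_mul, abs_of_pos (by norm_num : (0 : ℝ) < 1 / 2)]
    refine mul_le_mul_of_nonneg_left ?_ (by norm_num)
    refine (abs_sub _ _).trans (add_le_add ((abs_add_le _ _).trans (add_le_add ?_ ?_)) ?_)
    all_goals exact (hD _ _ _ _ _ y hy).trans (le_abs_self _)
  have h2 := Finset.single_le_sum (f := fun j => B c i j) (fun j _ => hB c i j) (Finset.mem_univ j)
  have h3 := Finset.single_le_sum (f := fun i => ∑ j, B c i j)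
    (fun i _ => Finset.sum_nonneg fun j _ => hB c i j) (Finset.mem_univ i)
  have h4 := Finset.single_le_sum (f := fun c => ∑ i, ∑ j, B c i j)
    (fun c _ => Finset.sum_nonneg fun i _ => Finset.sum_nonneg fun j _ => hB c i j)
    (Finset.mem_univ c)
  exact h1.trans (h2.trans (h3.trans h4))

theorem exists_bound_ricciQuadratic (h : RicciApproximation L N G Gk H ε) {s : Set (Model n)}
    (hs : IsCompact s) (hsN : s ⊆ N) (i j : Fin n) :
    ∃ D, ∀ y ∈ s, |ricciQuadratic G i j y| ≤ D := by
  obtain ⟨D, hD0, hD⟩ := h.exists_bound_christoffel hs hsN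
  refine ⟨∑ _k : Fin n, ∑ _l : Fin n, (D * D + D * D), fun y hy => ?_⟩
  rw [ricciQuadratic]
  refine (Finset.abs_sum_le_sum_abs _ _).trans (Finset.sum_le_sum fun k _ => ?_)
  refine (Finset.abs_sum_le_sum_abs _ _).trans (Finset.sum_le_sum fun l _ => ?_)
  refine (abs_sub _ _).trans (add_le_add ?_ ?_)
  all_goals
    rw [abs_mul]
    exact mul_le_mul (hD _ _ _ y hy) (hD _ _ _ y hy) (abs_nonneg _) hD0

theorem measurable_entries (h : RicciApproximation L N G Gk H ε) (a b : Fin n) :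
    Measurable fun z => G z a b := (h.continuous a b).measurable

theorem eventually_integrable_mul_invMulDeriv (h : RicciApproximation L N G Gk H ε)
    {Ψ : ℝ × Model n × Model n → ℝ} (hΨ : IsKernel Ψ) (p q i a b : Fin n) :
    ∀ᶠ k in atTop, ∀ x ∈ L, Integrable fun w =>
      Ψ (0, x, w) * invMulDeriv G p q i a b (x + ε k • w) := by
  obtain ⟨r, hr, hrN⟩ := h.exists_radius
  exact (h.kernelTendsto hΨ).eventually_integrable_mul hr
    ((measurable_inv_apply h.measurable_entries p q).mul (measurable_pderiv i _))
    (h.exists_bound_invMulDeriv h.isCompact.cthickening hrN p q i a b) h.pos' h.tendsto_zero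

theorem eventually_integrable_mul_christoffel (h : RicciApproximation L N G Gk H ε)
    {Ψ : ℝ × Model n × Model n → ℝ} (hΨ : IsKernel Ψ) (c i j : Fin n) :
    ∀ᶠ k in atTop, ∀ x ∈ L, Integrable fun w =>
      Ψ (0, x, w) * christoffel G c i j (x + ε k • w) := by
  obtain ⟨r, hr, hrN⟩ := h.exists_radius
  obtain ⟨D, _, hD⟩ := h.exists_bound_christoffel h.isCompact.cthickening hrN
  exact (h.kernelTendsto hΨ).eventually_integrable_mul hr
    (measurable_christoffel h.measurable_entries c i j) ⟨D, hD c i j⟩ h.pos' h.tendsto_zero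

theorem eventually_integrable_mul_ricciQuadratic (h : RicciApproximation L N G Gk H ε)
    (i j : Fin n) : ∀ᶠ k in atTop, ∀ x ∈ L, Integrable fun w =>
      H (0, x, w) * ricciQuadratic G i j (x + ε k • w) := by
  obtain ⟨r, hr, hrN⟩ := h.exists_radius
  exact (h.kernelTendsto h.kernel).eventually_integrable_mul hr
    (measurable_ricciQuadratic h.measurable_entries i j)
    (h.exists_bound_ricciQuadratic h.isCompact.cthickening hrN i j) h.pos' h.tendsto_zero

theorem bddTendsto_pderiv_christoffel (h : RicciApproximation L N G Gk H ε) (d c i j : Fin n) :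
    BddTendsto L (fun k x => pderiv d (christoffel (Gk k) c i j) x
      + (ε k)⁻¹ * ∫ w, dw d H (0, x, w) * christoffel G c i j (x + ε k • w)) fun _ => 0 := by
  have hT : ∀ p q i a b, BddTendsto L (fun k x => pderiv d (invMulDeriv (Gk k) p q i a b) x
      + (ε k)⁻¹ * ∫ w, dw d H (0, x, w) * invMulDeriv G p q i a b (x + ε k • w)) fun _ => 0 :=
    h.bddTendsto_pderiv_inv_mul d
  have hd := h.kernel.dw d
  refine (BddTendsto.sum Finset.univ fun l _ => (((hT c l i j l).add (hT c l j i l)).sub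
    (hT c l l i j)).const_mul (1 / 2)).congr ?_ (Eventually.of_forall fun x _ => by simp)
  have hint : ∀ᶠ k in atTop, ∀ p q i a b, ∀ x ∈ L, Integrable fun w =>
      dw d H (0, x, w) * invMulDeriv G p q i a b (x + ε k • w) := by
    simp only [eventually_all]
    exact fun p q i a b => h.eventually_integrable_mul_invMulDeriv hd p q i a b
  filter_upwards [h.eventually_det_ne_zero, hint] with k hk hi x hx
  have hsm := h.contDiffAt k x hx
  have hdiff : ∀ p q i a b, DifferentiableAt ℝ (invMulDeriv (Gk k) p q i a b) x :=
    fun p q i a b => ((contDiffAt_inv_apply hsm (hk x hx) p q).differentiableAt (by simp)).mul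
      ((((hsm a b).fderiv_right (m := ∞) (by simp)).differentiableAt (by simp)).clm_apply
        (differentiableAt_const _))
  have e1 : pderiv d (christoffel (Gk k) c i j) x =
      ∑ l, (1 / 2 : ℝ) * (pderiv d (invMulDeriv (Gk k) c l i j l) x
        + pderiv d (invMulDeriv (Gk k) c l j i l) x - pderiv d (invMulDeriv (Gk k) c l l i j) x) := by
    have hs := HasFDerivAt.fun_sum fun l (_ : l ∈ Finset.univ) =>
      (((hdiff c l i j l).hasFDerivAt.add (hdiff c l j i l).hasFDerivAt).sub
        (hdiff c l l i j).hasFDerivAt).const_mul (1 / 2 : ℝ)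
    have e : christoffel (Gk k) c i j = fun y => ∑ l, (1 / 2 : ℝ) *
        (invMulDeriv (Gk k) c l i j l + invMulDeriv (Gk k) c l j i l
          - invMulDeriv (Gk k) c l l i j) y :=
      funext fun y => christoffel_eq_sum (Gk k) c i j y
    rw [e, pderiv, hs.fderiv]
    simp only [sum_apply, smul_apply, smul_eq_mul, sub_apply, add_apply, pderiv]
  have e2 : ∫ w, dw d H (0, x, w) * christoffel G c i j (x + ε k • w) =
      ∑ l, (1 / 2 : ℝ) * ((∫ w, dw d H (0, x, w) * invMulDeriv G c l i j l (x + ε k • w))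
        + (∫ w, dw d H (0, x, w) * invMulDeriv G c l j i l (x + ε k • w))
        - ∫ w, dw d H (0, x, w) * invMulDeriv G c l l i j (x + ε k • w)) := by
    have e3 : ∀ l, (1 / 2 : ℝ) *
        ((∫ w, dw d H (0, x, w) * invMulDeriv G c l i j l (x + ε k • w))
          + (∫ w, dw d H (0, x, w) * invMulDeriv G c l j i l (x + ε k • w))
          - ∫ w, dw d H (0, x, w) * invMulDeriv G c l l i j (x + ε k • w)) =
        ∫ w, (1 / 2 : ℝ) * (dw d H (0, x, w) * invMulDeriv G c l i j l (x + ε k • w)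
          + dw d H (0, x, w) * invMulDeriv G c l j i l (x + ε k • w)
          - dw d H (0, x, w) * invMulDeriv G c l l i j (x + ε k • w)) := fun l => by
      rw [integral_const_mul, ← integral_add (hi _ _ _ _ _ x hx) (hi _ _ _ _ _ x hx),
        ← integral_sub _ (hi _ _ _ _ _ x hx)]
      exact (hi _ _ _ _ _ x hx).add (hi _ _ _ _ _ x hx)
    simp only [e3]
    rw [← integral_finsetSum]
    · refine integral_congr_ae (Eventually.of_forall fun w => ?_)
      simp only [christoffel_eq_sum, Finset.mul_sum]
      exact Finset.sum_congr rfl fun l _ => by ring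
    · exact fun l _ => (((hi _ _ _ _ _ x hx).add (hi _ _ _ _ _ x hx)).sub
        (hi _ _ _ _ _ x hx)).const_mul _
  rw [e1, e2, Finset.mul_sum, ← Finset.sum_add_distrib]
  exact Finset.sum_congr rfl fun l _ => by ring

end RicciApproximation

/-- The components of the distribution `Ric[G]` tested against `y ↦ ε⁻ⁿ H(0, x, (y - x) / ε)`. -/
def ricciAverage (G : Model n → Matrix (Fin n) (Fin n) ℝ) (H : ℝ × Model n × Model n → ℝ) (ε : ℝ)
    (i j : Fin n) (x : Model n) : ℝ :=
  (∑ m, (-(ε⁻¹ * ∫ w, dw m H (0, x, w) * christoffel G m i j (x + ε • w))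
    + ε⁻¹ * ∫ w, dw j H (0, x, w) * christoffel G m i m (x + ε • w)))
  + ∫ w, H (0, x, w) * ricciQuadratic G i j (x + ε • w)

/-- The derivative terms are linear in the derivatives of Christoffel symbols and covered by the
Friedrichs estimate. The quadratic terms contain first derivatives only: those of G_k converge
almost everywhere to those of G, and so do the averages of the latter, at Lebesgue points. -/
theorem RicciApproximation.bddTendsto_ricci (h : RicciApproximation L N G Gk H ε) (i j : Fin n) :
    BddTendsto L (fun k x => ricci (Gk k) i j x - ricciAverage G H (ε k) i j x) fun _ => 0 := by
  obtain ⟨r, hr, hrN⟩ := h.exists_radius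
  have hQ := (h.kernelTendsto h.kernel).integral_mul_of_bdd hr
    (measurable_ricciQuadratic h.measurable_entries i j)
    (h.exists_bound_ricciQuadratic h.isCompact.cthickening hrN i j) h.pos' h.tendsto_zero
  refine ((BddTendsto.sum Finset.univ fun m _ => (h.bddTendsto_pderiv_christoffel m m i j).sub
    (h.bddTendsto_pderiv_christoffel j m i m)).add
    ((h.bddTendsto_ricciQuadratic i j).sub hQ)).congr (Eventually.of_forall fun k x _ => ?_)
    (Eventually.of_forall fun x hx => ?_)
  · rw [ricci, ricciAverage, add_sub_add_comm, ← Finset.sum_sub_distrib]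
    congr 1
    exact Finset.sum_congr rfl fun m _ => by ring
  · rw [h.integral_eq_one x (h.subset hx)]
    simp

theorem RicciApproximation.bddTendsto_metric (h : RicciApproximation L N G Gk H ε) (i j : Fin n) :
    BddTendsto L (fun k x => Gk k x i j - ∫ w, H (0, x, w) * G (x + ε k • w) i j) fun _ => 0 := by
  have h1 := (h.rateTendsto i j).bddTendsto h.pos h.tendsto_zero
  have h2 := h.kernel.comp_zero.bddTendsto_kernelOp h.isCompact (h.continuous i j) h.pos
    h.tendsto_zero
  refine (h1.sub h2).congr (Eventually.of_forall fun k x _ => rfl)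
    (Eventually.of_forall fun x hx => ?_)
  simp [h.integral_eq_one x (h.subset hx)]

/-! ## The test functions -/

/-- The function `y ↦ ε⁻ⁿ H(0, x, (y - x) / ε)`. -/
def testFunction (H : ℝ × Model n × Model n → ℝ) (ε : ℝ) (x y : Model n) : ℝ :=
  (ε ^ n)⁻¹ * H (0, x, ε⁻¹ • (y - x))

theorem contDiff_testFunction (hH : IsKernel H) (ε : ℝ) (x : Model n) :
    ContDiff ℝ ∞ (testFunction H ε x) :=
  contDiff_const.mul ((hH.contDiff_slice 0 x).comp (by fun_prop : ContDiff ℝ ∞ fun y =>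
    ε⁻¹ • (y - x)))

theorem pderiv_testFunction (hH : IsKernel H) (i : Fin n) (ε : ℝ) (x y : Model n) :
    pderiv i (testFunction H ε x) y = (ε ^ n)⁻¹ * (ε⁻¹ * dw i H (0, x, ε⁻¹ • (y - x))) := by
  have h1 : HasFDerivAt (fun y => ε⁻¹ • (y - x)) (ε⁻¹ • .id ℝ (Model n)) y :=
    ((hasFDerivAt_id (𝕜 := ℝ) y).sub_const x).const_smul ε⁻¹
  have h2 := ((hH.contDiff_slice 0 x).differentiable (by simp) (ε⁻¹ • (y - x))).hasFDerivAt.comp y h1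
  have h3 : HasFDerivAt (testFunction H ε x) _ y := h2.const_mul (ε ^ n)⁻¹
  rw [dw_eq_pderiv hH, pderiv, h3.fderiv, pderiv]
  simp

theorem testFunction_eq_zero {R : ℝ} (hR : ∀ p, R ≤ ‖p.2.2‖ → H p = 0) {ε : ℝ} (hε : 0 < ε)
    {x y : Model n} (hy : ε * R ≤ dist y x) : testFunction H ε x y = 0 := by
  rw [testFunction, hR (0, x, ε⁻¹ • (y - x)), mul_zero]
  rw [norm_smul, norm_inv, Real.norm_eq_abs, abs_of_pos hε, le_inv_mul_iff₀ hε, ← dist_eq_norm]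
  exact hy

theorem tsupport_testFunction_subset {R : ℝ} (hR : ∀ p, R ≤ ‖p.2.2‖ → H p = 0) {ε : ℝ}
    (hε : 0 < ε) (x : Model n) :
    tsupport (testFunction H ε x) ⊆ Metric.closedBall x (ε * R) := by
  refine closure_minimal (fun y hy => ?_) Metric.isClosed_closedBall
  by_contra hc
  rw [Metric.mem_closedBall, not_le] at hc
  exact hy (testFunction_eq_zero hR hε hc.le)

theorem christoffel_congr {G₁ : Model n → Matrix (Fin n) (Fin n) ℝ} {y : Model n}
    (h : G₁ =ᶠ[𝓝 y] G) (c i j : Fin n) : christoffel G₁ c i j y = christoffel G c i j y := by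
  have h1 : ∀ i a b, pderiv i (fun z => G₁ z a b) y = pderiv i (fun z => G z a b) y :=
    fun i a b => pderiv_congr (h.mono fun z hz => by simp only [hz]) i
  simp only [christoffel, h1, h.eq_of_nhds]

theorem ricciQuadratic_congr {G₁ : Model n → Matrix (Fin n) (Fin n) ℝ} {y : Model n}
    (h : G₁ =ᶠ[𝓝 y] G) (i j : Fin n) : ricciQuadratic G₁ i j y = ricciQuadratic G i j y := by
  simp only [ricciQuadratic, christoffel_congr h]

theorem setIntegral_eq_integral_comp_add_smul {U : Set (Model n)} {ε : ℝ} (hε : 0 < ε)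
    (x : Model n) {F F' : Model n → ℝ} (hU : MeasurableSet U)
    (h0 : ∀ w, x + ε • w ∉ U → F' w = 0) (h : ∀ w, x + ε • w ∈ U → F (x + ε • w) = (ε ^ n)⁻¹ * F' w) :
    ∫ y in U, F y = ∫ w, F' w := by
  have h1 := integral_comp_add_smul x hε (U.indicator F)
  rw [integral_indicator hU] at h1
  have h2 : (fun w => U.indicator F (x + ε • w)) = fun w => (ε ^ n)⁻¹ * F' w := by
    funext w
    by_cases hw : x + ε • w ∈ U
    · rw [indicator_of_mem hw, h w hw]
    · rw [indicator_of_notMem hw, h0 w hw, mul_zero]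
  rw [h2, integral_const_mul] at h1
  exact (mul_left_cancel₀ (inv_ne_zero (pow_pos hε n).ne') h1).symm

/-- The distribution `Ric(Y, Y)` tested against `testFunction`, for a vector field `Y` that is
constant near the support. -/
theorem ricciDistribution_testFunction {G₁ : Model n → Matrix (Fin n) (Fin n) ℝ} (hH : IsKernel H)
    {R : ℝ} (hR : ∀ p, R ≤ ‖p.2.2‖ → H p = 0) {ε : ℝ} (hε : 0 < ε) {U N : Set (Model n)}
    (hU : IsOpen U) (hN : IsOpen N) (hG : ∀ y ∈ N, G₁ y = G y) {x : Model n} {s : ℝ}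
    (hs : ε * R < s) (hsU : Metric.ball x s ⊆ U) (hsN : Metric.ball x s ⊆ N)
    {Y : Model n → Model n} {v : Model n} (hY : ∀ y ∈ Metric.ball x s, Y y = v)
    (hi1 : ∀ d c i j, Integrable fun w => dw d H (0, x, w) * christoffel G c i j (x + ε • w))
    (hi2 : ∀ i j, Integrable fun w => H (0, x, w) * ricciQuadratic G i j (x + ε • w)) :
    ricciDistribution U G₁ Y (testFunction H ε x) =
      ∑ i, ∑ j, ricciAverage G H ε i j x * v i * v j := by
  have hmem : ∀ w, x + ε • w ∉ Metric.ball x s → ∀ᶠ w' in 𝓝 w, H (0, x, w') = 0 := by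
    intro w hw
    rw [Metric.mem_ball, dist_self_add_left, norm_smul, Real.norm_eq_abs, abs_of_pos hε,
      not_lt] at hw
    have hlt : R < ‖w‖ := lt_of_mul_lt_mul_left (hs.trans_le hw) hε.le
    filter_upwards [(isOpen_lt continuous_const continuous_norm).mem_nhds hlt] with w' hw'
    exact hR (0, x, w') (le_of_lt hw')
  have hH0 : ∀ w, x + ε • w ∉ Metric.ball x s → H (0, x, w) = 0 := fun w hw => (hmem w hw).self_of_nhds
  have hdw0 : ∀ d w, x + ε • w ∉ Metric.ball x s → dw d H (0, x, w) = 0 := fun d w hw => by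
    rw [dw_eq_pderiv hH, pderiv_congr (hmem w hw)]
    simp [pderiv]
  rw [ricciDistribution]
  refine Finset.sum_congr rfl fun i _ => Finset.sum_congr rfl fun j _ => ?_
  -- On the ball the field is constant, so only the test function is differentiated; outside the
  -- ball the test function vanishes near the point.
  have hpd : ∀ m w, pderiv m (fun z => Y z i * Y z j * testFunction H ε x z) (x + ε • w) =
      (ε ^ n)⁻¹ * (ε⁻¹ * (v i * v j * dw m H (0, x, w))) := by
    intro m w
    by_cases hw : x + ε • w ∈ Metric.ball x s
    · have h1 : (fun z => Y z i * Y z j * testFunction H ε x z) =ᶠ[𝓝 (x + ε • w)]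
          fun z => (v i * v j) * testFunction H ε x z := by
        filter_upwards [Metric.isOpen_ball.mem_nhds hw] with z hz
        rw [hY z hz]
      rw [pderiv_congr h1, pderiv_const_mul, pderiv_testFunction hH, add_sub_cancel_left,
        inv_smul_smul₀ hε.ne']
      ring
    · have h1 : (fun z => Y z i * Y z j * testFunction H ε x z) =ᶠ[𝓝 (x + ε • w)] fun _ => 0 := by
        have hw' : ε * R < dist (x + ε • w) x := hs.trans_le (by simpa using hw)
        filter_upwards [(isOpen_lt continuous_const (continuous_id.dist continuous_const)).mem_nhds
          hw'] with z hz
        have hz' : ε * R ≤ dist z x := le_of_lt hz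
        rw [testFunction_eq_zero hR hε hz', mul_zero]
      rw [pderiv_congr h1, hdw0 m w hw]
      simp [pderiv]
  have hc : ∀ w, x + ε • w ∈ Metric.ball x s → ∀ c i j,
      christoffel G₁ c i j (x + ε • w) = christoffel G c i j (x + ε • w) := fun w hw c i j =>
    christoffel_congr (by filter_upwards [hN.mem_nhds (hsN hw)] with y hy using hG y hy) c i j
  have hq : ∀ w, x + ε • w ∈ Metric.ball x s →
      ricciQuadratic G₁ i j (x + ε • w) = ricciQuadratic G i j (x + ε • w) := fun w hw =>
    ricciQuadratic_congr (by filter_upwards [hN.mem_nhds (hsN hw)] with y hy using hG y hy) i j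
  rw [setIntegral_eq_integral_comp_add_smul hε x hU.measurableSet
    (F' := fun w => ((∑ m, (-(ε⁻¹ * (dw m H (0, x, w) * christoffel G m i j (x + ε • w)))
      + ε⁻¹ * (dw j H (0, x, w) * christoffel G m i m (x + ε • w))))
      + H (0, x, w) * ricciQuadratic G i j (x + ε • w)) * v i * v j)]
  · have hterm : ∀ m, Integrable fun w =>
        -(ε⁻¹ * (dw m H (0, x, w) * christoffel G m i j (x + ε • w)))
          + ε⁻¹ * (dw j H (0, x, w) * christoffel G m i m (x + ε • w)) := fun m =>
      ((hi1 m m i j).const_mul _).neg.add ((hi1 j m i m).const_mul _)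
    rw [integral_mul_const, integral_mul_const, integral_add (integrable_finsetSum _ fun m _ =>
      hterm m) (hi2 i j), integral_finsetSum _ fun m _ => hterm m, ricciAverage]
    congr 4
    funext m
    rw [← integral_const_mul, ← integral_const_mul, ← integral_neg]
    exact integral_add ((hi1 m m i j).const_mul _).neg ((hi1 j m i m).const_mul _)
  · intro w hw
    have hw' := mt (fun h => hsU h) hw
    simp [hH0 w hw', hdw0 _ w hw']
  · intro w hw
    simp only [hpd]
    by_cases hb : x + ε • w ∈ Metric.ball x s
    · rw [hY _ hb]
      simp only [hc w hb, hq w hb, testFunction, add_sub_cancel_left, inv_smul_smul₀ hε.ne',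
        add_mul, mul_add, Finset.sum_mul, Finset.mul_sum]
      congr 1
      · exact Finset.sum_congr rfl fun m _ => by ring
      · ring
    · simp [testFunction, hH0 w hb, hdw0 _ w hb, inv_smul_smul₀ hε.ne']

theorem metricEval_testFunction {G₁ : Model n → Matrix (Fin n) (Fin n) ℝ} (hH : IsKernel H)
    {R : ℝ} (hR : ∀ p, R ≤ ‖p.2.2‖ → H p = 0) {ε : ℝ} (hε : 0 < ε) {U N : Set (Model n)}
    (hU : IsOpen U) (hG : ∀ y ∈ N, G₁ y = G y) {x : Model n} {s : ℝ}
    (hs : ε * R < s) (hsU : Metric.ball x s ⊆ U) (hsN : Metric.ball x s ⊆ N)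
    {Y : Model n → Model n} {v : Model n} (hY : ∀ y ∈ Metric.ball x s, Y y = v)
    (hGc : ∀ a b, Continuous fun z => G z a b) :
    ∫ y in U, metricEval G₁ Y y * testFunction H ε x y =
      ∑ i, ∑ j, (∫ w, H (0, x, w) * G (x + ε • w) i j) * v i * v j := by
  have hint : ∀ i j, Integrable fun w => H (0, x, w) * G (x + ε • w) i j := fun i j =>
    hH.integrable_mul 0 x ((hGc i j).comp (by fun_prop : Continuous fun w => x + ε • w))
  have hH0 : ∀ w, x + ε • w ∉ Metric.ball x s → H (0, x, w) = 0 := by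
    intro w hw
    rw [Metric.mem_ball, dist_self_add_left, norm_smul, Real.norm_eq_abs, abs_of_pos hε,
      not_lt] at hw
    exact hR (0, x, w) (lt_of_mul_lt_mul_left (hs.trans_le hw) hε.le).le
  rw [setIntegral_eq_integral_comp_add_smul hε x hU.measurableSet
    (F' := fun w => ∑ i, ∑ j, (H (0, x, w) * G (x + ε • w) i j) * v i * v j)]
  · rw [integral_finsetSum _ fun i _ => integrable_finsetSum _ fun j _ =>
      ((hint i j).mul_const _).mul_const _]
    refine Finset.sum_congr rfl fun i _ => ?_
    rw [integral_finsetSum _ fun j _ => ((hint i j).mul_const _).mul_const _]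
    refine Finset.sum_congr rfl fun j _ => ?_
    rw [integral_mul_const, integral_mul_const]
  · intro w hw
    simp [hH0 w (mt (fun h => hsU h) hw)]
  · intro w _
    by_cases hb : x + ε • w ∈ Metric.ball x s
    · simp only [metricEval, hY _ hb, hG _ (hsN hb), testFunction, add_sub_cancel_left,
        inv_smul_smul₀ hε.ne', Finset.sum_mul, Finset.mul_sum]
      exact Finset.sum_congr rfl fun i _ => Finset.sum_congr rfl fun j _ => by ring
    · simp [testFunction, hH0 w hb, inv_smul_smul₀ hε.ne']

end LipschitzSpacetime

end
noncomputable section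

namespace LipschitzSpacetime

variable {n : ℕ}

/-! ## Smooth extension -/

/-- Multiplication by a cut-off. Kernels have to be smooth on the whole space, whereas transition
maps and coefficients live on open sets; agreement near K also preserves derivatives on K. -/
theorem exists_contDiff_extension {F : Type*} [NormedAddCommGroup F] [NormedSpace ℝ F]
    {W K : Set (Model n)} (hW : IsOpen W) (hK : IsCompact K) (hKW : K ⊆ W) {f : Model n → F}
    (hf : ContDiffOn ℝ ∞ f W) :
    ∃ f' : Model n → F, ContDiff ℝ ∞ f' ∧ HasCompactSupport f' ∧ ∀ᶠ y in 𝓝ˢ K, f' y = f y := by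
  obtain ⟨r, hr, hrW⟩ := hK.exists_cthickening_subset_open hW hKW
  have hint : K ⊆ interior (Metric.cthickening r K) :=
    (Metric.self_subset_thickening hr K).trans
      (interior_maximal (Metric.thickening_subset_cthickening r K) Metric.isOpen_thickening)
  obtain ⟨c, hc1, hc0, -⟩ := exists_contMDiffMap_one_nhds_of_subset_interior (n := (⊤ : ℕ∞))
    (𝓘(ℝ, Model n)) hK.isClosed hint
  have hcs : ContDiff ℝ ∞ c := c.contMDiff.contDiff
  refine ⟨fun y => c y • f y, contDiff_iff_contDiffAt.2 fun y => ?_,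
    HasCompactSupport.intro hK.cthickening fun y hy => by rw [hc0 y hy, zero_smul], ?_⟩
  · by_cases hy : y ∈ W
    · exact hcs.contDiffAt.smul (hf.contDiffAt (hW.mem_nhds hy))
    · have hy' : y ∉ Metric.cthickening r K := fun h => hy (hrW h)
      refine (contDiffAt_const (c := (0 : F))).congr_of_eventuallyEq ?_
      filter_upwards [Metric.isClosed_cthickening.isOpen_compl.mem_nhds hy'] with z hz
      rw [hc0 z hz, zero_smul]
  · filter_upwards [hc1] with y hy
    rw [hy, one_smul]

/-! ## Transition maps and mollification -/

/-- Mutually inverse smooth maps between open sets. -/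
structure IsTransition (W O : Set (Model n)) (φ θ : Model n → Model n) : Prop where
  isOpen_source : IsOpen W
  isOpen_target : IsOpen O
  contDiffOn : ContDiffOn ℝ ∞ φ W
  contDiffOn_symm : ContDiffOn ℝ ∞ θ O
  mapsTo : MapsTo φ W O
  mapsTo_symm : MapsTo θ O W
  left_inv : ∀ y ∈ W, θ (φ y) = y
  right_inv : ∀ z ∈ O, φ (θ z) = z

namespace IsTransition

variable {W O : Set (Model n)} {φ θ : Model n → Model n}

theorem differentiableAt (h : IsTransition W O φ θ) {y : Model n} (hy : y ∈ W) :
    DifferentiableAt ℝ φ y :=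
  (h.contDiffOn.contDiffAt (h.isOpen_source.mem_nhds hy)).differentiableAt (by simp)

theorem differentiableAt_symm (h : IsTransition W O φ θ) {z : Model n} (hz : z ∈ O) :
    DifferentiableAt ℝ θ z :=
  (h.contDiffOn_symm.contDiffAt (h.isOpen_target.mem_nhds hz)).differentiableAt (by simp)

theorem fderiv_symm_comp (h : IsTransition W O φ θ) {y : Model n} (hy : y ∈ W) :
    (fderiv ℝ θ (φ y)).comp (fderiv ℝ φ y) = .id ℝ (Model n) := by
  have h1 := (h.differentiableAt_symm (h.mapsTo hy)).hasFDerivAt.comp y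
    (h.differentiableAt hy).hasFDerivAt
  have h2 : HasFDerivAt (θ ∘ φ) (.id ℝ (Model n)) y :=
    (hasFDerivAt_id y).congr_of_eventuallyEq (by
      filter_upwards [h.isOpen_source.mem_nhds hy] with z hz using h.left_inv z hz)
  exact h1.unique h2

theorem det_ne_zero (h : IsTransition W O φ θ) {y : Model n} (hy : y ∈ W) :
    (fderiv ℝ φ y).det ≠ 0 := by
  have h1 := congrArg ContinuousLinearMap.det (h.fderiv_symm_comp hy)
  have h2 : ((fderiv ℝ θ (φ y)).comp (fderiv ℝ φ y)).det =
      (fderiv ℝ θ (φ y)).det * (fderiv ℝ φ y).det := by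
    simp only [ContinuousLinearMap.det, ContinuousLinearMap.toLinearMap_comp]
    exact LinearMap.det_comp _ _
  rw [h2] at h1
  have h3 : (ContinuousLinearMap.id ℝ (Model n)).det = 1 := by
    exact LinearMap.det_id
  rw [h3] at h1
  exact right_ne_zero_of_mul (h1.trans_ne one_ne_zero)

/-- Mollification in the coordinates `z = φ(y)`, written as a kernel in the coordinates `y`. -/
theorem exists_kernel (h : IsTransition W O φ θ) {K : Set (Model n)} (hK : IsCompact K)
    (hKW : K ⊆ W) {ρ : Model n → ℝ} (hρ : ContDiff ℝ ∞ ρ) (hρ1 : tsupport ρ ⊆ Metric.ball 0 1) :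
    ∃ κ : ℝ × Model n × Model n → ℝ, IsKernel κ ∧
      (∀ x ∈ K, ∀ w, κ (0, x, w) = ρ (-(fderiv ℝ φ x w))) ∧
      ∀ U : Set (Model n), IsOpen U → K ⊆ U → ∃ ε₀ > 0, ∀ x ∈ K, ∀ ε, 0 < ε → ε < ε₀ →
        (∀ w, κ (ε, x, w) ≠ 0 → x + ε • w ∈ U) ∧
        ∀ (O' : Set (Model n)) (f : Model n → ℝ), MeasurableSet O' → O ⊆ O' →
          ∫ z in O', (ε ^ n)⁻¹ * ρ (ε⁻¹ • (φ x - z)) * f z =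
            ∫ w, κ (ε, x, w) * (|(fderiv ℝ φ (x + ε • w)).det| * f (φ (x + ε • w))) := by
  have hρ0 : ∀ v, ρ v ≠ 0 → ‖v‖ < 1 := fun v hv =>
    mem_ball_zero_iff.1 (hρ1 (subset_tsupport ρ hv))
  obtain ⟨φ', hφ', -, hφφ'⟩ := exists_contDiff_extension h.isOpen_source hK hKW h.contDiffOn
  have hφK : IsCompact (φ '' K) := hK.image_of_continuousOn (h.contDiffOn.continuousOn.mono hKW)
  have hφKO : φ '' K ⊆ O := by
    rintro _ ⟨y, hy, rfl⟩
    exact h.mapsTo (hKW hy)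
  obtain ⟨θ', hθ', hθ's, hθθ'⟩ :=
    exists_contDiff_extension h.isOpen_target hφK hφKO h.contDiffOn_symm
  obtain ⟨C, hC⟩ := hθ'.lipschitzWith_of_hasCompactSupport hθ's (by simp)
  obtain ⟨W', hW', hKW', hW'φ⟩ := mem_nhdsSet_iff_exists.1
    (inter_mem hφφ' (h.isOpen_source.mem_nhdsSet.2 hKW))
  obtain ⟨O₁, hO₁, hKO₁, hO₁θ⟩ := mem_nhdsSet_iff_exists.1
    (inter_mem hθθ' (h.isOpen_target.mem_nhdsSet.2 hφKO))
  obtain ⟨δ, hδ, hδO⟩ := hφK.exists_thickening_subset_open hO₁ hKO₁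
  -- With C a Lipschitz constant of the inverse transition map, the preimage of the ε-ball about
  -- φ(x) lies within distance Cε of x. A cut-off equal to one for |w| ≤ C + 1 therefore leaves the
  -- mollifier unchanged for small ε; it ensures bounded support for the other ε.
  let c : ContDiffBump (0 : Model n) := ⟨C + 1, 2 * (C + 1), by positivity, by
    have : (0 : ℝ) ≤ C := C.2
    linarith⟩
  have hcR : c.rOut = 2 * (C + 1) := rfl
  have hC0 : (0 : ℝ) ≤ C := C.2
  -- Hadamard quotient (φ'(x + εw) - φ'(x))/ε in integral form; smooth at ε = 0, where for x in K it
  -- becomes the differential of φ applied to w.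
  let q : ℝ × Model n × Model n → Model n := fun p =>
    ∫ t in Ioc (0 : ℝ) 1, fderiv ℝ φ' (p.2.1 + (t * p.1) • p.2.2) p.2.2
  have hq : ContDiff ℝ ∞ q := by
    refine contDiff_integral_Ioc (f := fun s : (ℝ × Model n × Model n) × ℝ =>
      fderiv ℝ φ' (s.1.2.1 + (s.2 * s.1.1) • s.1.2.2) s.1.2.2) ?_
    have h1 : ContDiff ℝ ∞ (fderiv ℝ φ') := hφ'.fderiv_right (by simp)
    exact (h1.comp (f := fun s : (ℝ × Model n × Model n) × ℝ =>
      s.1.2.1 + (s.2 * s.1.1) • s.1.2.2) (by fun_prop)).clm_apply (by fun_prop)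
  have hqε : ∀ ε : ℝ, ∀ x w, ε • q (ε, x, w) = φ' (x + ε • w) - φ' x := by
    intro ε x w
    have hd : ∀ t : ℝ, HasDerivAt (fun s : ℝ => φ' (x + (s * ε) • w))
        (ε • fderiv ℝ φ' (x + (t * ε) • w) w) t := fun t => by
      have h0 : HasDerivAt (fun s : ℝ => s * ε) ε t := by
        simpa using (hasDerivAt_id t).mul_const ε
      have h1 : HasDerivAt (fun s : ℝ => x + (s * ε) • w) (ε • w) t :=
        (h0.smul_const w).const_add x
      have h2 := (hφ'.differentiable (by simp) (x + (t * ε) • w)).hasFDerivAt.comp_hasDerivAt t h1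
      rwa [map_smul] at h2
    have h3 := intervalIntegral.integral_eq_sub_of_hasDerivAt (a := 0) (b := 1)
      (fun t _ => hd t) (by
        refine Continuous.intervalIntegrable ?_ _ _
        have h1 : Continuous (fderiv ℝ φ') := hφ'.continuous_fderiv (by simp)
        exact ((h1.comp (f := fun t : ℝ => x + (t * ε) • w) (by fun_prop)).clm_apply
          continuous_const).const_smul ε)
    simp only [one_mul, zero_mul, zero_smul, add_zero] at h3
    rw [← h3, intervalIntegral.integral_smul, intervalIntegral.integral_of_le zero_le_one]
  refine ⟨fun p => c p.2.2 * ρ (-q p), ⟨?_, 2 * (C + 1), fun p hp => ?_⟩, ?_, ?_⟩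
  · exact (c.contDiff.comp (contDiff_snd.comp contDiff_snd)).mul (hρ.comp hq.neg)
  · rw [c.zero_of_le_dist (by rwa [dist_zero_right]), zero_mul]
  · intro x hx w
    have hxφ : φ' =ᶠ[𝓝 x] φ := by
      filter_upwards [hW'.mem_nhds (hKW' hx)] with y hy using (hW'φ hy).1
    have h1 : q (0, x, w) = fderiv ℝ φ x w := by
      simp [q, hxφ.fderiv_eq]
    simp only [h1]
    by_cases h0 : ρ (-(fderiv ℝ φ x w)) = 0
    · rw [h0, mul_zero]
    · rw [c.one_of_mem_closedBall, one_mul]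
      have h2 := hρ0 _ h0
      rw [norm_neg] at h2
      have h3 := congrArg (fun l : Model n →L[ℝ] Model n => l w) (h.fderiv_symm_comp (hKW hx))
      simp only [ContinuousLinearMap.comp_apply, ContinuousLinearMap.id_apply] at h3
      have h4 : fderiv ℝ θ (φ x) = fderiv ℝ θ' (φ x) := by
        refine Filter.EventuallyEq.fderiv_eq ?_
        filter_upwards [hO₁.mem_nhds (hKO₁ (mem_image_of_mem φ hx))] with z hz
        exact (hO₁θ hz).1.symm
      have h5 := (fderiv ℝ θ' (φ x)).le_opNorm (fderiv ℝ φ x w)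
      rw [← h4, h3, h4] at h5
      have h6 := norm_fderiv_le_of_lipschitz ℝ hC (x₀ := φ x)
      rw [mem_closedBall_zero_iff]
      have h7 := mul_le_mul h6 h2.le (norm_nonneg _) hC0
      change ‖w‖ ≤ (C : ℝ) + 1
      linarith
  · intro U hU hKU
    obtain ⟨r, hr, hrU⟩ := hK.exists_thickening_subset_open (hU.inter hW')
      (subset_inter hKU hKW')
    -- The bound δ keeps the ε-ball about φ(x) where the extension of θ is genuine; the second bound
    -- keeps x + εw in U and where that of φ is genuine, for every w in the support of the cut-off.
    refine ⟨min δ (r / (2 * (C + 1))), lt_min hδ (by positivity), fun x hx ε hε hεlt => ?_⟩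
    have hεδ : ε < δ := hεlt.trans_le (min_le_left _ _)
    have hεr : ε * (2 * (C + 1)) < r :=
      (lt_div_iff₀ (by positivity)).1 (hεlt.trans_le (min_le_right _ _))
    have hmem : ∀ w, ‖w‖ < 2 * (C + 1) → x + ε • w ∈ U ∩ W' := fun w hw => by
      refine hrU (Metric.mem_thickening_iff.2 ⟨x, hx, ?_⟩)
      rw [dist_self_add_left, norm_smul, Real.norm_eq_abs, abs_of_pos hε]
      exact (mul_lt_mul_of_pos_left hw hε).trans hεr
    have hxW' : x ∈ W' := hKW' hx
    have hqeq : ∀ w, ‖w‖ < 2 * (C + 1) → ε⁻¹ • (φ x - φ (x + ε • w)) = -q (ε, x, w) := by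
      intro w hw
      have h1 := hqε ε x w
      rw [(hW'φ (hmem w hw).2).1, (hW'φ hxW').1] at h1
      rw [← neg_sub, ← h1, smul_neg, inv_smul_smul₀ hε.ne']
    -- Every z at which the mollifier is nonzero is hit by the substitution z = φ(x + εw), and
    -- already by some w where the cut-off equals one.
    have hnear : ∀ z, ‖ε⁻¹ • (φ x - z)‖ < 1 → z ∈ O ∧ θ z ∈ W ∧
        ∃ w, ‖w‖ < C + 1 ∧ θ z = x + ε • w := by
      intro z hz
      rw [norm_smul, norm_inv, Real.norm_eq_abs, abs_of_pos hε, inv_mul_lt_iff₀ hε, mul_one,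
        norm_sub_rev] at hz
      have hzO₁ : z ∈ O₁ := hδO (Metric.mem_thickening_iff.2
        ⟨φ x, mem_image_of_mem φ hx, by rw [dist_eq_norm]; exact hz.trans hεδ⟩)
      have hzO : z ∈ O := (hO₁θ hzO₁).2
      refine ⟨hzO, h.mapsTo_symm hzO, ε⁻¹ • (θ z - x), ?_, ?_⟩
      · rw [norm_smul, norm_inv, Real.norm_eq_abs, abs_of_pos hε, inv_mul_lt_iff₀ hε]
        have h1 := hC.dist_le_mul z (φ x)
        have hxO₁ : φ x ∈ O₁ := hKO₁ (mem_image_of_mem φ hx)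
        rw [(hO₁θ hzO₁).1, (hO₁θ hxO₁).1, h.left_inv x (hKW hx), dist_eq_norm,
          dist_eq_norm] at h1
        have h2 := mul_le_mul_of_nonneg_left hz.le hC0
        linarith
      · rw [smul_inv_smul₀ hε.ne', add_sub_cancel]
    refine ⟨fun w hw => ?_, fun O' f hO' hOO' => ?_⟩
    · by_cases hw' : ‖w‖ < 2 * (C + 1)
      · exact (hmem w hw').1
      · refine absurd ?_ hw
        simp only
        rw [c.zero_of_le_dist (by rw [dist_zero_right]; exact not_lt.1 hw'), zero_mul]
    · let S : Set (Model n) := Metric.ball 0 (2 * (C + 1))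
      let m : Model n → Model n := fun w => φ (x + ε • w)
      have hSW : ∀ w ∈ S, x + ε • w ∈ W := fun w hw =>
        (hW'φ (hmem w (mem_ball_zero_iff.1 hw)).2).2
      have hm' : ∀ w ∈ S, HasFDerivWithinAt m
          ((fderiv ℝ φ (x + ε • w)).comp (ε • .id ℝ (Model n))) S w := fun w hw => by
        have h1 : HasFDerivAt (fun w : Model n => x + ε • w) (ε • .id ℝ (Model n)) w :=
          ((hasFDerivAt_id (𝕜 := ℝ) w).const_smul ε).const_add x
        exact ((h.differentiableAt (hSW w hw)).hasFDerivAt.comp w h1).hasFDerivWithinAt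
      have hminj : InjOn m S := fun w hw w' hw' hww' => by
        have h1 := congrArg θ hww'
        simp only [m] at h1
        rw [h.left_inv _ (hSW w hw), h.left_inv _ (hSW w' hw')] at h1
        exact smul_right_injective _ hε.ne' (add_left_cancel h1)
      have hcv := integral_image_eq_integral_abs_det_fderiv_smul volume
        (measurableSet_ball (x := (0 : Model n)) (ε := 2 * (C + 1))) hm' hminj
        fun z => (ε ^ n)⁻¹ * ρ (ε⁻¹ • (φ x - z)) * f z
      have himg : m '' S ⊆ O' := by
        rintro _ ⟨w, hw, rfl⟩
        exact hOO' (h.mapsTo (hSW w hw))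
      rw [setIntegral_eq_of_subset_of_forall_sdiff_eq_zero hO' himg, hcv,
        ← integral_indicator measurableSet_ball]
      · refine integral_congr_ae (Eventually.of_forall fun w => ?_)
        by_cases hw : w ∈ S
        · have hw2 := mem_ball_zero_iff.1 hw
          simp only [m]
          rw [indicator_of_mem hw, hqeq w hw2]
          have hdet : ((fderiv ℝ φ (x + ε • w)).comp (ε • .id ℝ (Model n))).det =
              (fderiv ℝ φ (x + ε • w)).det * ε ^ n := by
            simp only [ContinuousLinearMap.det, ContinuousLinearMap.toLinearMap_comp,
              ContinuousLinearMap.toLinearMap_smul]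
            rw [LinearMap.det_comp, LinearMap.det_smul, finrank_euclideanSpace_fin]
            exact congrArg _ ((congrArg _ LinearMap.det_id).trans (mul_one _))
          rw [hdet, abs_mul, abs_of_pos (pow_pos hε n), smul_eq_mul]
          have hεn := (pow_pos hε n).ne'
          by_cases h0 : ρ (-q (ε, x, w)) = 0
          · simp [h0]
          · have hc1 : c w = 1 := by
              rw [← hqeq w hw2] at h0
              obtain ⟨_, _, w', hw', e⟩ := hnear _ (hρ0 _ h0)
              rw [h.left_inv _ (hSW w hw)] at e
              have : w = w' := smul_right_injective _ hε.ne' (add_left_cancel e)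
              refine c.one_of_mem_closedBall (mem_closedBall_zero_iff.2 ?_)
              rw [this]
              exact hw'.le
            rw [hc1]
            field_simp
        · have hc0 : c w = 0 := c.zero_of_le_dist (by
            rw [dist_zero_right]
            exact not_lt.1 fun hlt => hw (mem_ball_zero_iff.2 hlt))
          rw [indicator_of_notMem hw]
          simp only [hc0, zero_mul]
      · intro z hz
        by_cases h0 : ρ (ε⁻¹ • (φ x - z)) = 0
        · rw [h0, mul_zero, zero_mul]
        · obtain ⟨hzO, _, w, hw, e⟩ := hnear z (hρ0 _ h0)
          refine absurd ⟨w, mem_ball_zero_iff.2 (by linarith), ?_⟩ hz.2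
          simp only [m]
          rw [← e, h.right_inv z hzO]

end IsTransition

theorem integral_abs_det_mul_comp (A : Model n →L[ℝ] Model n) (hA : A.det ≠ 0)
    (f : Model n → ℝ) : ∫ w, |A.det| * f (-(A w)) = ∫ w, f w := by
  have hinj : Function.Injective A := by
    exact (A.toContinuousLinearEquivOfDetNeZero hA).injective
  have hsurj : Function.Surjective A := LinearMap.injective_iff_surjective.1 hinj
  have h1 := integral_image_eq_integral_abs_det_fderiv_smul volume (MeasurableSet.univ)
    (f := A) (f' := fun _ => A) (fun w _ => A.hasFDerivAt.hasFDerivWithinAt) hinj.injOn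
    fun z => f (-z)
  rw [image_univ, hsurj.range_eq, setIntegral_univ, setIntegral_univ,
    integral_neg_eq_self f volume] at h1
  simpa using h1.symm

end LipschitzSpacetime

end
noncomputable section

namespace LipschitzSpacetime

variable {n : ℕ} {M : Type*} [TopologicalSpace M] [ChartedSpace (Model n) M]

/-! ## Transition maps of charts -/

theorem eq_sum_single (v : Model n) : v = ∑ i, v i • EuclideanSpace.single i (1 : ℝ) := by
  ext j
  simp [Finset.sum_apply, Pi.single_apply]

theorem bilin_apply_eq_sum (B : Model n →L[ℝ] Model n →L[ℝ] ℝ) (v w : Model n) :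
    B v w = ∑ i, ∑ j,
      B (EuclideanSpace.single i 1) (EuclideanSpace.single j 1) * v i * w j := by
  conv_lhs => rw [eq_sum_single v, eq_sum_single w]
  simp only [map_sum, map_smul, sum_apply, smul_apply, smul_eq_mul, Finset.mul_sum]
  rw [Finset.sum_comm]
  exact Finset.sum_congr rfl fun i _ => Finset.sum_congr rfl fun j _ => by ring

theorem pushBilin_eq_sum_gram (ψ : OpenPartialHomeomorph M (Model n)) (T : BilinField n M)
    (y v w : Model n) : pushBilin ψ T y v w = ∑ i, ∑ j, gram ψ T y i j * v i * w j :=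
  bilin_apply_eq_sum _ v w

variable {ψ β : OpenPartialHomeomorph M (Model n)}

theorem mdifferentiableAt_chart (hψ : ψ ∈ smoothCharts n M) {x : M} (hx : x ∈ ψ.source) :
    MDifferentiableAt (𝓡 n) (𝓡 n) ψ x :=
  (contMDiffAt_of_mem_maximalAtlas hψ hx).mdifferentiableAt (by simp)

theorem mdifferentiableAt_chart_symm (hψ : ψ ∈ smoothCharts n M) {y : Model n}
    (hy : y ∈ ψ.target) : MDifferentiableAt (𝓡 n) (𝓡 n) ψ.symm y :=
  (contMDiffAt_symm_of_mem_maximalAtlas hψ hy).mdifferentiableAt (by simp)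

theorem isTransition_charts (hψ : ψ ∈ smoothCharts n M) (hβ : β ∈ smoothCharts n M) :
    IsTransition (ψ.symm ≫ₕ β).source (β.symm ≫ₕ ψ).source (β ∘ ψ.symm) (ψ ∘ β.symm) where
  isOpen_source := (ψ.symm ≫ₕ β).open_source
  isOpen_target := (β.symm ≫ₕ ψ).open_source
  contDiffOn := by
    refine contMDiffOn_iff_contDiffOn.1 ?_
    exact (contMDiffOn_of_mem_maximalAtlas hβ).comp
      ((contMDiffOn_symm_of_mem_maximalAtlas hψ).mono fun y hy => hy.1) fun y hy => hy.2
  contDiffOn_symm := by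
    refine contMDiffOn_iff_contDiffOn.1 ?_
    exact (contMDiffOn_of_mem_maximalAtlas hψ).comp
      ((contMDiffOn_symm_of_mem_maximalAtlas hβ).mono fun y hy => hy.1) fun y hy => hy.2
  mapsTo := fun y hy => ⟨β.map_source hy.2, by
    change β.symm (β (ψ.symm y)) ∈ ψ.source
    rw [β.left_inv (x := ψ.symm y) hy.2]
    exact ψ.map_target hy.1⟩
  mapsTo_symm := fun z hz => ⟨ψ.map_source hz.2, by
    change ψ.symm (ψ (β.symm z)) ∈ β.source
    rw [ψ.left_inv (x := β.symm z) hz.2]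
    exact β.map_target hz.1⟩
  left_inv := fun y hy => by
    change ψ (β.symm (β (ψ.symm y))) = y
    rw [β.left_inv (x := ψ.symm y) hy.2, ψ.right_inv hy.1]
  right_inv := fun z hz => by
    change β (ψ.symm (ψ (β.symm z))) = z
    rw [ψ.left_inv (x := β.symm z) hz.2, β.right_inv hz.1]

theorem mfderiv_chart_comp_symm (hψ : ψ ∈ smoothCharts n M) (hβ : β ∈ smoothCharts n M)
    {y : Model n} (hy : y ∈ (ψ.symm ≫ₕ β).source) (v : Model n) :
    (mfderiv (𝓡 n) (𝓡 n) β (ψ.symm y) (mfderiv (𝓡 n) (𝓡 n) ψ.symm y v) : Model n) =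
      fderiv ℝ (β ∘ ψ.symm) y v := by
  have h1 := mfderiv_comp y (mdifferentiableAt_chart hβ hy.2) (mdifferentiableAt_chart_symm hψ hy.1)
  rw [mfderiv_eq_fderiv] at h1
  exact (congrArg (fun l : Model n →L[ℝ] Model n => l v) h1).symm

theorem mfderiv_chart_symm_eq (hψ : ψ ∈ smoothCharts n M) (hβ : β ∈ smoothCharts n M)
    {z : Model n} (hz : z ∈ (β.symm ≫ₕ ψ).source) (v : Model n) :
    (mfderiv (𝓡 n) (𝓡 n) β.symm z v : Model n) =
      mfderiv (𝓡 n) (𝓡 n) ψ.symm (ψ (β.symm z)) (fderiv ℝ (ψ ∘ β.symm) z v : Model n) := by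
  have h0 : (β.symm : Model n → M) =ᶠ[𝓝 z] ψ.symm ∘ (ψ ∘ β.symm) := by
    filter_upwards [(β.symm ≫ₕ ψ).open_source.mem_nhds hz] with y hy
    exact (ψ.left_inv hy.2).symm
  have hd : MDifferentiableAt (𝓡 n) (𝓡 n) (ψ ∘ β.symm) z :=
    ((isTransition_charts hψ hβ).differentiableAt_symm hz).mdifferentiableAt
  have h1 := mfderiv_comp z (g := ψ.symm) (f := ψ ∘ β.symm)
    (mdifferentiableAt_chart_symm hψ (ψ.map_source hz.2)) hd
  rw [← h0.mfderiv_eq, mfderiv_eq_fderiv] at h1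
  exact congrArg (fun l : Model n →L[ℝ] Model n => l v) h1

theorem pushBilin_eq_of_transition (hψ : ψ ∈ smoothCharts n M) (hβ : β ∈ smoothCharts n M)
    (T : BilinField n M) {y : Model n} (hy : y ∈ (ψ.symm ≫ₕ β).source) (v w : Model n) :
    pushBilin β T (β (ψ.symm y)) v w =
      pushBilin ψ T y (fderiv ℝ (ψ ∘ β.symm) (β (ψ.symm y)) v)
        (fderiv ℝ (ψ ∘ β.symm) (β (ψ.symm y)) w) := by
  have hz := (isTransition_charts hψ hβ).mapsTo hy
  have e1 : β.symm (β (ψ.symm y)) = ψ.symm y := β.left_inv hy.2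
  have e2 : ψ (β.symm (β (ψ.symm y))) = y := by rw [e1, ψ.right_inv hy.1]
  have h1 := mfderiv_chart_symm_eq hψ hβ hz
  simp only [Function.comp_apply] at h1
  rw [e2] at h1
  let T' : M → Model n →L[ℝ] Model n →L[ℝ] ℝ := T
  change T' (β.symm (β (ψ.symm y))) _ _ = T' (ψ.symm y) _ _
  rw [e1]
  exact congrArg₂ (fun a b : Model n => T' (ψ.symm y) a b) (h1 v) (h1 w)

end LipschitzSpacetime

end
noncomputable section

namespace LipschitzSpacetime

variable {n : ℕ} {M : Type*} [TopologicalSpace M] [ChartedSpace (Model n) M]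

/-! ## The regularisation as a kernel operator -/

theorem contDiffAt_clm_det {A : Model n → Model n →L[ℝ] Model n} {y : Model n}
    (hA : ContDiffAt ℝ ∞ A y) : ContDiffAt ℝ ∞ (fun z => (A z).det) y := by
  have h1 : ∀ z, (A z).det = ((Matrix.of fun i j => A z (EuclideanSpace.single j 1) i) :
      Matrix (Fin n) (Fin n) ℝ).det := fun z => by
    rw [ContinuousLinearMap.det,
      ← LinearMap.det_toMatrix (EuclideanSpace.basisFun (Fin n) ℝ).toBasis]
    congr 1
  simp only [h1]
  refine contDiffAt_det (G := fun z => Matrix.of fun i j => A z (EuclideanSpace.single j 1) i)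
    fun i j => ?_
  exact (EuclideanSpace.proj (𝕜 := ℝ) i).contDiff.contDiffAt.comp y
    (hA.clm_apply contDiffAt_const)

theorem contDiffAt_clm_apply_coord {A : Model n → Model n →L[ℝ] Model n} {y : Model n}
    (hA : ContDiffAt ℝ ∞ A y) (v : Model n) (i : Fin n) : ContDiffAt ℝ ∞ (fun z => A z v i) y :=
  (EuclideanSpace.proj (𝕜 := ℝ) i).contDiff.contDiffAt.comp y (hA.clm_apply contDiffAt_const)

theorem contDiffAt_comp_chart_symm {ψ : OpenPartialHomeomorph M (Model n)}
    (hψ : ψ ∈ smoothCharts n M) {f : M → ℝ} (hf : ContMDiff (𝓡 n) 𝓘(ℝ, ℝ) ∞ f) {y : Model n}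
    (hy : y ∈ ψ.target) : ContDiffAt ℝ ∞ (fun z => f (ψ.symm z)) y :=
  contMDiffAt_iff_contDiffAt.1
    (hf.contMDiffAt.comp y (contMDiffAt_symm_of_mem_maximalAtlas hψ hy))

theorem sum_coord_mul_apply (A : Model n →L[ℝ] Model n) (v : Model n) (i : Fin n) :
    ∑ c, v c * A (EuclideanSpace.single c 1) i = A v i := by
  conv_rhs => rw [eq_sum_single v]
  simp [Finset.sum_apply]

theorem integrableOn_smul_of_continuousOn {F : Type*} [NormedAddCommGroup F] [NormedSpace ℝ F]
    {c : Model n → ℝ} {f : Model n → F} {K s : Set (Model n)} (hs : MeasurableSet s)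
    (hc : ContinuousOn c s) (hf : ContinuousOn f s) (hK : IsCompact K) (hKs : K ⊆ s)
    (h0 : ∀ y ∈ s \ K, c y = 0) : IntegrableOn (fun y => c y • f y) s :=
  (((hc.smul hf).mono hKs).integrableOn_compact hK).of_forall_sdiff_eq_zero hs fun y hy => by
    simp [h0 y hy]

namespace RegularisationData

variable (d : RegularisationData n M)

theorem isCompact_tsupport_partition [T2Space M] (α : ℕ) : IsCompact (tsupport (d.ξ α)) :=
  (d.relatively_compact α).of_isClosed_subset (isClosed_tsupport _)
    ((d.ξ_subordinate α).trans subset_closure)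

/-- Evaluation commutes with the operator-valued integral because the integrand is continuous and
vanishes off the compact image of the support of ξ. -/
theorem chartConvolution_apply [T2Space M] {T : BilinField n M} {α : ℕ}
    (hT : ContinuousOn (pushBilin (d.ψ α) T) (d.ψ α).target) (ε : ℝ) (z v w : Model n) :
    d.chartConvolution T ε α z v w =
      ∫ y in (d.ψ α).target, (ε ^ n)⁻¹ * d.ρ (ε⁻¹ • (z - y)) *
        (d.ξ α ((d.ψ α).symm y) * pushBilin (d.ψ α) T y v w) := by
  have hcont : ContinuousOn (fun y => d.mollifier ε (z - y) * d.ξ α ((d.ψ α).symm y))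
      (d.ψ α).target := by
    refine ContinuousOn.mul ?_ ?_
    · have := d.ρ_smooth.continuous
      unfold mollifier
      fun_prop
    · exact (d.ξ α).contMDiff.continuous.comp_continuousOn (d.ψ α).symm.continuousOn
  have hK : IsCompact (d.ψ α '' tsupport (d.ξ α)) :=
    (d.isCompact_tsupport_partition α).image_of_continuousOn
      ((d.ψ α).continuousOn.mono (d.ξ_subordinate α))
  have hKt : d.ψ α '' tsupport (d.ξ α) ⊆ (d.ψ α).target := by
    rintro _ ⟨x, hx, rfl⟩
    exact (d.ψ α).map_source (d.ξ_subordinate α hx)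
  have hint := integrableOn_smul_of_continuousOn (F := Model n →L[ℝ] Model n →L[ℝ] ℝ)
    (d.ψ α).open_target.measurableSet hcont hT hK hKt fun y hy => by
      have h0 : d.ξ α ((d.ψ α).symm y) = 0 := image_eq_zero_of_notMem_tsupport fun h =>
        hy.2 ⟨_, h, (d.ψ α).right_inv hy.1⟩
      rw [h0, mul_zero]
  rw [chartConvolution, ContinuousLinearMap.integral_apply hint,
    ContinuousLinearMap.integral_apply (hint.apply_continuousLinearMap v)]
  refine integral_congr_ae (Eventually.of_forall fun y => ?_)
  simp only [smul_apply, smul_eq_mul, mollifier]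
  ring

/-- The contribution of one chart of the cover, read in another chart ψ: the convolution becomes a
kernel by the substitution z = φ(x + εw), and the components of T are transformed at x + εw into one
chart and back at x. At ε = 0 both transformations take place at the same point and cancel, which
leaves Kronecker deltas. -/
theorem exists_chart_kernel [T2Space M] (α : ℕ) {ψ : OpenPartialHomeomorph M (Model n)}
    (hψ : ψ ∈ smoothCharts n M) {L V : Set (Model n)} (hL : IsCompact L) (hV : IsOpen V)
    (hLV : L ⊆ V) (hVψ : V ⊆ ψ.target) :
    ∃ Φ : Fin n → Fin n → Fin n → Fin n → ℝ × Model n × Model n → ℝ,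
      (∀ a b c e, IsKernel (Φ a b c e)) ∧
      (∀ x ∈ L, ∀ w a b c e, Φ a b c e (0, x, w) = (if a = c then 1 else 0) *
        (if b = e then 1 else 0) * (d.χ α (ψ.symm x) * d.ξ α (ψ.symm x) *
          (|(fderiv ℝ (d.ψ α ∘ ψ.symm) x).det| * d.ρ (-(fderiv ℝ (d.ψ α ∘ ψ.symm) x w))))) ∧
      ∃ ε₀ > 0, ∀ x ∈ L, ∀ ε, 0 < ε → ε < ε₀ → ∀ (T : BilinField n M)
        (G : Model n → Matrix (Fin n) (Fin n) ℝ),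
        ContinuousOn (pushBilin (d.ψ α) T) (d.ψ α).target →
        (∀ a b, Continuous fun z => G z a b) → (∀ z ∈ V, G z = gram ψ T z) → ∀ a b,
        d.χ α (ψ.symm x) * d.chartConvolution T ε α (d.ψ α (ψ.symm x))
          (mfderiv (𝓡 n) (𝓡 n) (d.ψ α) (ψ.symm x)
            (mfderiv (𝓡 n) (𝓡 n) ψ.symm x (EuclideanSpace.single a 1 : Model n)))
          (mfderiv (𝓡 n) (𝓡 n) (d.ψ α) (ψ.symm x)
            (mfderiv (𝓡 n) (𝓡 n) ψ.symm x (EuclideanSpace.single b 1 : Model n))) =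
          ∑ c, ∑ e, kernelOp (Φ a b c e) ε (fun z => G z c e) x := by
  have hφθ := isTransition_charts hψ (d.ψ_mem α)
  set W := (ψ.symm ≫ₕ d.ψ α).source with hW
  set φ : Model n → Model n := d.ψ α ∘ ψ.symm with hφ
  set θ : Model n → Model n := ψ ∘ (d.ψ α).symm with hθ
  have hLψ := hLV.trans hVψ
  have hcφ : ∀ y ∈ W, ContDiffAt ℝ ∞ φ y := fun y hy =>
    hφθ.contDiffOn.contDiffAt (hφθ.isOpen_source.mem_nhds hy)
  have hcDφ : ∀ y ∈ W, ContDiffAt ℝ ∞ (fderiv ℝ φ) y := fun y hy =>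
    (hcφ y hy).fderiv_right (by simp)
  have hcDθ : ∀ y ∈ W, ContDiffAt ℝ ∞ (fun z => fderiv ℝ θ (φ z)) y := fun y hy =>
    ContDiffAt.comp y (((hφθ.contDiffOn_symm.contDiffAt
      (hφθ.isOpen_target.mem_nhds (hφθ.mapsTo hy)))).fderiv_right (by simp)) (hcφ y hy)
  let e1 : Fin n → Model n := fun a => EuclideanSpace.single a 1
  -- Factors evaluated at x: the cut-off and the pull-back of the form to ψ. The cut-off makes them
  -- smooth on the whole image of ψ, by zero outside the other chart.
  let P : Fin n → Fin n → Fin n → Fin n → Model n → ℝ := fun a b c e y =>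
    d.χ α (ψ.symm y) * (fderiv ℝ φ y (e1 a) c * fderiv ℝ φ y (e1 b) e)
  have hP : ∀ a b c e, ContDiffOn ℝ ∞ (P a b c e) ψ.target := by
    intro a b c e y hy
    refine ContDiffAt.contDiffWithinAt ?_
    by_cases hyα : ψ.symm y ∈ (d.ψ α).source
    · have hyW : y ∈ W := ⟨hy, hyα⟩
      exact (contDiffAt_comp_chart_symm hψ (d.χ_smooth α) hy).mul
        ((contDiffAt_clm_apply_coord (hcDφ y hyW) _ _).mul
          (contDiffAt_clm_apply_coord (hcDφ y hyW) _ _))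
    · have hy0 : ψ.symm y ∉ tsupport (d.χ α) := fun h => hyα (d.χ_support α h)
      refine (contDiffAt_const (c := (0 : ℝ))).congr_of_eventuallyEq ?_
      filter_upwards [(ψ.symm.continuousAt hy).preimage_mem_nhds
        ((isClosed_tsupport _).isOpen_compl.mem_nhds hy0)] with z hz
      simp only [P]
      rw [image_eq_zero_of_notMem_tsupport hz, zero_mul]
  have hPex := fun a b c e => exists_contDiff_extension ψ.open_target hL hLψ (hP a b c e)
  choose P' hP' _ hPP' using hPex
  -- Factors evaluated at x + εw: the Jacobian, the partition function and the change of components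
  -- from ψ to the other chart.
  let s : Fin n → Fin n → Fin n → Fin n → Model n → ℝ := fun c e c' e' y =>
    |(fderiv ℝ φ y).det| * d.ξ α (ψ.symm y) *
      (fderiv ℝ θ (φ y) (e1 c) c' * fderiv ℝ θ (φ y) (e1 e) e')
  have hs : ∀ c e c' e', ContDiffOn ℝ ∞ (s c e c' e') W := by
    intro c e c' e' y hy
    refine ContDiffAt.contDiffWithinAt ?_
    refine ContDiffAt.mul (ContDiffAt.mul ?_ ?_) ?_
    · exact (contDiffAt_abs (hφθ.det_ne_zero hy)).comp y (contDiffAt_clm_det (hcDφ y hy))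
    · exact contDiffAt_comp_chart_symm hψ (d.ξ α).contMDiff hy.1
    · exact (contDiffAt_clm_apply_coord (hcDθ y hy) _ _).mul
        (contDiffAt_clm_apply_coord (hcDθ y hy) _ _)
  -- On K the point lies in the domain of the other chart; at points of L outside K the cut-off
  -- vanishes and both sides are zero.
  set K := L ∩ ψ.symm ⁻¹' tsupport (d.χ α) with hKdef
  have hK : IsCompact K := hL.of_isClosed_subset
    ((ψ.symm.continuousOn.mono hLψ).preimage_isClosed_of_isClosed hL.isClosed
      (isClosed_tsupport _)) inter_subset_left
  have hKW : K ⊆ W := fun y hy => ⟨hLψ hy.1, d.χ_support α hy.2⟩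
  have hsex := fun c e c' e' => exists_contDiff_extension hφθ.isOpen_source hK hKW (hs c e c' e')
  choose s' hs' _ hss' using hsex
  obtain ⟨κ, hκ, hκ0, hκU⟩ := hφθ.exists_kernel hK hKW d.ρ_smooth d.ρ_support
  have hall : ∀ᶠ y in 𝓝ˢ K, ∀ c e c' e', s' c e c' e' y = s c e c' e' y := by
    simp only [eventually_all]
    exact hss'
  obtain ⟨U, hU, hKU, hUs⟩ := mem_nhdsSet_iff_exists.1 (inter_mem hall
    ((hφθ.isOpen_source.inter hV).mem_nhdsSet.2 (subset_inter hKW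
      (inter_subset_left.trans hLV))))
  obtain ⟨ε₀, hε₀, hκε⟩ := hκU U hU hKU
  have hPx : ∀ a b c e, ∀ x ∈ L, P' a b c e x = P a b c e x := fun a b c e x hx =>
    (hPP' a b c e).self_of_nhdsSet x hx
  have hχ0 : ∀ x ∈ L, x ∉ K → d.χ α (ψ.symm x) = 0 := fun x hx hxK =>
    image_eq_zero_of_notMem_tsupport fun h => hxK ⟨hx, h⟩
  have hκs : ∀ c e c' e', IsKernel fun p : ℝ × Model n × Model n =>
      κ p * s' c e c' e' (p.2.1 + p.1 • p.2.2) := fun c e c' e' => by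
    refine ⟨hκ.contDiff.mul ((hs' c e c' e').comp (by fun_prop)), ?_⟩
    obtain ⟨R, hR⟩ := hκ.support
    exact ⟨R, fun p hp => by rw [hR p hp, zero_mul]⟩
  have hterm : ∀ a b c e c' e', IsKernel fun p : ℝ × Model n × Model n =>
      P' a b c e p.2.1 * (κ p * s' c e c' e' (p.2.1 + p.1 • p.2.2)) := fun a b c e c' e' => by
    refine ⟨((hP' a b c e).comp (by fun_prop)).mul (hκs c e c' e').contDiff, ?_⟩
    obtain ⟨R, hR⟩ := (hκs c e c' e').support
    exact ⟨R, fun p hp => by rw [hR p hp, mul_zero]⟩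
  refine ⟨fun a b c' e' p => ∑ c, ∑ e,
    P' a b c e p.2.1 * (κ p * s' c e c' e' (p.2.1 + p.1 • p.2.2)), fun a b c' e' =>
      IsKernel.sum fun c _ => IsKernel.sum fun e _ => hterm a b c e c' e', ?_, ε₀, hε₀, ?_⟩
  · intro x hx w a b c' e'
    simp only [zero_smul, add_zero]
    by_cases hxK : x ∈ K
    · have hinv := hφθ.fderiv_symm_comp (hKW hxK)
      have hδ : ∀ a c', ∑ c, fderiv ℝ φ x (e1 a) c * fderiv ℝ θ (φ x) (e1 c) c' =
          if a = c' then 1 else 0 := fun a c' => by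
        rw [sum_coord_mul_apply, ← ContinuousLinearMap.comp_apply, hinv]
        simp [e1, eq_comm]
      rw [← hδ a c', ← hδ b e', Finset.sum_mul_sum, Finset.sum_mul]
      refine Finset.sum_congr rfl fun c _ => ?_
      rw [Finset.sum_mul]
      refine Finset.sum_congr rfl fun e _ => ?_
      rw [hPx _ _ _ _ x hx, (hUs (hKU hxK)).1, hκ0 x hxK]
      simp only [P, s]
      ring
    · rw [hχ0 x hx hxK]
      simp [hPx _ _ _ _ x hx, P, hχ0 x hx hxK]
  · intro x hx ε hε hεlt T G hT hG hGV a b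
    have hRHS : ∀ c' e', kernelOp (fun p => ∑ c, ∑ e,
        P' a b c e p.2.1 * (κ p * s' c e c' e' (p.2.1 + p.1 • p.2.2))) ε (fun z => G z c' e') x =
        ∑ c, ∑ e, P a b c e x * ∫ w, κ (ε, x, w) * s' c e c' e' (x + ε • w) *
          G (x + ε • w) c' e' := fun c' e' => by
      have hi : ∀ c e, Integrable fun w => κ (ε, x, w) * s' c e c' e' (x + ε • w) *
          G (x + ε • w) c' e' := fun c e =>
        (hκs c e c' e').integrable_mul ε x ((hG c' e').comp (by fun_prop))
      have hi' : ∀ c e, Integrable fun w => P' a b c e x *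
          (κ (ε, x, w) * s' c e c' e' (x + ε • w)) * G (x + ε • w) c' e' := fun c e => by
        simpa only [mul_assoc] using (hi c e).const_mul (P' a b c e x)
      simp only [kernelOp, Finset.sum_mul]
      rw [integral_finsetSum _ fun c _ => integrable_finsetSum _ fun e _ => hi' c e]
      refine Finset.sum_congr rfl fun c _ => ?_
      rw [integral_finsetSum _ fun e _ => hi' c e]
      refine Finset.sum_congr rfl fun e _ => ?_
      rw [← integral_const_mul, ← hPx _ _ _ _ x hx]
      exact integral_congr_ae (Eventually.of_forall fun w => by ring)
    rw [Finset.sum_congr rfl fun c' _ => Finset.sum_congr rfl fun e' _ => hRHS c' e']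
    by_cases hxK : x ∈ K
    · obtain ⟨hκne, hκint⟩ := hκε x hxK ε hε hεlt
      have hconv : ∀ c e, d.chartConvolution T ε α (φ x) (e1 c) (e1 e) =
          ∑ c', ∑ e', ∫ w, κ (ε, x, w) * s' c e c' e' (x + ε • w) * G (x + ε • w) c' e' := by
        intro c e
        have hi : ∀ c' e', Integrable fun w => κ (ε, x, w) * s' c e c' e' (x + ε • w) *
            G (x + ε • w) c' e' := fun c' e' =>
          (hκs c e c' e').integrable_mul ε x ((hG c' e').comp (by fun_prop))
        rw [d.chartConvolution_apply hT, hκint _ (fun z => d.ξ α ((d.ψ α).symm z) *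
          pushBilin (d.ψ α) T z (e1 c) (e1 e)) (d.ψ α).open_target.measurableSet
          fun z hz => hz.1]
        rw [← Finset.sum_congr rfl fun c' _ => integral_finsetSum _ fun e' _ => hi c' e',
          ← integral_finsetSum _ fun c' _ => integrable_finsetSum _ fun e' _ => hi c' e']
        refine integral_congr_ae (Eventually.of_forall fun w => ?_)
        simp only
        by_cases h0 : κ (ε, x, w) = 0
        · simp [h0]
        · have hyU := hUs (hκne w h0)
          set y := x + ε • w
          have hyW : y ∈ W := hyU.2.1
          have h1 : (d.ψ α).symm (φ y) = ψ.symm y := (d.ψ α).left_inv hyW.2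
          rw [h1, hφ, Function.comp_apply, pushBilin_eq_of_transition hψ (d.ψ_mem α) T hyW,
            pushBilin_eq_sum_gram, ← hGV y hyU.2.2]
          simp only [Finset.mul_sum]
          refine Finset.sum_congr rfl fun c' _ => Finset.sum_congr rfl fun e' _ => ?_
          rw [hyU.1]
          simp only [s, hφ, hθ, Function.comp_apply]
          ring
      have hxW := hKW hxK
      change d.χ α (ψ.symm x) * d.chartConvolution T ε α (φ x) _ _ = _
      rw [mfderiv_chart_comp_symm hψ (d.ψ_mem α) hxW, mfderiv_chart_comp_symm hψ (d.ψ_mem α) hxW,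
        bilin_apply_eq_sum, Finset.mul_sum]
      have hswap : ∀ F : Fin n → Fin n → Fin n → Fin n → ℝ,
          ∑ c', ∑ e', ∑ c, ∑ e, F c' e' c e = ∑ c, ∑ e, ∑ c', ∑ e', F c' e' c e := fun F => by
        rw [Finset.sum_congr rfl fun c' _ => Finset.sum_comm, Finset.sum_comm]
        refine Finset.sum_congr rfl fun c _ => ?_
        rw [Finset.sum_congr rfl fun c' _ => Finset.sum_comm, Finset.sum_comm]
      rw [hswap]
      refine Finset.sum_congr rfl fun c _ => ?_
      rw [Finset.mul_sum]
      refine Finset.sum_congr rfl fun e _ => ?_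
      simp only [← Finset.mul_sum]
      rw [← hconv]
      simp only [P, e1, hφ]
      ring
    · simp [P, hχ0 x hx hxK]

end RegularisationData

end LipschitzSpacetime

end
-- Summation over the charts of the cover.
noncomputable section

namespace LipschitzSpacetime

variable {n : ℕ} {M : Type*} [TopologicalSpace M] [ChartedSpace (Model n) M]

theorem LocLipschitzBilin.continuousOn {T : BilinField n M} (hT : LocLipschitzBilin T)
    {ψ : OpenPartialHomeomorph M (Model n)} (hψ : ψ ∈ smoothCharts n M) :
    ContinuousOn (pushBilin ψ T) ψ.target := (hT ψ hψ).continuousOn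

namespace RegularisationData

variable (d : RegularisationData n M)

theorem regularise_apply {T : BilinField n M} {ε : ℝ} {x : M} {S : Finset ℕ}
    (hS : ∀ α, x ∈ (d.ψ α).source → α ∈ S) (v w : TangentSpace (𝓡 n) x) :
    d.regularise T ε x v w = ∑ α ∈ S, d.χ α x * d.chartConvolution T ε α (d.ψ α x)
      (mfderiv (𝓡 n) (𝓡 n) (d.ψ α) x v) (mfderiv (𝓡 n) (𝓡 n) (d.ψ α) x w) := by
  rw [regularise, finsum_eq_sum_of_support_subset (s := S)]
  · have h1 : ∀ (F : ℕ → Model n →L[ℝ] Model n →L[ℝ] ℝ) (v w : Model n),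
        (∑ α ∈ S, F α) v w = ∑ α ∈ S, F α v w := fun F v w => by
      simp only [sum_apply]
    exact h1 _ v w
  · intro α hα
    refine hS α (d.χ_support α (subset_tsupport _ fun h0 => hα ?_))
    simp only [h0]
    exact ContinuousLinearMap.ext fun v => ContinuousLinearMap.ext fun w => zero_mul _

/-- Only finitely many charts of the cover meet the compact set. At ε = 0 the term of index α has
mass ξ_α, since χ_α = 1 on the support of ξ_α and ρ has integral one, and the ξ_α sum to one.
Nonnegativity follows likewise: χ_α enters only where it equals one. -/
theorem exists_kernel [T2Space M] (i₀ : Fin n) {ψ : OpenPartialHomeomorph M (Model n)}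
    (hψ : ψ ∈ smoothCharts n M) {L V : Set (Model n)} (hL : IsCompact L) (hV : IsOpen V)
    (hLV : L ⊆ V) (hVψ : V ⊆ ψ.target) :
    ∃ (Φ : Fin n → Fin n → Fin n → Fin n → ℝ × Model n × Model n → ℝ)
      (H : ℝ × Model n × Model n → ℝ),
      (∀ a b c e, KernelAtZero L (Φ a b c e) H
        ((if a = c then 1 else 0) * (if b = e then 1 else 0))) ∧
      (∀ x ∈ L, ∀ w, 0 ≤ H (0, x, w)) ∧
      ∃ ε₀ > 0, ∀ x ∈ L, ∀ ε, 0 < ε → ε < ε₀ → ∀ (T : BilinField n M)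
        (G : Model n → Matrix (Fin n) (Fin n) ℝ), LocLipschitzBilin T →
        (∀ a b, Continuous fun z => G z a b) → (∀ z ∈ V, G z = gram ψ T z) → ∀ a b,
        gram ψ (d.regularise T ε) x a b =
          ∑ c, ∑ e, kernelOp (Φ a b c e) ε (fun z => G z c e) x := by
  have hLψ := hLV.trans hVψ
  have hfin := d.locally_finite.finite_nonempty_inter_compact
    (hL.image_of_continuousOn (ψ.symm.continuousOn.mono hLψ))
  set S := hfin.toFinset with hSdef
  have hS : ∀ x ∈ L, ∀ α, ψ.symm x ∈ (d.ψ α).source → α ∈ S := fun x hx α hα =>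
    hfin.mem_toFinset.2 ⟨_, hα, mem_image_of_mem _ hx⟩
  choose Φ hΦ hΦ0 ε₀ hε₀ hΦε using fun α => d.exists_chart_kernel α hψ hL hV hLV hVψ
  let η : ℕ → Model n → Model n → ℝ := fun α x w => d.χ α (ψ.symm x) * d.ξ α (ψ.symm x) *
    (|(fderiv ℝ (d.ψ α ∘ ψ.symm) x).det| * d.ρ (-(fderiv ℝ (d.ψ α ∘ ψ.symm) x w)))
  have hH0 : ∀ x ∈ L, ∀ w, ∑ α ∈ S, Φ α i₀ i₀ i₀ i₀ (0, x, w) = ∑ α ∈ S, η α x w :=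
    fun x hx w => Finset.sum_congr rfl fun α _ => by rw [hΦ0 α x hx]; simp [η]
  have hη1 : ∀ x ∈ L, ∀ α, ∫ w, η α x w = d.ξ α (ψ.symm x) := by
    intro x hx α
    by_cases h0 : d.ξ α (ψ.symm x) = 0
    · simp [η, h0]
    · have hp : ψ.symm x ∈ tsupport (d.ξ α) := subset_tsupport _ h0
      have hxW : x ∈ (ψ.symm ≫ₕ d.ψ α).source := ⟨hLψ hx, d.ξ_subordinate α hp⟩
      simp only [η]
      rw [integral_const_mul, integral_abs_det_mul_comp _
        ((isTransition_charts hψ (d.ψ_mem α)).det_ne_zero hxW), d.ρ_integral,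
        (d.χ_eq_one α).self_of_nhdsSet _ hp, one_mul, mul_one]
  -- At ε = 0 all diagonal kernels coincide on L, so any of them can serve as H; the index `i₀`
  -- selects one.
  refine ⟨fun a b c e p => ∑ α ∈ S, Φ α a b c e p, fun p => ∑ α ∈ S, Φ α i₀ i₀ i₀ i₀ p,
    fun a b c e => ⟨IsKernel.sum fun α _ => hΦ α a b c e, IsKernel.sum fun α _ => hΦ α _ _ _ _,
      fun x hx w => ?_, fun x hx => ?_⟩, fun x hx w => ?_, ?_⟩
  · rw [hH0 x hx, Finset.mul_sum]
    exact Finset.sum_congr rfl fun α _ => hΦ0 α x hx w a b c e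
  · rw [integral_finsetSum S fun α _ => ?_]
    · have h1 : ∀ α, ∫ w, Φ α i₀ i₀ i₀ i₀ (0, x, w) = d.ξ α (ψ.symm x) := fun α => by
        rw [← hη1 x hx α]
        refine integral_congr_ae (Eventually.of_forall fun w => ?_)
        simp only
        rw [hΦ0 α x hx]
        simp [η]
      rw [Finset.sum_congr rfl fun α _ => h1 α]
      have h2 := d.ξ.sum_eq_one (mem_univ (ψ.symm x))
      rwa [finsum_eq_sum_of_support_subset (s := S)] at h2
      exact fun α hα => hS x hx α (d.ξ_subordinate α (subset_tsupport _ hα))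
    · simpa using (hΦ α i₀ i₀ i₀ i₀).integrable_mul 0 x (u := fun _ => 1) continuous_const
  · change 0 ≤ ∑ α ∈ S, Φ α i₀ i₀ i₀ i₀ (0, x, w)
    rw [hH0 x hx]
    refine Finset.sum_nonneg fun α hα => ?_
    have h1 : 0 ≤ d.ξ α (ψ.symm x) := d.ξ.nonneg _ _
    by_cases h0 : d.ξ α (ψ.symm x) = 0
    · simp [η, h0]
    · simp only [η]
      rw [(d.χ_eq_one α).self_of_nhdsSet _ (subset_tsupport _ h0), one_mul]
      exact mul_nonneg h1 (mul_nonneg (abs_nonneg _) (d.ρ_nonneg _))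
  · have hmin : ∃ δ > 0, ∀ α ∈ S, δ ≤ ε₀ α := by
      by_cases hne : S.Nonempty
      · refine ⟨S.inf' hne ε₀, (Finset.lt_inf'_iff hne).2 fun α _ => hε₀ α, fun α hα =>
          Finset.inf'_le _ hα⟩
      · exact ⟨1, one_pos, fun α hα => absurd ⟨α, hα⟩ hne⟩
    obtain ⟨δ, hδ, hδS⟩ := hmin
    refine ⟨δ, hδ, fun x hx ε hε hεδ T G hT hG hGV a b => ?_⟩
    refine (d.regularise_apply (hS x hx) _ _).trans ((Finset.sum_congr rfl fun α hα =>
      hΦε α x hx ε hε (hεδ.trans_le (hδS α hα)) T G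
        (hT.continuousOn (d.ψ_mem α)) hG hGV a b).trans ?_)
    have h1 : ∀ c e, kernelOp (fun p => ∑ α ∈ S, Φ α a b c e p) ε (fun z => G z c e) x =
        ∑ α ∈ S, kernelOp (Φ α a b c e) ε (fun z => G z c e) x := fun c e => by
      simp only [kernelOp, Finset.sum_mul]
      exact integral_finsetSum _ fun α _ =>
        (hΦ α a b c e).integrable_mul ε x ((hG c e).comp (by fun_prop))
    simp only [h1]
    rw [Finset.sum_comm]
    exact Finset.sum_congr rfl fun c _ => Finset.sum_comm

end RegularisationData

end LipschitzSpacetime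

end
noncomputable section

namespace LipschitzSpacetime

variable {n : ℕ}

/-! ## Partial derivatives and iterated derivatives -/

theorem norm_euclidean_single (i : Fin n) :
    ‖(EuclideanSpace.single i 1 : Model n)‖ = 1 := by simp

theorem abs_pderiv_le_norm_iteratedFDeriv (u : Model n → ℝ) (i : Fin n) (x : Model n) :
    |pderiv i u x| ≤ ‖iteratedFDeriv ℝ 1 u x‖ := by
  rw [norm_iteratedFDeriv_one]
  have h := (fderiv ℝ u x).le_opNorm (EuclideanSpace.single i 1)
  rwa [norm_euclidean_single, mul_one, Real.norm_eq_abs] at h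

theorem abs_pderiv_pderiv_le_norm_iteratedFDeriv {u : Model n → ℝ} {x : Model n}
    (hu : ContDiffAt ℝ ∞ u x) (i j : Fin n) :
    |pderiv i (pderiv j u) x| ≤ ‖iteratedFDeriv ℝ 2 u x‖ := by
  have h1 : DifferentiableAt ℝ (fderiv ℝ u) x :=
    (hu.fderiv_right (m := ∞) (by simp)).differentiableAt (by simp)
  have h2 : pderiv i (pderiv j u) x = iteratedFDeriv ℝ 2 u x
      ![EuclideanSpace.single i 1, EuclideanSpace.single j 1] := by
    rw [iteratedFDeriv_two_apply]
    change fderiv ℝ (fun y => fderiv ℝ u y (EuclideanSpace.single j 1)) x _ = _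
    rw [fderiv_clm_apply h1 (differentiableAt_const _)]
    simp
  rw [h2, ← Real.norm_eq_abs]
  refine ((iteratedFDeriv ℝ 2 u x).le_opNorm _).trans ?_
  simp [Fin.prod_univ_two]

theorem eventually_norm_lt_of_tendstoUniformlyOn {F : Type*} [NormedAddCommGroup F]
    {f : ℕ → Model n → F} {L : Set (Model n)} (h : TendstoUniformlyOn f 0 atTop L) {δ : ℝ}
    (hδ : 0 < δ) : ∀ᶠ k in atTop, ∀ x ∈ L, ‖f k x‖ < δ := by
  filter_upwards [Metric.tendstoUniformlyOn_iff.1 h δ hδ] with k hk x hx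
  simpa using hk x hx

theorem bddTendsto_pderiv_of_tendstoUniformlyOn {F : Type*} [NormedAddCommGroup F]
    [NormedSpace ℝ F] {f : ℕ → Model n → F} {L : Set (Model n)}
    (h : TendstoUniformlyOn (fun k y => iteratedFDeriv ℝ 1 (f k) y) 0 atTop L) (ℓ : F →L[ℝ] ℝ)
    (hf : ∀ᶠ k in atTop, ∀ x ∈ L, ContDiffAt ℝ ∞ (f k) x) (i : Fin n) :
    BddTendsto L (fun k => pderiv i fun y => ℓ (f k y)) fun _ => 0 := by
  refine BddTendsto.of_uniform_zero fun δ hδ => ?_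
  filter_upwards [hf, eventually_norm_lt_of_tendstoUniformlyOn h (δ := δ / (‖ℓ‖ + 1))
    (by positivity)] with k hk1 hk2 x hx
  refine (abs_pderiv_le_norm_iteratedFDeriv _ i x).trans
    ((ℓ.norm_iteratedFDeriv_comp_left (hk1 x hx) (n := 1) (by simp)).trans ?_)
  have h1 := (lt_div_iff₀ (by positivity)).1 (hk2 x hx)
  nlinarith [norm_nonneg (iteratedFDeriv ℝ 1 (f k) x)]

theorem bddTendsto_pderiv_pderiv_of_tendstoUniformlyOn {F : Type*} [NormedAddCommGroup F]
    [NormedSpace ℝ F] {f : ℕ → Model n → F} {L : Set (Model n)}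
    (h : TendstoUniformlyOn (fun k y => iteratedFDeriv ℝ 2 (f k) y) 0 atTop L) (ℓ : F →L[ℝ] ℝ)
    (hf : ∀ᶠ k in atTop, ∀ x ∈ L, ContDiffAt ℝ ∞ (f k) x) (i j : Fin n) :
    BddTendsto L (fun k => pderiv i (pderiv j fun y => ℓ (f k y))) fun _ => 0 := by
  refine BddTendsto.of_uniform_zero fun δ hδ => ?_
  filter_upwards [hf, eventually_norm_lt_of_tendstoUniformlyOn h (δ := δ / (‖ℓ‖ + 1))
    (by positivity)] with k hk1 hk2 x hx
  refine (abs_pderiv_pderiv_le_norm_iteratedFDeriv (ℓ.contDiff.contDiffAt.comp x (hk1 x hx))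
    i j).trans ((ℓ.norm_iteratedFDeriv_comp_left (hk1 x hx) (n := 2)
      (WithTop.coe_le_coe.2 le_top)).trans ?_)
  have h1 := (lt_div_iff₀ (by positivity)).1 (hk2 x hx)
  nlinarith [norm_nonneg (iteratedFDeriv ℝ 2 (f k) x)]

/-- A locally Lipschitz function is Lipschitz on a compact set, and real-valued Lipschitz functions
extend to the whole space with the same constant. Working with a global function avoids domain
conditions in all integrals. -/
theorem exists_lipschitz_extension {F ι : Type*} [NormedAddCommGroup F] [NormedSpace ℝ F]
    [Fintype ι] {f : Model n → F} {L : Set (Model n)} (hf : LocallyLipschitzOn L f)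
    (hL : IsCompact L) (ℓ : ι → F →L[ℝ] ℝ) :
    ∃ u : ι → Model n → ℝ, (∃ C : NNReal, ∀ i, LipschitzWith C (u i)) ∧
      ∀ i, ∀ z ∈ L, u i z = ℓ i (f z) := by
  obtain ⟨C, hC⟩ := hf.exists_lipschitzOnWith_of_compact hL
  choose u hu huf using fun i => ((ℓ i).lipschitz.comp_lipschitzOnWith hC).extend_real
  refine ⟨u, ⟨∑ i, ‖ℓ i‖₊ * C, fun i => (hu i).weaken ?_⟩, fun i z hz => (huf i hz).symm⟩
  exact Finset.single_le_sum (f := fun i => ‖ℓ i‖₊ * C) (fun _ _ => zero_le) (Finset.mem_univ i)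

theorem contDiffAt_clm_comp {F : Type*} [NormedAddCommGroup F] [NormedSpace ℝ F]
    {f : Model n → F} {s : Set (Model n)} (hs : IsOpen s) (hf : ContDiffOn ℝ ∞ f s)
    (ℓ : F →L[ℝ] ℝ) {x : Model n} (hx : x ∈ s) : ContDiffAt ℝ ∞ (fun y => ℓ (f y)) x :=
  ℓ.contDiff.contDiffAt.comp x (hf.contDiffAt (hs.mem_nhds hx))

/-- Evaluation of bilinear forms. -/
def evalBilin (v w : Model n) : (Model n →L[ℝ] Model n →L[ℝ] ℝ) →L[ℝ] ℝ :=
  (ContinuousLinearMap.apply ℝ ℝ w).comp (ContinuousLinearMap.apply ℝ (Model n →L[ℝ] ℝ) v)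

/-! ### Components of tensor fields in a chart. -/

variable {M : Type*} [TopologicalSpace M] [ChartedSpace (Model n) M]
  {ψ : OpenPartialHomeomorph M (Model n)}

theorem contDiffOn_pushBilin {T : BilinField n M} {s : Set (Model n)}
    (h : ∀ a b, ContDiffOn ℝ ∞ (fun y => gram ψ T y a b) s) :
    ContDiffOn ℝ ∞ (pushBilin ψ T) s := by
  refine contDiffOn_clm_apply.2 fun v => contDiffOn_clm_apply.2 fun w => ?_
  simp only [pushBilin_eq_sum_gram]
  exact ContDiffOn.sum fun i _ => ContDiffOn.sum fun j _ =>
    ((h i j).mul contDiffOn_const).mul contDiffOn_const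

theorem SmoothBilin.contDiffAt_gram {T : BilinField n M} (hT : SmoothBilin T)
    (hψ : ψ ∈ smoothCharts n M) {y : Model n} (hy : y ∈ ψ.target) (a b : Fin n) :
    ContDiffAt ℝ ∞ (fun z => gram ψ T z a b) y :=
  contDiffAt_clm_comp (F := Model n →L[ℝ] Model n →L[ℝ] ℝ) ψ.open_target (hT ψ hψ)
    (evalBilin (EuclideanSpace.single a 1) (EuclideanSpace.single b 1)) hy

theorem gram_sub (T S : BilinField n M) (y : Model n) (a b : Fin n) :
    gram ψ (fun x => T x - S x) y a b = gram ψ T y a b - gram ψ S y a b := rfl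

theorem LocLipschitzBilin.exists_extension {g : BilinField n M} (hg : LocLipschitzBilin g)
    (hψ : ψ ∈ smoothCharts n M) {L : Set (Model n)} (hL : IsCompact L) (hLψ : L ⊆ ψ.target) :
    ∃ G : Model n → Matrix (Fin n) (Fin n) ℝ,
      (∃ C : NNReal, ∀ a b, LipschitzWith C fun z => G z a b) ∧ ∀ z ∈ L, G z = gram ψ g z := by
  obtain ⟨u, ⟨C, hC⟩, hu⟩ := exists_lipschitz_extension
    (F := Model n →L[ℝ] Model n →L[ℝ] ℝ) ((hg ψ hψ).mono hLψ) hL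
    fun p : Fin n × Fin n => evalBilin (EuclideanSpace.single p.1 1) (EuclideanSpace.single p.2 1)
  refine ⟨fun z => Matrix.of fun a b => u (a, b) z, ⟨C, fun a b => hC (a, b)⟩, fun z hz => ?_⟩
  ext a b
  exact hu (a, b) z hz

theorem mfderiv_chart_mfderiv_symm (hψ : ψ ∈ smoothCharts n M) {y : Model n} (hy : y ∈ ψ.target)
    (v : Model n) :
    (mfderiv (𝓡 n) (𝓡 n) ψ (ψ.symm y) (mfderiv (𝓡 n) (𝓡 n) ψ.symm y v) : Model n) = v := by
  have hyW : y ∈ (ψ.symm ≫ₕ ψ).source := ⟨hy, ψ.map_target hy⟩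
  rw [mfderiv_chart_comp_symm hψ hψ hyW, Filter.EventuallyEq.fderiv_eq (f := id)]
  · rw [fderiv_id]
    rfl
  · filter_upwards [ψ.open_target.mem_nhds hy] with z hz using ψ.right_inv hz

/-- A one-sided inverse of an endomorphism of a finite-dimensional space is two-sided. -/
theorem mfderiv_symm_mfderiv_chart (hψ : ψ ∈ smoothCharts n M) {y : Model n} (hy : y ∈ ψ.target)
    (u : TangentSpace (𝓡 n) (ψ.symm y)) :
    mfderiv (𝓡 n) (𝓡 n) ψ.symm y (mfderiv (𝓡 n) (𝓡 n) ψ (ψ.symm y) u : Model n) = u := by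
  let A : Model n →L[ℝ] Model n := mfderiv (𝓡 n) (𝓡 n) ψ.symm y
  let B : Model n →L[ℝ] Model n := mfderiv (𝓡 n) (𝓡 n) ψ (ψ.symm y)
  have h1 : (B : Model n →ₗ[ℝ] Model n) ∘ₗ (A : Model n →ₗ[ℝ] Model n) = LinearMap.id :=
    LinearMap.ext fun v => mfderiv_chart_mfderiv_symm hψ hy v
  have h2 : (A : Model n →ₗ[ℝ] Model n) ∘ₗ (B : Model n →ₗ[ℝ] Model n) = LinearMap.id :=
    (LinearMap.comp_eq_id_comm _ _).1 h1
  exact congrArg (fun l : Model n →ₗ[ℝ] Model n => l u) h2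

/-- A vector in the kernel of the form is orthogonal to the timelike vector of the signature
condition, hence has positive square unless it is zero; but its square is zero. -/
theorem IsLorentzian.det_gram_ne_zero {g : BilinField n M} (hg : IsLorentzian g)
    (hψ : ψ ∈ smoothCharts n M) {y : Model n} (hy : y ∈ ψ.target) : (gram ψ g y).det ≠ 0 := by
  intro h0
  obtain ⟨v, hv, hv0⟩ := Matrix.exists_mulVec_eq_zero_iff.2 h0
  have h1 : ∀ u : Model n, pushBilin ψ g y u (WithLp.toLp 2 v) = 0 := fun u => by
    rw [pushBilin_eq_sum_gram]
    refine Finset.sum_eq_zero fun i _ => ?_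
    have h2 := congrFun hv0 i
    simp only [Matrix.mulVec, dotProduct, Pi.zero_apply] at h2
    have h3 : ∑ j, gram ψ g y i j * u i * v j = u i * ∑ j, gram ψ g y i j * v j := by
      rw [Finset.mul_sum]
      exact Finset.sum_congr rfl fun j _ => by ring
    exact h3.trans (by rw [h2, mul_zero])
  obtain ⟨t, -, ht⟩ := hg.signature (ψ.symm y)
  set w : TangentSpace (𝓡 n) (ψ.symm y) :=
    mfderiv (𝓡 n) (𝓡 n) ψ.symm y (WithLp.toLp 2 v : Model n) with hw
  have hw0 : w ≠ 0 := fun hw0 => hv (by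
    have h2 := mfderiv_chart_mfderiv_symm hψ hy (WithLp.toLp 2 v)
    rw [← hw, hw0] at h2
    have h3 : (0 : Model n) = WithLp.toLp 2 v := (map_zero _).symm.trans h2
    funext i
    exact (congrArg (fun z : Model n => z i) h3).symm)
  have h4 : g (ψ.symm y) t w = 0 := by
    have h5 : g (ψ.symm y) (mfderiv (𝓡 n) (𝓡 n) ψ.symm y
      (mfderiv (𝓡 n) (𝓡 n) ψ (ψ.symm y) t : Model n)) w = 0 := h1 _
    rwa [mfderiv_symm_mfderiv_chart hψ hy] at h5
  exact (ht w h4 hw0).ne' (h1 (WithLp.toLp 2 v))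

end LipschitzSpacetime

end
-- The approximating metrics in a chart.
noncomputable section

namespace LipschitzSpacetime

variable {n : ℕ} {M : Type*} [TopologicalSpace M] [ChartedSpace (Model n) M]
  {ψ : OpenPartialHomeomorph M (Model n)}

theorem KernelAtZero.mono {N N' : Set (Model n)} {Φ H : ℝ × Model n × Model n → ℝ} {c : ℝ}
    (h : KernelAtZero N Φ H c) (hN : N' ⊆ N) : KernelAtZero N' Φ H c :=
  ⟨h.kernel, h.kernel_one, fun x hx => h.eq_mul x (hN hx), fun x hx => h.integral_eq_one x (hN hx)⟩

theorem sum_delta_mul_delta_mul (a b : Fin n) (F : Fin n → Fin n → ℝ) :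
    ∑ c, ∑ e, ((if a = c then 1 else 0) * (if b = e then 1 else 0)) * F c e = F a b := by
  simp

theorem pderiv_sum_sum_add {ι κ : Type*} (s : Finset ι) (t : Finset κ)
    {f : ι → κ → Model n → ℝ} {g : Model n → ℝ} {x : Model n}
    (hf : ∀ a b, DifferentiableAt ℝ (f a b) x) (hg : DifferentiableAt ℝ g x) (i : Fin n) :
    pderiv i (fun y => (∑ a ∈ s, ∑ b ∈ t, f a b y) + g y) x =
      (∑ a ∈ s, ∑ b ∈ t, pderiv i (f a b) x) + pderiv i g x := by
  have h1 : HasFDerivAt (fun y => (∑ a ∈ s, ∑ b ∈ t, f a b y) + g y)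
      ((∑ a ∈ s, ∑ b ∈ t, fderiv ℝ (f a b) x) + fderiv ℝ g x) x :=
    (HasFDerivAt.fun_sum fun a _ => HasFDerivAt.fun_sum fun b _ => (hf a b).hasFDerivAt).add
      hg.hasFDerivAt
  rw [pderiv, h1.fderiv]
  simp only [add_apply, sum_apply, pderiv]

theorem _root_.ContDiffAt.pderiv {u : Model n → ℝ} {x : Model n} (hu : ContDiffAt ℝ ∞ u x)
    (i : Fin n) : ContDiffAt ℝ ∞ (LipschitzSpacetime.pderiv i u) x :=
  (hu.fderiv_right (m := ∞) (by simp)).clm_apply contDiffAt_const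

/-- In the chart g_k is a sum of kernel operators plus the remainder g_k - g ⋆ ρ_ε. Convergence of
the remainder in C^∞_loc handles its first and second derivatives, its O(ε) bound the rate, and the
asymptotics of kernel operators do the rest. -/
theorem IsInnerApproximation.exists_ricciApproximation [T2Space M] (i₀ : Fin n)
    {d : RegularisationData n M} {g : BilinField n M} {gk : ℕ → BilinField n M}
    (hgk : IsInnerApproximation d g gk) (hg : IsLorentzian g) (hgL : LocLipschitzBilin g)
    (hψ : ψ ∈ smoothCharts n M) {L : Set (Model n)} (hL : IsCompact L) (hLψ : L ⊆ ψ.target) :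
    ∃ (N : Set (Model n)) (G : Model n → Matrix (Fin n) (Fin n) ℝ)
      (H : ℝ × Model n × Model n → ℝ) (ε : ℕ → ℝ),
      RicciApproximation L N G (fun k => gram ψ (gk k)) H ε ∧ N ⊆ ψ.target ∧
        (∀ z ∈ N, G z = gram ψ g z) ∧ ∀ x ∈ N, ∀ w, 0 ≤ H (0, x, w) := by
  -- Two intermediate compact sets: g is extended from L₂, the kernels are normalised on L₁, and the
  -- interior of L₁ is an open set on which identities may be differentiated.
  obtain ⟨L₂, hL₂, hLL₂, hL₂ψ⟩ := exists_compact_between hL ψ.open_target hLψ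
  obtain ⟨L₁, hL₁, hLL₁, hL₁₂⟩ := exists_compact_between hL isOpen_interior hLL₂
  obtain ⟨G, ⟨C, hGC⟩, hG⟩ := hgL.exists_extension hψ hL₂ hL₂ψ
  obtain ⟨ε, hε, hε0, hsm, hrate⟩ := hgk.close
  have hVψ : interior L₂ ⊆ ψ.target := interior_subset.trans hL₂ψ
  have hGV : ∀ z ∈ interior L₂, G z = gram ψ g z := fun z hz => hG z (interior_subset hz)
  obtain ⟨Φ, H, hΦ, hH, ε₀, hε₀, hreg⟩ := d.exists_kernel i₀ hψ hL₁ isOpen_interior hL₁₂ hVψ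
  set N := interior L₁ with hN
  have hNo : IsOpen N := isOpen_interior
  have hNV : N ⊆ interior L₂ := interior_subset.trans hL₁₂
  have hΦN := fun a b c e => (hΦ a b c e).mono (N' := N) interior_subset
  have hGcont : ∀ a b, Continuous fun z => G z a b := fun a b => (hGC a b).continuous
  have hεlt : ∀ᶠ k in atTop, ε k < ε₀ := hε0.eventually (gt_mem_nhds hε₀)
  let T : ℕ → BilinField n M := fun k x => gk k x - d.regularise g (ε k) x
  let F : ℕ → Fin n → Fin n → Fin n → Fin n → Model n → ℝ := fun k a b c e =>
    kernelOp (Φ a b c e) (ε k) fun z => G z c e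
  have hF : ∀ k a b c e, ContDiff ℝ ∞ (F k a b c e) := fun k a b c e =>
    (hΦN a b c e).kernel.contDiff_kernelOp (hε k).1 (hGcont c e)
  have hgkF : ∀ᶠ k in atTop, ∀ x ∈ N, ∀ a b,
      gram ψ (gk k) x a b = (∑ c, ∑ e, F k a b c e x) + gram ψ (T k) x a b := by
    filter_upwards [hεlt] with k hk x hx a b
    simp only [T]
    rw [gram_sub, hreg x (interior_subset hx) (ε k) (hε k).1 hk g G hgL hGcont hGV]
    simp only [F]
    ring
  have hgks : ∀ k, ∀ x ∈ N, ∀ a b, ContDiffAt ℝ ∞ (fun z => gram ψ (gk k) z a b) x :=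
    fun k x hx a b => (hgk.smooth k).contDiffAt_gram hψ (hVψ (hNV hx)) a b
  -- The remainder is smooth as the difference of g_k and the smooth kernel operators; no separate
  -- smoothness result for the regularisation is needed.
  have hTs : ∀ᶠ k in atTop, ∀ x ∈ N, ∀ a b, ContDiffAt ℝ ∞ (fun z => gram ψ (T k) z a b) x := by
    filter_upwards [hgkF] with k hk x hx a b
    refine ((hgks k x hx a b).sub (ContDiff.contDiffAt (f := fun z => ∑ c, ∑ e, F k a b c e z)
      (ContDiff.sum fun c _ => ContDiff.sum fun e _ => hF k a b c e))).congr_of_eventuallyEq ?_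
    filter_upwards [hNo.mem_nhds hx] with z hz
    rw [hk z hz a b]
    ring
  have hTp : ∀ᶠ k in atTop, ∀ x ∈ L, ContDiffAt ℝ ∞ (pushBilin ψ (T k)) x := by
    filter_upwards [hTs] with k hk x hx
    exact (contDiffOn_pushBilin fun a b y hy => (hk y hy a b).contDiffWithinAt).contDiffAt
      (hNo.mem_nhds (hLL₁ hx))
  let ℓ : Fin n → Fin n → (Model n →L[ℝ] Model n →L[ℝ] ℝ) →L[ℝ] ℝ := fun a b =>
    evalBilin (EuclideanSpace.single a 1) (EuclideanSpace.single b 1)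
  have hr1 : ∀ a b i, BddTendsto L (fun k => pderiv i fun z => gram ψ (T k) z a b) fun _ => 0 :=
    fun a b i => bddTendsto_pderiv_of_tendstoUniformlyOn (F := Model n →L[ℝ] Model n →L[ℝ] ℝ)
      (hsm ψ hψ L hLψ hL 1) (ℓ a b) hTp i
  have hr2 : ∀ a b i j,
      BddTendsto L (fun k => pderiv i (pderiv j fun z => gram ψ (T k) z a b)) fun _ => 0 :=
    fun a b i j => bddTendsto_pderiv_pderiv_of_tendstoUniformlyOn
      (F := Model n →L[ℝ] Model n →L[ℝ] ℝ) (hsm ψ hψ L hLψ hL 2) (ℓ a b) hTp i j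
  have hd1 : ∀ᶠ k in atTop, ∀ x ∈ N, ∀ a b i, pderiv i (fun z => gram ψ (gk k) z a b) x =
      (∑ c, ∑ e, pderiv i (F k a b c e) x) + pderiv i (fun z => gram ψ (T k) z a b) x := by
    filter_upwards [hgkF, hTs] with k hk hkT x hx a b i
    rw [← pderiv_sum_sum_add _ _ (fun c e => (hF k a b c e).differentiable (by simp) x)
      ((hkT x hx a b).differentiableAt (by simp))]
    refine pderiv_congr ?_ i
    filter_upwards [hNo.mem_nhds hx] with z hz using hk z hz a b
  have hd2 : ∀ᶠ k in atTop, ∀ x ∈ N, ∀ a b i j,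
      pderiv i (pderiv j (fun z => gram ψ (gk k) z a b)) x =
      (∑ c, ∑ e, pderiv i (pderiv j (F k a b c e)) x) +
        pderiv i (pderiv j fun z => gram ψ (T k) z a b) x := by
    filter_upwards [hd1, hTs] with k hk hkT x hx a b i j
    rw [← pderiv_sum_sum_add _ _
      (fun c e => ((hF k a b c e).contDiffAt.pderiv j).differentiableAt (by simp))
      (((hkT x hx a b).pderiv j).differentiableAt (by simp))]
    refine pderiv_congr ?_ i
    filter_upwards [hNo.mem_nhds hx] with z hz using hk z hz a b j
  refine ⟨N, G, H, ε, ⟨hL, hNo, hLL₁, hε, hε0, ⟨C, hGC⟩, fun z hz => ?_,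
    (hΦN i₀ i₀ i₀ i₀).kernel_one, (hΦN i₀ i₀ i₀ i₀).integral_eq_one,
    fun k x hx => hgks k x (hLL₁ hx), fun a b => ?_, fun a b i => ?_, fun a b i j => ?_⟩,
    hNV.trans hVψ, fun z hz => hGV z (hNV hz), fun x hx => hH x (interior_subset hx)⟩
  · rw [hGV z (hNV hz)]
    exact hg.det_gram_ne_zero hψ (hVψ (hNV hz))
  · obtain ⟨D, hD⟩ := hrate ψ hψ L hLψ hL
    obtain ⟨D', hD'⟩ := (BddTendsto.sum Finset.univ fun c _ => BddTendsto.sum Finset.univ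
      fun e _ => (hΦN a b c e).bddTendsto_inv_mul_sub hL hLL₁ (hGC c e) hε hε0).bdd
    refine ⟨D' + D, ?_⟩
    filter_upwards [hgkF, hD'] with k hk hkD x hx
    have h1 : |gram ψ (T k) x a b| ≤ D * ε k := by
      refine le_trans ?_ (hD k x hx)
      have h2 := (pushBilin ψ (T k) x).le_opNorm₂ (EuclideanSpace.single a 1)
        (EuclideanSpace.single b 1)
      rwa [norm_euclidean_single, norm_euclidean_single, mul_one, mul_one] at h2
    -- The deltas single out G_ab from the sum, so the error of the average can be distributed over
    -- all pairs (c, e), each with its own rate.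
    have h3 : gram ψ (gk k) x a b - G x a b = ε k * (∑ c, ∑ e, (ε k)⁻¹ * (F k a b c e x
        - ((if a = c then 1 else 0) * (if b = e then 1 else 0)) * G x c e)) +
        gram ψ (T k) x a b := by
      rw [hk x (hLL₁ hx)]
      simp only [← Finset.mul_sum, Finset.sum_sub_distrib]
      rw [sum_delta_mul_delta_mul a b fun c e => G x c e, mul_inv_cancel_left₀ (hε k).1.ne']
      ring
    rw [h3]
    refine (abs_add_le _ _).trans ?_
    rw [abs_mul, abs_of_pos (hε k).1, add_mul]
    refine add_le_add ?_ h1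
    rw [mul_comm]
    exact mul_le_mul_of_nonneg_right (hkD x hx) (hε k).1.le
  · refine ((BddTendsto.sum Finset.univ fun c _ => BddTendsto.sum Finset.univ fun e _ =>
      (hΦN a b c e).bddTendsto_pderiv hL hNo hLL₁ (hGC c e) hε hε0 i).add (hr1 a b i)).congr ?_
      (Eventually.of_forall fun x _ => ?_)
    · filter_upwards [hd1] with k hk x hx using hk x (hLL₁ hx) a b i
    · rw [add_zero, sum_delta_mul_delta_mul a b fun c e => pderiv i (fun z => G z c e) x]
  · refine ((BddTendsto.sum Finset.univ fun c _ => BddTendsto.sum Finset.univ fun e _ =>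
      (hΦN a b c e).bddTendsto_pderiv_pderiv hL hNo hLL₁ (hGC c e) hε hε0 i j).add
        (hr2 a b i j)).congr ?_ (Eventually.of_forall fun x _ => by simp)
    filter_upwards [hd2] with k hk x hx
    rw [hk x (hLL₁ hx) a b i j]
    simp only [Finset.sum_sub_distrib]
    rw [sum_delta_mul_delta_mul a b fun c e => (ε k)⁻¹ * ((ε k)⁻¹ *
      ∫ w, dw i (dw j H) (0, x, w) * G (x + ε k • w) c e)]
    ring

end LipschitzSpacetime

end
noncomputable section

namespace LipschitzSpacetime

variable {n : ℕ} {M : Type*} [TopologicalSpace M] [ChartedSpace (Model n) M]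
  {ψ : OpenPartialHomeomorph M (Model n)}

/-! ## Vector fields in charts -/

/-- The vector field with constant components `v` in the chart `ψ`; meaningful on `ψ.source`. -/
def coordField (ψ : OpenPartialHomeomorph M (Model n)) (v : Model n) : VectorField n M :=
  fun p => (mfderiv (𝓡 n) (𝓡 n) ψ.symm (ψ p) v : Model n)

theorem tangentBundle_mk_congr {p q : M} (h : q = p) (u : Model n) :
    (⟨q, u⟩ : TangentBundle (𝓡 n) M) = ⟨p, u⟩ := by
  subst h
  rfl

theorem pushVector_coordField (hψ : ψ ∈ smoothCharts n M) (v : Model n) {y : Model n}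
    (hy : y ∈ ψ.target) : pushVector ψ (coordField ψ v) y = v := by
  have h1 := mfderiv_chart_mfderiv_symm hψ hy v
  rw [pushVector, coordField, ψ.right_inv hy]
  exact h1

theorem pushBilin_pushVector (hψ : ψ ∈ smoothCharts n M) (T : BilinField n M)
    (X Y : VectorField n M) {y : Model n} (hy : y ∈ ψ.target) :
    pushBilin ψ T y (pushVector ψ X y) (pushVector ψ Y y) =
      T (ψ.symm y) (X (ψ.symm y)) (Y (ψ.symm y)) := by
  have h1 := mfderiv_symm_mfderiv_chart hψ hy (X (ψ.symm y))
  have h2 := mfderiv_symm_mfderiv_chart hψ hy (Y (ψ.symm y))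
  exact congrArg₂ (fun a b => T (ψ.symm y) a b) h1 h2

variable [IsManifold (𝓡 n) ∞ M]

theorem contMDiffAt_coordField (hψ : ψ ∈ smoothCharts n M) (v : Model n) {p : M}
    (hp : p ∈ ψ.source) : ContMDiffAt (𝓡 n) (𝓡 n).tangent ∞
      (fun q => (⟨q, coordField ψ v q⟩ : TangentBundle (𝓡 n) M)) p := by
  have h1 := (contMDiffOn_symm_of_mem_maximalAtlas hψ).contMDiffOn_tangentMapWithin (m := ∞)
    (by simp) ψ.open_target.uniqueMDiffOn
  have h2 : ContMDiffAt (𝓡 n) (𝓡 n).tangent ∞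
      (fun q => (⟨ψ q, v⟩ : TangentBundle (𝓡 n) (Model n))) p := by
    have h3 : ContMDiff (𝓡 n) (𝓡 n).tangent ∞
        (fun y => (⟨y, v⟩ : TangentBundle (𝓡 n) (Model n))) :=
      contMDiff_vectorSpace_iff_contDiff (V := fun _ : Model n => v).2 contDiff_const
    exact h3.contMDiffAt.comp p (contMDiffAt_of_mem_maximalAtlas hψ hp)
  have hnhds : Bundle.TotalSpace.proj ⁻¹' ψ.target ∈
      𝓝 (⟨ψ p, v⟩ : TangentBundle (𝓡 n) (Model n)) :=
    ((FiberBundle.continuous_proj (Model n) (TangentSpace (𝓡 n) : Model n → Type)).isOpen_preimage _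
      ψ.open_target).mem_nhds (ψ.map_source hp)
  refine ((h1.contMDiffAt hnhds).comp p h2).congr_of_eventuallyEq ?_
  filter_upwards [ψ.open_source.mem_nhds hp] with q hq
  simp only [Function.comp_apply, tangentMapWithin]
  rw [mfderivWithin_of_isOpen ψ.open_target (ψ.map_source hq)]
  exact (tangentBundle_mk_congr (ψ.left_inv hq) _).symm

theorem SmoothVectorField.contDiffOn_pushVector {X : VectorField n M} (hX : SmoothVectorField X)
    (hψ : ψ ∈ smoothCharts n M) : ContDiffOn ℝ ∞ (pushVector ψ X) ψ.target := by
  have h1 := (contMDiffOn_of_mem_maximalAtlas hψ).contMDiffOn_tangentMapWithin (m := ∞)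
    (by simp) ψ.open_source.uniqueMDiffOn
  refine (contMDiffOn_vectorSpace_iff_contDiffOn (V := pushVector ψ X)).1 ?_
  have h2 : ContMDiffOn (𝓡 n) (𝓡 n).tangent ∞
      (fun y => (⟨ψ.symm y, X (ψ.symm y)⟩ : TangentBundle (𝓡 n) M)) ψ.target :=
    ContMDiff.comp_contMDiffOn hX (contMDiffOn_symm_of_mem_maximalAtlas hψ)
  refine (h1.comp h2 fun y hy => ψ.map_target hy).congr fun y hy => ?_
  simp only [Function.comp_apply, tangentMapWithin]
  rw [mfderivWithin_of_isOpen ψ.open_source (ψ.map_target hy)]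
  exact (tangentBundle_mk_congr (ψ.right_inv hy) _).symm

theorem continuousOn_gram_inner (h : Bundle.ContMDiffRiemannianMetric (𝓡 n) ∞ (Model n)
    (fun x : M => TangentSpace (𝓡 n) x)) (hψ : ψ ∈ smoothCharts n M) (a b : Fin n) :
    ContinuousOn (fun y => gram ψ h.inner y a b) ψ.target := by
  intro y hy
  refine ContinuousAt.continuousWithinAt ?_
  have hp := ψ.map_target hy
  have h1 := h.contMDiff.contMDiffAt.clm_bundle_apply₂ (x := ψ.symm y)
    (E₃ := Bundle.Trivial M ℝ) (contMDiffAt_coordField hψ (EuclideanSpace.single a 1) hp)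
    (contMDiffAt_coordField hψ (EuclideanSpace.single b 1) hp)
  rw [Bundle.contMDiffAt_section] at h1
  have h2 := h1.continuousAt.comp (ψ.symm.continuousAt hy)
  refine h2.congr ?_
  filter_upwards [ψ.open_target.mem_nhds hy] with z hz
  change h.inner (ψ.symm z) (coordField ψ (EuclideanSpace.single a 1) (ψ.symm z))
    (coordField ψ (EuclideanSpace.single b 1) (ψ.symm z)) = _
  rw [coordField, coordField, ψ.right_inv hz]
  rfl

end LipschitzSpacetime

end
noncomputable section

namespace LipschitzSpacetime

variable {n : ℕ} {M : Type*} [TopologicalSpace M] [ChartedSpace (Model n) M]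
  {ψ : OpenPartialHomeomorph M (Model n)}

/-! ## Timelike test fields -/

/-- If u and v were orthogonal, w = g(t,v)u - g(t,u)v would be a nonzero vector orthogonal to t with
g(w,w) = g(t,v)² g(u,u) + g(t,u)² g(v,v) ≤ 0, against the signature condition. -/
theorem IsLorentzian.apply_ne_zero_of_timelike {g : BilinField n M} (hg : IsLorentzian g) {x : M}
    {u v : TangentSpace (𝓡 n) x} (hu : g x u u < 0) (hv : g x v v < 0) : g x u v ≠ 0 := by
  intro huv
  obtain ⟨t, -, ht⟩ := hg.signature x
  have htu : g x t u ≠ 0 := fun h0 => by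
    have hu0 : u ≠ 0 := fun h => by rw [h, map_zero] at hu; simp at hu
    exact lt_asymm hu (ht u h0 hu0)
  have hvu : g x v u = 0 := by rw [hg.symm, huv]
  set w : TangentSpace (𝓡 n) x := g x t v • u - g x t u • v with hw
  have htw : g x t w = 0 := by
    rw [hw, map_sub, map_smul, map_smul, smul_eq_mul, smul_eq_mul, mul_comm, sub_self]
  have hvw : g x v w = -(g x t u * g x v v) := by
    rw [hw, map_sub, map_smul, map_smul, hvu, smul_eq_mul, smul_eq_mul, mul_zero, zero_sub]
  have huw : g x u w = g x t v * g x u u := by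
    rw [hw, map_sub, map_smul, map_smul, huv, smul_eq_mul, smul_eq_mul, mul_zero, sub_zero]
  have hw0 : w ≠ 0 := fun h0 => by
    rw [h0, map_zero] at hvw
    exact mul_ne_zero htu hv.ne (neg_eq_zero.1 hvw.symm)
  have hww : g x w w = g x t v * g x w u - g x t u * g x w v := by
    conv_lhs => rw [hw]
    rw [← hw, map_sub, map_smul, map_smul, smul_eq_mul, smul_eq_mul]
  have h1 := ht w htw hw0
  rw [hww, hg.symm x w u, hg.symm x w v, huw, hvw] at h1
  nlinarith [mul_nonneg (sq_nonneg (g x t v)) (neg_nonneg.2 hu.le),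
    mul_nonneg (sq_nonneg (g x t u)) (neg_nonneg.2 hv.le)]

variable [IsManifold (𝓡 n) ∞ M]

/-- The Riemannian metric is bounded below on the compact product of L with the unit sphere, which
makes its norm comparable with the Euclidean one. -/
theorem exists_norm_pushVector_le (h : Bundle.ContMDiffRiemannianMetric (𝓡 n) ∞ (Model n)
    (fun x : M => TangentSpace (𝓡 n) x)) (hψ : ψ ∈ smoothCharts n M) {L : Set (Model n)}
    (hL : IsCompact L) (hLψ : L ⊆ ψ.target) {X : ℕ → VectorField n M}
    (hX : LocUniformlyBounded h.inner X) :
    ∃ B : ℝ, ∀ k, ∀ y ∈ L, ‖pushVector ψ (X k) y‖ ≤ B := by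
  have hpos : ∀ y ∈ L, ∀ v : Model n, v ≠ 0 → 0 < pushBilin ψ h.inner y v v := by
    intro y hy v hv
    refine h.pos (ψ.symm y) _ fun h0 => hv ?_
    have h1 := mfderiv_chart_mfderiv_symm hψ (hLψ hy) v
    let B : Model n →L[ℝ] Model n := mfderiv (𝓡 n) (𝓡 n) ψ (ψ.symm y)
    exact h1.symm.trans ((congrArg B h0).trans (map_zero B))
  have hc : ContinuousOn (fun p : Model n × Model n =>
      (pushBilin ψ h.inner p.1 p.2 p.2)⁻¹) (L ×ˢ Metric.sphere 0 1) := by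
    refine ContinuousOn.inv₀ ?_ fun p hp => (hpos p.1 hp.1 p.2 fun h0 => by
      have := mem_sphere_zero_iff_norm.1 hp.2
      simp [h0] at this).ne'
    simp only [pushBilin_eq_sum_gram]
    refine continuousOn_finsetSum _ fun i _ => continuousOn_finsetSum _ fun j _ => ?_
    refine ContinuousOn.mul (ContinuousOn.mul ?_ (by fun_prop)) (by fun_prop)
    exact ((continuousOn_gram_inner h hψ i j).mono hLψ).comp continuousOn_fst fun p hp => hp.1
  obtain ⟨D, hD⟩ := (hL.prod (isCompact_sphere 0 1)).exists_bound_of_continuousOn hc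
  obtain ⟨C, hC⟩ := hX _ (hL.image_of_continuousOn (ψ.symm.continuousOn.mono hLψ))
  -- The argument bounds the square of the norm by |D|C², and t ≤ t² + 1.
  refine ⟨|D| * C ^ 2 + 1, fun k y hy => ?_⟩
  set u := pushVector ψ (X k) y with hu
  have huC : pushBilin ψ h.inner y u u ≤ C ^ 2 := by
    rw [hu, pushBilin_pushVector hψ _ _ _ (hLψ hy)]
    have h1 := hC k (ψ.symm y) (mem_image_of_mem _ hy)
    exact (Real.sqrt_le_left ((Real.sqrt_nonneg _).trans h1)).1 h1
  by_cases hu0 : u = 0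
  · rw [hu0, norm_zero]
    positivity
  · have hnu : 0 < ‖u‖ := norm_pos_iff.2 hu0
    have h1 := hD (y, ‖u‖⁻¹ • u) ⟨hy, by simp [norm_smul, hnu.ne']⟩
    have h2 := hpos y hy u hu0
    have h3 : pushBilin ψ h.inner y (‖u‖⁻¹ • u) (‖u‖⁻¹ • u) =
        (‖u‖ ^ 2)⁻¹ * pushBilin ψ h.inner y u u := by
      rw [map_smul, map_smul, smul_apply, smul_eq_mul, smul_eq_mul]
      field_simp
    simp only [h3, norm_inv, norm_mul, norm_pow, Real.norm_eq_abs, abs_norm, abs_of_pos h2,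
      mul_inv, inv_inv] at h1
    rw [← div_eq_mul_inv, div_le_iff₀ h2] at h1
    have h4 := h1.trans ((mul_le_mul_of_nonneg_right (le_abs_self D) h2.le).trans
      (mul_le_mul_of_nonneg_left huC (abs_nonneg D)))
    nlinarith [sq_nonneg (‖u‖ - 1)]

/-- Interpolate with a bump function between X and the field with constant components v = X(x). On
the ball both fields are timelike and lie in the same half of the light cone, which is convex, so
the combination stays timelike. -/
theorem exists_timelike_extension [T2Space M] {g : BilinField n M} (hg : IsLorentzian g)
    (hψ : ψ ∈ smoothCharts n M) (hgc : ContinuousOn (pushBilin ψ g) ψ.target) {X : VectorField n M}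
    (hX : SmoothVectorField X) (hXt : Timelike g X) {x : Model n} {r : ℝ} (hr : 0 < r)
    (hball : Metric.ball x r ⊆ ψ.target)
    (htime : ∀ y ∈ Metric.ball x r, pushBilin ψ g y (pushVector ψ X x) (pushVector ψ X x) < 0) :
    ∃ Y : VectorField n M, SmoothVectorField Y ∧ Timelike g Y ∧
      ∀ y ∈ Metric.ball x (r / 2), pushVector ψ Y y = pushVector ψ X x := by
  classical
  set v := pushVector ψ X x with hv
  let b : ContDiffBump x := ⟨r / 2, 3 * r / 4, by positivity, by linarith⟩
  let c : M → ℝ := fun p => if p ∈ ψ.source then b (ψ p) else 0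
  have hball' : Metric.closedBall x (3 * r / 4) ⊆ Metric.ball x r :=
    Metric.closedBall_subset_ball (by linarith)
  let Y : VectorField n M := X + c • (coordField ψ v - X)
  have hY : ∀ p, Y p = X p + c p • (coordField ψ v p - X p) := fun p => rfl
  have hc0 : ∀ p, p ∉ ψ.symm '' Metric.closedBall x (3 * r / 4) → c p = 0 := by
    intro p hp
    by_cases hps : p ∈ ψ.source
    · simp only [c, if_pos hps]
      refine b.zero_of_le_dist (le_of_not_ge fun h1 => hp ⟨ψ p, h1, ψ.left_inv hps⟩)
    · simp only [c, if_neg hps]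
  -- At the centre g(X, v) = g(v, v) < 0. Two timelike vectors are never orthogonal, so g(X, v) has
  -- no zero on the ball and, the ball being connected, keeps its sign.
  have hneg : ∀ y ∈ Metric.ball x r, pushBilin ψ g y (pushVector ψ X y) v < 0 := by
    have hcont : ContinuousOn (fun y => pushBilin ψ g y (pushVector ψ X y) v)
        (Metric.ball x r) :=
      (((hgc.clm_apply (hX.contDiffOn_pushVector hψ).continuousOn).clm_apply
        continuousOn_const).mono hball)
    intro y hy
    by_contra hy0
    have hx : x ∈ Metric.ball x r := Metric.mem_ball_self hr
    obtain ⟨z, hz, hz0⟩ := (convex_ball x r).isPreconnected.intermediate_value hx hy hcont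
      ⟨(htime x hx).le, not_lt.1 hy0⟩
    have hzt := hball hz
    have h1 := pushBilin_pushVector hψ g X (coordField ψ v) hzt
    have h2 := pushBilin_pushVector hψ g (coordField ψ v) (coordField ψ v) hzt
    rw [pushVector_coordField hψ v hzt] at h1 h2
    exact hg.apply_ne_zero_of_timelike (hXt _) (h2.symm.trans_lt (htime z hz))
      (h1.symm.trans hz0)
  refine ⟨Y, fun p => ?_, fun p => ?_, fun y hy => ?_⟩
  · by_cases hp : p ∈ ψ.source
    · have hcs : ContMDiffAt (𝓡 n) 𝓘(ℝ, ℝ) ∞ c p := by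
        refine (b.contDiff.contMDiff.contMDiffAt.comp p
          (contMDiffAt_of_mem_maximalAtlas hψ hp)).congr_of_eventuallyEq ?_
        filter_upwards [ψ.open_source.mem_nhds hp] with q hq
        simp only [c, if_pos hq, Function.comp_apply]
      exact (hX p).add_section (hcs.smul_section ((contMDiffAt_coordField hψ v hp).sub_section
        (hX p)))
    · refine (hX p).congr_of_eventuallyEq ?_
      have hcl : IsClosed (ψ.symm '' Metric.closedBall x (3 * r / 4)) :=
        ((isCompact_closedBall _ _).image_of_continuousOn
          (ψ.symm.continuousOn.mono (hball'.trans hball))).isClosed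
      have hpc : p ∉ ψ.symm '' Metric.closedBall x (3 * r / 4) := by
        rintro ⟨y, hy, rfl⟩
        exact hp (ψ.map_target (hball (hball' hy)))
      filter_upwards [hcl.isOpen_compl.mem_nhds hpc] with q hq
      rw [hY, hc0 q hq, zero_smul, add_zero]
  · by_cases hp : p ∈ ψ.symm '' Metric.closedBall x (3 * r / 4)
    · obtain ⟨y, hy, rfl⟩ := hp
      have hyb := hball' hy
      have hyt := hball hyb
      have ht0 : 0 ≤ c (ψ.symm y) := by
        simp only [c, if_pos (ψ.map_target hyt)]
        exact b.nonneg
      have ht1 : c (ψ.symm y) ≤ 1 := by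
        simp only [c, if_pos (ψ.map_target hyt)]
        exact b.le_one
      set t := c (ψ.symm y)
      have h1 := pushBilin_pushVector hψ g X (coordField ψ v) hyt
      have h2 := pushBilin_pushVector hψ g (coordField ψ v) (coordField ψ v) hyt
      rw [pushVector_coordField hψ v hyt] at h1 h2
      have h3 := h1.symm.trans_lt (hneg y hyb)
      have h4 := h2.symm.trans_lt (htime y hyb)
      have h5 := hXt (ψ.symm y)
      -- The square of (1 - t)X + tV: all three terms are nonpositive, and the first or, for t = 1,
      -- the last is negative.
      have h6 : g (ψ.symm y) (Y (ψ.symm y)) (Y (ψ.symm y)) =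
          (1 - t) ^ 2 * g (ψ.symm y) (X (ψ.symm y)) (X (ψ.symm y)) +
          2 * (t * (1 - t)) * g (ψ.symm y) (X (ψ.symm y)) (coordField ψ v (ψ.symm y)) +
          t ^ 2 * g (ψ.symm y) (coordField ψ v (ψ.symm y)) (coordField ψ v (ψ.symm y)) := by
        have h7 := hg.symm (ψ.symm y) (coordField ψ v (ψ.symm y)) (X (ψ.symm y))
        rw [hY]
        simp only [map_add, map_sub, map_smul, add_apply, sub_apply, smul_apply, smul_eq_mul, h7]
        ring
      rw [h6]
      rcases ht1.eq_or_lt with ht | ht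
      · rw [ht]
        linarith
      · have h8 : 0 < (1 - t) ^ 2 := pow_pos (sub_pos.2 ht) 2
        nlinarith [mul_neg_of_pos_of_neg h8 h5,
          mul_nonneg (mul_nonneg ht0 (sub_pos.2 ht).le) (neg_nonneg.2 h3.le),
          mul_nonneg (sq_nonneg t) (neg_nonneg.2 h4.le)]
    · rw [hY, hc0 p hp, zero_smul, add_zero]
      exact hXt p
  · have hyt : y ∈ ψ.target := hball (Metric.ball_subset_ball (by linarith) hy)
    have hc1 : c (ψ.symm y) = 1 := by
      simp only [c, if_pos (ψ.map_target hyt), ψ.right_inv hyt]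
      exact b.one_of_mem_closedBall (Metric.ball_subset_closedBall hy)
    have h1 : Y (ψ.symm y) = coordField ψ v (ψ.symm y) := by
      rw [hY, hc1, one_smul, add_sub_cancel]
    rw [← pushVector_coordField hψ v hyt, pushVector, pushVector, h1]

end LipschitzSpacetime

end
noncomputable section

namespace LipschitzSpacetime

variable {n : ℕ}

/-! ## Regularity of the Ricci deficit -/

theorem contDiffAt_christoffel {G : Model n → Matrix (Fin n) (Fin n) ℝ} {x : Model n}
    (h : ∀ a b, ContDiffAt ℝ ∞ (fun z => G z a b) x) (hd : (G x).det ≠ 0) (k i j : Fin n) :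
    ContDiffAt ℝ ∞ (christoffel G k i j) x :=
  contDiffAt_const.mul (ContDiffAt.sum fun l _ => (contDiffAt_inv_apply h hd k l).mul
    ((((h j l).pderiv i).add ((h i l).pderiv j)).sub ((h i j).pderiv l)))

theorem continuousAt_ricci {G : Model n → Matrix (Fin n) (Fin n) ℝ} {x : Model n}
    (h : ∀ a b, ContDiffAt ℝ ∞ (fun z => G z a b) x) (hd : (G x).det ≠ 0) (i j : Fin n) :
    ContinuousAt (ricci G i j) x := by
  have hc := contDiffAt_christoffel h hd
  refine ContDiffAt.continuousAt (n := ∞) (𝕜 := ℝ) (ContDiffAt.add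
    (ContDiffAt.sum fun k _ => ((hc k i j).pderiv k).sub ((hc k i k).pderiv j))
    (ContDiffAt.sum fun k _ => ContDiffAt.sum fun l _ =>
      ((hc k i j).mul (hc l k l)).sub ((hc k i l).mul (hc l j k))))

variable {M : Type*} [TopologicalSpace M] [ChartedSpace (Model n) M]
  {ψ : OpenPartialHomeomorph M (Model n)}

/-- Used for measurability, which the passage from almost everywhere convergence to L^p requires. -/
theorem continuousOn_ricciDeficit [IsManifold (𝓡 n) ∞ M] (hψ : ψ ∈ smoothCharts n M)
    {g : BilinField n M} (hg : IsLorentzian g) (hgs : SmoothBilin g) {X : VectorField n M}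
    (hX : SmoothVectorField X) (c : ℝ) : ContinuousOn (ricciDeficit ψ g c X) ψ.target := by
  have hXc : ∀ i, ContinuousOn (fun y => pushVector ψ X y i) ψ.target := fun i =>
    (EuclideanSpace.proj (𝕜 := ℝ) i).continuous.comp_continuousOn
      (hX.contDiffOn_pushVector hψ).continuousOn
  have h1 : ∀ i j, ContinuousOn (ricci (gram ψ g) i j) ψ.target := fun i j y hy =>
    (continuousAt_ricci (fun a b => hgs.contDiffAt_gram hψ hy a b) (hg.det_gram_ne_zero hψ hy)
      i j).continuousWithinAt
  have h2 : ∀ i j, ContinuousOn (fun y => gram ψ g y i j) ψ.target := fun i j y hy =>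
    (hgs.contDiffAt_gram hψ hy i j).continuousAt.continuousWithinAt
  refine ContinuousOn.sup (ContinuousOn.neg (ContinuousOn.sub ?_ (continuousOn_const.mul ?_)))
    continuousOn_const
  · exact continuousOn_finsetSum _ fun i _ => continuousOn_finsetSum _ fun j _ =>
      ((h1 i j).mul (hXc i)).mul (hXc j)
  · exact continuousOn_finsetSum _ fun i _ => continuousOn_finsetSum _ fun j _ =>
      ((h2 i j).mul (hXc i)).mul (hXc j)

/-! ## The distributional Ricci bound in coordinates -/

theorem BddTendsto.abs {L : Set (Model n)} {f : ℕ → Model n → ℝ}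
    (hf : BddTendsto L f fun _ => 0) : BddTendsto L (fun k x => |f k x|) fun _ => 0 := by
  refine ⟨?_, ?_⟩
  · obtain ⟨C, hC⟩ := hf.bdd
    exact ⟨C, hC.mono fun k hk x hx => by rw [abs_abs]; exact hk x hx⟩
  · filter_upwards [hf.tendsto] with x hx hxL
    simpa using (hx hxL).abs

/-- A Lipschitz metric is negative on the constant extensions of uniformly timelike vectors, on balls
of uniform radius. -/
theorem exists_radius_neg {G : Model n → Matrix (Fin n) (Fin n) ℝ} {C : NNReal}
    (hG : ∀ a b, LipschitzWith C fun z => G z a b) (B : ℝ) {c : ℝ} (hc : c < 0) :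
    ∃ r > 0, ∀ x v : Model n, ‖v‖ ≤ B → (∑ i, ∑ j, G x i j * v i * v j) < c →
      ∀ y ∈ Metric.ball x r, (∑ i, ∑ j, G y i j * v i * v j) < 0 := by
  set D : ℝ := ∑ _i : Fin n, ∑ _j : Fin n, C * (|B| * |B|) with hD
  have hD0 : 0 ≤ D := Finset.sum_nonneg fun _ _ => Finset.sum_nonneg fun _ _ => by positivity
  -- D is a Lipschitz constant of y ↦ g_y(v, v) valid for all |v| ≤ B; adding one keeps the
  -- denominator positive.
  refine ⟨-c / (D + 1), div_pos (neg_pos.2 hc) (by positivity), fun x v hv hx y hy => ?_⟩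
  have hvB : ∀ i, |v i| ≤ |B| := fun i =>
    (PiLp.norm_apply_le v i).trans (hv.trans (le_abs_self B))
  have h1 : (∑ i, ∑ j, G y i j * v i * v j) - ∑ i, ∑ j, G x i j * v i * v j ≤ D * dist y x := by
    rw [← Finset.sum_sub_distrib, hD, Finset.sum_mul]
    refine Finset.sum_le_sum fun i _ => ?_
    rw [← Finset.sum_sub_distrib, Finset.sum_mul]
    refine Finset.sum_le_sum fun j _ => ?_
    have h2 : |G y i j - G x i j| ≤ C * dist y x := (hG i j).dist_le_mul y x
    calc G y i j * v i * v j - G x i j * v i * v j = (G y i j - G x i j) * (v i * v j) := by ring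
      _ ≤ |G y i j - G x i j| * (|v i| * |v j|) := by
        rw [← abs_mul, ← abs_mul]
        exact le_abs_self _
      _ ≤ C * dist y x * (|B| * |B|) := by
        have := hvB i
        have := hvB j
        gcongr
      _ = C * (|B| * |B|) * dist y x := by ring
  have h3 := (lt_div_iff₀ (by positivity)).1 (Metric.mem_ball.1 hy)
  nlinarith [dist_nonneg (x := y) (y := x)]

/-- The distributional bound is applied at each x and k with its own vector field, equal to the
constant v = X_k(x) near x, and its own test function. As the field is constant on the support,
pairing the distribution with it gives exactly the averaged tensor on v. -/
theorem eventually_ricciAverage_nonneg [T2Space M] [IsManifold (𝓡 n) ∞ M]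
    (hψ : ψ ∈ smoothCharts n M) {g : BilinField n M} (hg : IsLorentzian g)
    (hgL : LocLipschitzBilin g) {L N : Set (Model n)} {G : Model n → Matrix (Fin n) (Fin n) ℝ}
    {Gk : ℕ → Model n → Matrix (Fin n) (Fin n) ℝ} {H : ℝ × Model n × Model n → ℝ} {ε : ℕ → ℝ}
    (h : RicciApproximation L N G Gk H ε) (hNψ : N ⊆ ψ.target) (hGN : ∀ z ∈ N, G z = gram ψ g z)
    (hH : ∀ x ∈ N, ∀ w, 0 ≤ H (0, x, w)) {ρ : ℝ}
    (hRic : ∀ X : VectorField n M, SmoothVectorField X → Timelike g X → RicciLowerBound g ρ X)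
    {X : ℕ → VectorField n M} (hX : ∀ k, SmoothVectorField (X k)) {B : ℝ}
    (hXB : ∀ k, ∀ y ∈ L, ‖pushVector ψ (X k) y‖ ≤ B) (hXt : LocUniformlyTimelike g X) :
    ∀ᶠ k in atTop, ∀ x ∈ L, 0 ≤ ∑ i, ∑ j, (ricciAverage G H (ε k) i j x
      - ρ * ∫ w, H (0, x, w) * G (x + ε k • w) i j)
        * pushVector ψ (X k) x i * pushVector ψ (X k) x j := by
  have hLψ := h.subset.trans hNψ
  obtain ⟨r₁, hr₁, hr₁N⟩ := h.exists_radius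
  obtain ⟨C, hC⟩ := h.lipschitz
  obtain ⟨c, hc, hXc⟩ := hXt _ (h.isCompact.image_of_continuousOn (ψ.symm.continuousOn.mono hLψ))
  obtain ⟨r₂, hr₂, hneg⟩ := exists_radius_neg hC B hc
  obtain ⟨R, hR⟩ := h.kernel.support
  -- Uniform timelikeness on one-point compact sets.
  have hXtime : ∀ k, Timelike g (X k) := fun k p => by
    obtain ⟨c', hc', hp⟩ := hXt {p} isCompact_singleton
    exact (hp k p rfl).trans hc'
  set r := min r₁ r₂ with hr
  have hr0 : 0 < r := lt_min hr₁ hr₂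
  -- Eventually the support of the test function fits into the half ball on which the extended field
  -- is constant. The radius is common to all x and k, so this is uniform in x.
  have hεR : ∀ᶠ k in atTop, ε k * R < r / 2 := by
    have h1 : Tendsto (fun k => ε k * R) atTop (𝓝 0) := by
      simpa using h.tendsto_zero.mul_const R
    exact h1.eventually (gt_mem_nhds (half_pos hr0))
  have hi1 : ∀ᶠ k in atTop, ∀ m c i j, ∀ x ∈ L, Integrable fun w =>
      dw m H (0, x, w) * christoffel G c i j (x + ε k • w) := by
    simp only [eventually_all]
    exact fun m c i j => RicciApproximation.eventually_integrable_mul_christoffel h (h.kernel.dw m) c i j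
  have hi2 : ∀ᶠ k in atTop, ∀ i j, ∀ x ∈ L, Integrable fun w =>
      H (0, x, w) * ricciQuadratic G i j (x + ε k • w) := by
    simp only [eventually_all]
    exact fun i j => RicciApproximation.eventually_integrable_mul_ricciQuadratic h i j
  filter_upwards [hεR, hi1, hi2] with k hkR hk1 hk2 x hx
  have hεk := h.pos' k
  have hballN : Metric.ball x r ⊆ N := fun y hy => hr₁N (Metric.mem_cthickening_of_dist_le y x r₁ L hx
    ((Metric.mem_ball.1 hy).le.trans (min_le_left _ _)))
  have hgram : ∀ y ∈ N, ∀ v, pushBilin ψ g y v v = ∑ i, ∑ j, G y i j * v i * v j :=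
    fun y hy v => by rw [pushBilin_eq_sum_gram, hGN y hy]
  obtain ⟨Y, hYs, hYt, hYv⟩ := exists_timelike_extension hg hψ (hgL.continuousOn hψ) (hX k)
    (hXtime k) (x := x) hr0 (hballN.trans hNψ) fun y hy => by
      rw [hgram y (hballN hy)]
      refine hneg x _ (hXB k x hx) ?_ y
        (Metric.ball_subset_ball (min_le_right _ _) hy)
      rw [← hgram x (h.subset hx), pushBilin_pushVector hψ _ _ _ (hLψ hx)]
      exact hXc k _ (mem_image_of_mem _ hx)
  have hsub : Metric.ball x (r / 2) ⊆ Metric.ball x r := Metric.ball_subset_ball (by linarith)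
  have hsupp := tsupport_testFunction_subset (H := H) hR hεk x
  have h1 := hRic Y hYs hYt ψ hψ (testFunction H (ε k) x) (contDiff_testFunction h.kernel _ _)
    ((isCompact_closedBall _ _).of_isClosed_subset (isClosed_tsupport _) hsupp)
    (hsupp.trans ((Metric.closedBall_subset_ball hkR).trans (hsub.trans (hballN.trans hNψ))))
    fun y => mul_nonneg (inv_nonneg.2 (pow_pos hεk n).le) (hH x (h.subset hx) _)
  rw [ricciDistribution_testFunction (G := G) h.kernel hR hεk ψ.open_target h.isOpen
      (fun y hy => (hGN y hy).symm) hkR (hsub.trans (hballN.trans hNψ)) (hsub.trans hballN) hYv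
      (fun m c i j => hk1 m c i j x hx) (fun i j => hk2 i j x hx),
    metricEval_testFunction (G := G) h.kernel hR hεk ψ.open_target
      (fun y hy => (hGN y hy).symm) hkR (hsub.trans (hballN.trans hNψ)) (hsub.trans hballN) hYv
      h.continuous] at h1
  refine h1.trans_eq ?_
  rw [Finset.mul_sum, ← Finset.sum_sub_distrib]
  refine Finset.sum_congr rfl fun i _ => ?_
  rw [Finset.mul_sum, ← Finset.sum_sub_distrib]
  exact Finset.sum_congr rfl fun j _ => by ring

/-- The averaged tensor is nonnegative on X_k(x), so the negative part is controlled by the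
difference between the tensor of g_k and the averaged one, times the squared bound on X_k. -/
theorem bddTendsto_ricciDeficit [T2Space M] [IsManifold (𝓡 n) ∞ M] (i₀ : Fin n)
    (h : Bundle.ContMDiffRiemannianMetric (𝓡 n) ∞ (Model n) (fun x : M => TangentSpace (𝓡 n) x))
    {g : BilinField n M} (hg : IsLorentzian g) (hgL : LocLipschitzBilin g)
    {d : RegularisationData n M} {gk : ℕ → BilinField n M} (hgk : IsInnerApproximation d g gk)
    {ρ : ℝ}
    (hRic : ∀ X : VectorField n M, SmoothVectorField X → Timelike g X → RicciLowerBound g ρ X)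
    {X : ℕ → VectorField n M} (hX : ∀ k, SmoothVectorField (X k))
    (hXB : LocUniformlyBounded h.inner X) (hXt : LocUniformlyTimelike g X)
    (hψ : ψ ∈ smoothCharts n M) {L : Set (Model n)} (hL : IsCompact L) (hLψ : L ⊆ ψ.target) :
    BddTendsto L (fun k => ricciDeficit ψ (gk k) ρ (X k)) fun _ => 0 := by
  obtain ⟨N, G, H, ε, hR, hNψ, hGN, hH⟩ :=
    hgk.exists_ricciApproximation i₀ hg hgL hψ hL hLψ
  obtain ⟨B, hB⟩ := exists_norm_pushVector_le h hψ hL hLψ hXB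
  have hbound : BddTendsto L (fun k x => ∑ i, ∑ j, |B| * |B| *
      |(ricci (gram ψ (gk k)) i j x - ricciAverage G H (ε k) i j x)
        - ρ * (gram ψ (gk k) x i j - ∫ w, H (0, x, w) * G (x + ε k • w) i j)|) fun _ => 0 := by
    have h1 := BddTendsto.sum Finset.univ fun i _ => BddTendsto.sum Finset.univ fun j _ =>
      ((((hR.bddTendsto_ricci i j).sub ((hR.bddTendsto_metric i j).const_mul ρ)).congr
        (Eventually.of_forall fun k x _ => rfl)
        (g₀ := fun _ => 0) (Eventually.of_forall fun x _ => by simp)).abs).const_mul (|B| * |B|)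
    exact h1.congr (Eventually.of_forall fun k x _ => rfl) (Eventually.of_forall fun x _ => by simp)
  refine hbound.of_nonneg_of_le (fun k x _ => le_max_right _ _) ?_
  filter_upwards [eventually_ricciAverage_nonneg hψ hg hgL hR hNψ hGN hH hRic hX hB hXt]
    with k hk x hx
  have h0 := hk x hx
  set v := pushVector ψ (X k) x with hv
  have hvB : ∀ i, |v i| ≤ |B| := fun i =>
    (PiLp.norm_apply_le v i).trans ((hB k x hx).trans (le_abs_self B))
  refine max_le ?_ (Finset.sum_nonneg fun _ _ => Finset.sum_nonneg fun _ _ => by positivity)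
  -- Adding the nonnegative averaged quantity turns the expression into minus a difference of
  -- tensors, to be estimated componentwise.
  refine (le_add_of_nonneg_right h0).trans ?_
  simp only [ricciEval, metricEval, ← hv, Finset.mul_sum, ← Finset.sum_sub_distrib,
    ← Finset.sum_neg_distrib, ← Finset.sum_add_distrib]
  refine Finset.sum_le_sum fun i _ => Finset.sum_le_sum fun j _ => ?_
  set a := ricci (gram ψ (gk k)) i j x - ricciAverage G H (ε k) i j x
    - ρ * (gram ψ (gk k) x i j - ∫ w, H (0, x, w) * G (x + ε k • w) i j) with ha
  have h1 : -(a * (v i * v j)) ≤ |B| * |B| * |a| := by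
    refine (neg_le_abs _).trans ?_
    rw [abs_mul, abs_mul, mul_comm]
    have := hvB i
    have := hvB j
    gcongr
  refine le_trans (le_of_eq ?_) h1
  rw [ha]
  ring

end LipschitzSpacetime

end
-- Conclusion in L^p.
theorem mainTheorem6 {n : ℕ} (hn : 2 ≤ n)
    {M : Type*} [TopologicalSpace M] [T2Space M] [SecondCountableTopology M] [ConnectedSpace M]
    [ChartedSpace (LipschitzSpacetime.Model n) M] [IsManifold (𝓡 n) ∞ M]
    (h : Bundle.ContMDiffRiemannianMetric (𝓡 n) ∞ (LipschitzSpacetime.Model n)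
      (fun x : M => TangentSpace (𝓡 n) x))
    (g : LipschitzSpacetime.BilinField n M)
    (hg : LipschitzSpacetime.IsLorentzian g) (hgLip : LipschitzSpacetime.LocLipschitzBilin g)
    (d : LipschitzSpacetime.RegularisationData n M)
    (gk : ℕ → LipschitzSpacetime.BilinField n M)
    (hgk : LipschitzSpacetime.IsInnerApproximation d g gk)
    (ρ : ℝ)
    (hRic : ∀ X : LipschitzSpacetime.VectorField n M, LipschitzSpacetime.SmoothVectorField X →
      LipschitzSpacetime.Timelike g X → LipschitzSpacetime.RicciLowerBound g ρ X)
    (X : ℕ → LipschitzSpacetime.VectorField n M)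
    (hXsmooth : ∀ k, LipschitzSpacetime.SmoothVectorField (X k))
    (hXbdd : LipschitzSpacetime.LocUniformlyBounded h.inner X)
    (hXtime : LipschitzSpacetime.LocUniformlyTimelike g X)
    (K : Set M) (hK : IsCompact K) (p : ℝ≥0∞) (hp : 1 ≤ p) (hp' : p ≠ ⊤) :
    LipschitzSpacetime.TendstoZeroLp K p
      (fun k ψ => LipschitzSpacetime.ricciDeficit ψ (gk k) ρ (X k)) := by
  intro ψ hψ L hL hLK
  have hLs : L ⊆ ψ.source := fun x hx => (hLK hx).2
  have hL' : IsCompact (ψ '' L) := hL.image_of_continuousOn (ψ.continuousOn.mono hLs)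
  have hLψ : ψ '' L ⊆ ψ.target := by
    rintro _ ⟨x, hx, rfl⟩
    exact ψ.map_source (hLs hx)
  -- Positive dimension supplies the index that selects the scalar kernel H.
  refine (LipschitzSpacetime.bddTendsto_ricciDeficit ⟨0, by omega⟩ h hg hgLip hgk hRic hXsmooth
    hXbdd hXtime hψ hL' hLψ).tendsto_eLpNorm hL' (fun k => ?_) hp hp'
  exact ((LipschitzSpacetime.continuousOn_ricciDeficit hψ (hgk.lorentzian k) (hgk.smooth k)
    (hXsmooth k) ρ).mono hLψ).aestronglyMeasurable hL'.measurableSet
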